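/- Let $p\ge 1$ and $q$ be coprime integers, $r=q/p$, let $K(r)\subset S^3$ be the $2$-bridge link of slope $r$, the union of the rational tangles $(B^3,t(\infty))$ and $(B^3,t(r))$ of slopes $\infty$ and $r$, and let $G(r)=\pi_1(S^3\setminus K(r))$. It is a knot if $p$ is odd and a $2$-component link if $p$ is even. Let $\tau_+$ and $\tau_-$ be the upper and lower tunnels, the core arcs of $t(\infty)$ and $t(r)$. Let $(\mathbb Z_2)^2$ be the group of symmetries of $(S^3,K(r))$ induced by the translations by $\mathbb Z^2$ of the Conway sphere $(\mathbb R^2,\mathbb Z^2)/\mathcal J$ (the common boundary of the two tangles), where $\mathcal J$ is generated by the $\pi$-rotations about the points of $\mathbb Z^2$. If $p$ is odd, let $h_+$ (resp. $h_-$) be the strong inversion in this group whose fixed circle contains $\tau_+$ (resp. $\tau_-$); the arc $\tau_\pm^c$ of this circle complementary to $\tau_\pm$ is the long upper (resp. lower) tunnel. If $p$ is even, let $h$ be the strong inversion in this group whose fixed circle contains both $\tau_+$ and $\tau_-$; the two other arcs $\tau_L$, $\tau_R$ into which $K(r)$ cuts this circle are the intermediate tunnels. A tunnel $\tau$ determines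 a pair $\{m_1,m_2\}$ of meridians in $G(r)$, represented by $\tau$ together with small meridional loops at its two endpoints; it is well defined up to inverting each $m_i$ and simultaneous conjugation. The pairs determined by $\tau_+^c$, $\tau_-^c$ and $\tau_L,\tau_R$ are called the long upper, long lower and intermediate meridian pairs. Let $M(K(r))$ be the double covering of $S^3$ branched over $K(r)$, and let $O(r)$ be the quotient of $G(r)$ by the normal closure of the squares of the meridians. Then $H_1(M(K(r)))\cong\mathbb Z_p$ is a subgroup of index two of $O(r)$: the class of a loop in $M(K(r))$ that avoids the branch set is identified with the element of $O(r)$ represented by the image of that loop in $S^3\setminus K(r)$. For a meridian pair, let $\omega(m_1,m_2)\in O(r)$ be the element represented by $m_1m_2$; it lies in $H_1(M(K(r)))$. (1) Let $p$ be odd and let $\{m_1,m_2\}$ be the long upper or the long lower meridian pair of the knot group $G(r)$. Then $\omega(m_1,m_2)=0$ in $H_1(M(K(r)))\cong\mathbb Z_p$. In particular, if $p\ge 3$, then $\omega(m_1,m_2)$ is not a generator of $H_1(M(K(r)))$, and $\{m_1,m_2\}$ does not generate $G(r)$. (2) Let $p$ be even and let $\{m_1,m_2\}$ be an intermediate meridian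 pair of the link group $G(r)$. Then $2\,\omega(m_1,m_2)=0$ in $H_1(M(K(r)))\cong\mathbb Z_p$. In particular, if $p\ge 4$, then $\omega(m_1,m_2)$ is not a generator of $H_1(M(K(r)))$, and $\{m_1,m_2\}$ does not generate $G(r)$. -/

import Mathlib

/-! ## Links, meridians, tunnels, and the `π`-orbifold group -/

section Links

variable {X : Type*} [TopologicalSpace X]

/-- The class in `π₁(X, x)` of a loop at `x`. -/
noncomputable def loopClass {x : X} (l : Path x x) : FundamentalGroup X x :=
  FundamentalGroup.fromPath (Path.Homotopic.Quotient.mk l)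

/-- A tubular chart of a one-dimensional `K ⊆ X`: an open embedding of `ℂ × ℝ` into `X` in which
`K` is the axis `{0} × ℝ`. The discs `ℂ × {s}` are meridian discs of `K`. -/
structure TubularChart (K : Set X) where
  toFun : ℂ × ℝ → X
  isOpenEmbedding : Topology.IsOpenEmbedding toFun
  mem_iff : ∀ z s, toFun (z, s) ∈ K ↔ z = 0

namespace TubularChart

variable {K : Set X}

/-- The base point of the meridional loop of a tubular chart. -/
def base (φ : TubularChart K) : ↥Kᶜ :=
  ⟨φ.toFun (1, 0), fun h => one_ne_zero ((φ.mem_iff 1 0).1 h)⟩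

/-- The meridional loop `t ↦ (exp (2πit), 0)` of a tubular chart. -/
noncomputable def loop (φ : TubularChart K) : Path φ.base φ.base where
  toFun t := ⟨φ.toFun (Complex.exp (2 * Real.pi * Complex.I * ((t : ℝ) : ℂ)), 0),
    fun h => Complex.exp_ne_zero _ ((φ.mem_iff _ 0).1 h)⟩
  continuous_toFun := by
    refine Continuous.subtype_mk (φ.isOpenEmbedding.continuous.comp ?_) _
    fun_prop
  source' := by
    apply Subtype.ext
    simp [base]
  target' := by
    apply Subtype.ext
    simp [base, Complex.exp_two_pi_mul_I]

end TubularChart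

/-- The meridians of the link group `π₁(X ∖ K, x)`: the elements freely homotopic to the
meridional loop of a tubular chart. (Both orientations occur, as `z ↦ conj z` is allowed.) -/
def IsMeridian (K : Set X) (x : ↥Kᶜ) (m : FundamentalGroup ↥Kᶜ x) : Prop :=
  ∃ (φ : TubularChart K) (α : Path x φ.base), m = loopClass ((α.trans φ.loop).trans α.symm)

/-- The `π`-orbifold group `O(K)`: the link group modulo the normal closure of the squares of
the meridians. -/
abbrev PiOrbifoldGroup (K : Set X) (x : ↥Kᶜ) : Type _ :=
  FundamentalGroup ↥Kᶜ x ⧸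
    Subgroup.normalClosure {g : FundamentalGroup ↥Kᶜ x | ∃ m, IsMeridian K x m ∧ g = m ^ 2}

/-- `ω(m₁, m₂)`: the element of the `π`-orbifold group represented by the product `m₁ m₂`. -/
noncomputable def meridianOmega {K : Set X} {x : ↥Kᶜ} (m₁ m₂ : FundamentalGroup ↥Kᶜ x) : PiOrbifoldGroup K x :=
  QuotientGroup.mk (m₁ * m₂)

/-- A tunnel for `K`: an arc `τ` in `X` with `τ ∩ K = ∂τ`. -/
structure Tunnel (K : Set X) where
  left : X
  right : X
  path : Path left right
  injective : Function.Injective path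
  mem_iff : ∀ t, path t ∈ K ↔ t = 0 ∨ t = 1

/-- Let `c : [0, 1] → X` be an arc which leaves `K` at time `0` and ends at `b ∉ K`. Then `m` is a
meridian of `K` *along `c`* if it is represented by the loop which runs from `b` back along `c`
until it is so near `c 0` that the rest of `c` lies in a tubular chart, then goes round the
meridional loop of that chart (reaching it inside the chart), and returns the same way.
Such an `m` is unique up to inversion. -/
def IsMeridianAlong (K : Set X) (c : ℝ → X) (b : ↥Kᶜ) (m : FundamentalGroup ↥Kᶜ b) : Prop :=
  (b : X) = c 1 ∧
  ∃ (φ : TubularChart K) (s : ℝ), 0 < s ∧ s ≤ 1 ∧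
    (∀ t, 0 ≤ t → t ≤ s → c t ∈ Set.range φ.toFun) ∧
    ∃ (z : ↥Kᶜ) (α : Path b z) (δ : Path z φ.base),
      (∀ u, (α u : X) = c (1 - (u : ℝ) * (1 - s))) ∧
      (∀ u, (δ u : X) ∈ Set.range φ.toFun) ∧
      m = loopClass (((α.trans δ).trans φ.loop).trans (α.trans δ).symm)

/-- `{m₁, m₂}` is a meridian pair of `π₁(X ∖ K, x)` determined by the tunnel `τ`: for some path
`β` from `x` to the midpoint of `τ`, transport along `β` takes `m₁`, `m₂` to meridians along the
two halves of `τ`. Such a pair is unique up to simultaneous conjugation and inversion of either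
member. -/
def IsMeridianPair {K : Set X} (τ : Tunnel K) {x : ↥Kᶜ} (m₁ m₂ : FundamentalGroup ↥Kᶜ x) : Prop :=
  ∃ (b : ↥Kᶜ) (β : Path x b),
    IsMeridianAlong K (fun t => τ.path.extend (t / 2)) b
      (FundamentalGroup.fundamentalGroupMulEquivOfPath β m₁) ∧
    IsMeridianAlong K (fun t => τ.path.extend (1 - t / 2)) b
      (FundamentalGroup.fundamentalGroupMulEquivOfPath β m₂)

/-- The first homology group of a path-connected space, as the abelianized fundamental group,
written additively. -/
abbrev HOne (M : Type*) [TopologicalSpace M] (y : M) : Type _ :=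
  Additive (Abelianization (FundamentalGroup M y))

/-- The class in `H₁(M)` of a loop in `M`. -/
noncomputable def homologyClass {M : Type*} [TopologicalSpace M] {y : M} (l : Path y y) :
    HOne M y :=
  Additive.ofMul (Abelianization.of (loopClass l))

/-- Let `π : M → X` be the double covering branched over `K`. This says that `ι` is the inclusion
of `H₁(M)` in `O(K)` as a subgroup of index two: the class of a loop of `M` which avoids the branch
set is sent to the element of `O(K)` represented by its image in `X ∖ K`. Every class of `H₁(M)`
contains such a loop, so `ι` is uniquely determined. -/
def IsHOneInclusion {M : Type*} [TopologicalSpace M] (K : Set X) (π : M → X) (y : M) (hy : π y ∉ K)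
    (ι : HOne M y →+ Additive (PiOrbifoldGroup K ⟨π y, hy⟩)) : Prop :=
  Function.Injective ι ∧ ι.range.index = 2 ∧
    ∀ (l : Path y y) (l' : Path (⟨π y, hy⟩ : ↥Kᶜ) ⟨π y, hy⟩), (∀ t, (l' t : X) = π (l t)) →
      ι (homologyClass l) = Additive.ofMul (QuotientGroup.mk (loopClass l'))

end Links

/-! ## The two-bridge link of slope `q / p`

The Conway sphere is `(ℝ², ℤ²) / J`, where `J` is generated by the `π`-rotations about the points
of `ℤ²`, so `J` consists of the maps `x ↦ ± x + 2n` with `n ∈ ℤ²`. In the plane, a line of slope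
`q / p` has direction `(p, q)`. The rational tangle of slope `q / p` is obtained from
`(ℝ² / J) × [0, 1]`, with strings `(ℤ² / J) × [0, 1]`, by crushing each line of slope `q / p` in
the level `1` to a point: so the simple loops of slope `q / p` bound discs in the complement of
the strings, and the level `1` becomes the core arc of the tangle, which joins the two strings.

The pair `(S³, K(q / p))` is the union of the rational tangle of slope `∞` (at the levels in
`[0, 1]`, crushed at level `1`) and the one of slope `q / p` (at the levels in `[-1, 0]`, crushed
at level `-1`). The double covering of `S³` branched over `K(q / p)` is obtained in the same way
from the torus `ℝ² / 2ℤ²`: it is the union of two solid tori. -/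

namespace TwoBridge

/-- Points `(x, t)` of `ℝ² × [-1, 1]`. -/
abbrev Pt : Type := (ℝ × ℝ) × Set.Icc (-1 : ℝ) 1

/-- The vectors along which level `t` is crushed: the line of slope `∞` at `t = 1`, the line of
slope `q / p` at `t = -1`, and only `0` in between. -/
noncomputable def crushed (p q : ℤ) (t : ℝ) : Submodule ℝ (ℝ × ℝ) :=
  if t = 1 then Submodule.span ℝ {((0 : ℝ), (1 : ℝ))}
  else if t = -1 then Submodule.span ℝ {((p : ℝ), (q : ℝ))}
  else ⊥

/-- The translations of level `t` by which one passes to the quotient torus (crushed to a circle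
at the levels `± 1`): sums of a vector of `2ℤ²` and a crushed vector. -/
def IsPeriod (p q : ℤ) (t : ℝ) (v : ℝ × ℝ) : Prop :=
  ∃ a b : ℤ, v - (2 * (a : ℝ), 2 * (b : ℝ)) ∈ crushed p q t

theorem IsPeriod.zero (p q : ℤ) (t : ℝ) : IsPeriod p q t 0 :=
  ⟨0, 0, by simp [← Prod.zero_eq_mk]⟩

theorem IsPeriod.neg {p q : ℤ} {t : ℝ} {v : ℝ × ℝ} (h : IsPeriod p q t v) :
    IsPeriod p q t (-v) := by
  obtain ⟨a, b, h⟩ := h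
  refine ⟨-a, -b, ?_⟩
  convert (crushed p q t).neg_mem h using 1
  ext <;> simp <;> ring

theorem IsPeriod.add {p q : ℤ} {t : ℝ} {v w : ℝ × ℝ} (hv : IsPeriod p q t v)
    (hw : IsPeriod p q t w) : IsPeriod p q t (v + w) := by
  obtain ⟨a, b, h⟩ := hv
  obtain ⟨c, d, h'⟩ := hw
  refine ⟨a + c, b + d, ?_⟩
  convert (crushed p q t).add_mem h h' using 1
  ext <;> simp <;> ring

theorem IsPeriod.sub {p q : ℤ} {t : ℝ} {v w : ℝ × ℝ} (hv : IsPeriod p q t v)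
    (hw : IsPeriod p q t w) : IsPeriod p q t (v - w) := by
  simpa [sub_eq_add_neg] using hv.add hw.neg

/-- The equivalence relation on `ℝ² × [-1, 1]` whose quotient is the double branched covering. -/
def coverSetoid (p q : ℤ) : Setoid Pt where
  r a b := a.2 = b.2 ∧ IsPeriod p q a.2 (b.1 - a.1)
  iseqv :=
    { refl := fun a => ⟨rfl, by simpa using IsPeriod.zero p q a.2⟩
      symm := fun {a b} h => ⟨h.1.symm, by
        have := h.2.neg
        rw [h.1] at this
        simpa using this⟩
      trans := fun {a b c} h h' => ⟨h.1.trans h'.1, by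
        have := h'.2
        rw [← h.1] at this
        simpa using this.add h.2⟩ }

/-- The equivalence relation on `ℝ² × [-1, 1]` whose quotient is the three-sphere: at each level,
`x` is identified with `± x + v` for every period `v`. -/
def sphereSetoid (p q : ℤ) : Setoid Pt where
  r a b := a.2 = b.2 ∧ (IsPeriod p q a.2 (b.1 - a.1) ∨ IsPeriod p q a.2 (b.1 + a.1))
  iseqv :=
    { refl := fun a => ⟨rfl, Or.inl (by simpa using IsPeriod.zero p q a.2)⟩
      symm := fun {a b} h => ⟨h.1.symm, by
        rw [← h.1]
        rcases h.2 with h' | h'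
        · exact Or.inl (by simpa using h'.neg)
        · exact Or.inr (by simpa [add_comm] using h')⟩
      trans := fun {a b c} h h' => ⟨h.1.trans h'.1, by
        have h2 := h'.2
        rw [← h.1] at h2
        rcases h.2 with h1 | h1 <;> rcases h2 with h2 | h2
        · exact Or.inl (by simpa using h2.add h1)
        · refine Or.inr ?_
          convert h2.sub h1 using 1
          abel
        · refine Or.inr ?_
          convert h2.add h1 using 1
          abel
        · refine Or.inl ?_
          convert h2.sub h1 using 1
          abel⟩ }

/-- The three-sphere, as the union of the rational tangles of slopes `∞` and `q / p`. -/
def Sphere (p q : ℤ) : Type := Quotient (sphereSetoid p q)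

/-- The double covering of the three-sphere branched over the two-bridge link of slope `q / p`. -/
def DoubleCover (p q : ℤ) : Type := Quotient (coverSetoid p q)

instance (p q : ℤ) : TopologicalSpace (Sphere p q) :=
  inferInstanceAs (TopologicalSpace (Quotient (sphereSetoid p q)))

instance (p q : ℤ) : TopologicalSpace (DoubleCover p q) :=
  inferInstanceAs (TopologicalSpace (Quotient (coverSetoid p q)))

/-- The point of the three-sphere represented by `(x, t)`. -/
def mk (p q : ℤ) (a : Pt) : Sphere p q := Quotient.mk (sphereSetoid p q) a

theorem mk_eq_mk {p q : ℤ} {a b : Pt} : mk p q a = mk p q b ↔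
    a.2 = b.2 ∧ (IsPeriod p q a.2 (b.1 - a.1) ∨ IsPeriod p q a.2 (b.1 + a.1)) :=
  Quotient.eq (r := sphereSetoid p q)

theorem mk_surjective {p q : ℤ} : Function.Surjective (mk p q) := Quotient.mk_surjective

theorem continuous_mk {p q : ℤ} : Continuous (mk p q) := continuous_quotient_mk'

/-- The two-bridge link `K(q / p)`, the image of `ℤ² × [-1, 1]`. -/
def link (p q : ℤ) : Set (Sphere p q) :=
  {P | ∃ (a b : ℤ) (t : Set.Icc (-1 : ℝ) 1), P = mk p q (((a : ℝ), (b : ℝ)), t)}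

/-- The projection of the double branched covering; it is the quotient map by the covering
involution `deck` below. -/
def proj (p q : ℤ) : DoubleCover p q → Sphere p q :=
  Quotient.map' (s₁ := coverSetoid p q) (s₂ := sphereSetoid p q) id
    (fun _ _ h => ⟨h.1, Or.inl h.2⟩)

/-- The covering involution of the double branched covering, induced by `(x, t) ↦ (-x, t)`. -/
def deck (p q : ℤ) : DoubleCover p q → DoubleCover p q :=
  Quotient.map' (s₁ := coverSetoid p q) (s₂ := coverSetoid p q) (fun c => (-c.1, c.2))
    (fun c d h => ⟨h.1, by
      have := h.2.neg
      simpa [add_comm, sub_eq_add_neg] using this⟩)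

/-- The fibres of the double branched covering are the orbits of the covering involution. -/
theorem proj_eq_proj {p q : ℤ} {y z : DoubleCover p q} :
    proj p q y = proj p q z ↔ z = y ∨ z = deck p q y := by
  induction y using Quotient.inductionOn with | _ c
  induction z using Quotient.inductionOn with | _ d
  have h1 : proj p q (Quotient.mk (coverSetoid p q) c) = proj p q (Quotient.mk (coverSetoid p q) d)
      ↔ (sphereSetoid p q).r c d := Quotient.eq (r := sphereSetoid p q)
  have h2 : Quotient.mk (coverSetoid p q) d = Quotient.mk (coverSetoid p q) c ↔
      (coverSetoid p q).r c d := eq_comm.trans (Quotient.eq (r := coverSetoid p q))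
  have h3 : Quotient.mk (coverSetoid p q) d = deck p q (Quotient.mk (coverSetoid p q) c) ↔
      (coverSetoid p q).r (-c.1, c.2) d :=
    eq_comm.trans (Quotient.eq (r := coverSetoid p q))
  refine h1.trans (Iff.trans ?_ (or_congr h2 h3).symm)
  change (c.2 = d.2 ∧ (IsPeriod p q c.2 (d.1 - c.1) ∨ IsPeriod p q c.2 (d.1 + c.1))) ↔
    (c.2 = d.2 ∧ IsPeriod p q c.2 (d.1 - c.1)) ∨ (c.2 = d.2 ∧ IsPeriod p q c.2 (d.1 - -c.1))
  rw [sub_neg_eq_add]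
  tauto

/-- The covering involution fixes exactly the points over the link. -/
theorem deck_eq_self {p q : ℤ} {y : DoubleCover p q} :
    deck p q y = y ↔ proj p q y ∈ link p q := by
  induction y using Quotient.inductionOn with | _ c
  obtain ⟨x, t⟩ := c
  have h1 : deck p q (Quotient.mk (coverSetoid p q) (x, t)) = Quotient.mk (coverSetoid p q) (x, t)
      ↔ (coverSetoid p q).r (-x, t) (x, t) := Quotient.eq (r := coverSetoid p q)
  rw [h1]
  change (t = t ∧ IsPeriod p q t (x - -x)) ↔ mk p q (x, t) ∈ link p q
  constructor
  · rintro ⟨_, a, b, h⟩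
    refine ⟨a, b, t, mk_eq_mk.2 ⟨rfl, Or.inl ⟨0, 0, ?_⟩⟩⟩
    convert (crushed p q t).smul_mem (-1 / 2 : ℝ) h using 1
    ext <;> simp <;> ring
  · rintro ⟨a, b, t', h⟩
    refine ⟨rfl, ?_⟩
    obtain ⟨_, ⟨c, d, h⟩ | ⟨c, d, h⟩⟩ := mk_eq_mk.1 h
    · refine ⟨a - 2 * c, b - 2 * d, ?_⟩
      convert (crushed p q t).smul_mem (-2 : ℝ) h using 1
      ext <;> simp <;> ring
    · refine ⟨-a + 2 * c, -b + 2 * d, ?_⟩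
      convert (crushed p q t).smul_mem (2 : ℝ) h using 1
      ext <;> simp <;> ring

theorem crushed_one {p q : ℤ} {v : ℝ × ℝ} : v ∈ crushed p q 1 ↔ v.1 = 0 := by
  rw [crushed, if_pos rfl, Submodule.mem_span_singleton]
  constructor
  · rintro ⟨c, rfl⟩
    simp
  · intro h
    exact ⟨v.2, by ext <;> simp [h]⟩

theorem crushed_neg_one {p q : ℤ} (hpq : IsCoprime p q) {v : ℝ × ℝ} :
    v ∈ crushed p q (-1) ↔ (q : ℝ) * v.1 = p * v.2 := by
  rw [crushed, if_neg (by norm_num), if_pos rfl, Submodule.mem_span_singleton]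
  constructor
  · rintro ⟨c, rfl⟩
    simp only [Prod.smul_mk, smul_eq_mul]
    ring
  · intro h
    obtain ⟨a, b, hab⟩ := hpq
    have hab' : (a : ℝ) * p + b * q = 1 := by exact_mod_cast hab
    refine ⟨a * v.1 + b * v.2, ?_⟩
    ext
    · simp only [Prod.smul_mk, smul_eq_mul]
      linear_combination v.1 * hab' - b * h
    · simp only [Prod.smul_mk, smul_eq_mul]
      linear_combination v.2 * hab' + a * h

theorem isPeriod_one {p q : ℤ} {v : ℝ × ℝ} : IsPeriod p q 1 v ↔ ∃ a : ℤ, v.1 = 2 * a := by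
  simp only [IsPeriod, crushed_one, Prod.fst_sub, sub_eq_zero]
  exact ⟨fun ⟨a, _, h⟩ => ⟨a, h⟩, fun ⟨a, h⟩ => ⟨a, 0, h⟩⟩

theorem isPeriod_neg_one {p q : ℤ} (hpq : IsCoprime p q) {v : ℝ × ℝ} :
    IsPeriod p q (-1) v ↔ ∃ c : ℤ, (q : ℝ) * v.1 - p * v.2 = 2 * c := by
  simp only [IsPeriod, crushed_neg_one hpq, Prod.fst_sub, Prod.snd_sub]
  constructor
  · rintro ⟨a, b, h⟩
    refine ⟨q * a - p * b, ?_⟩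
    push_cast
    linear_combination h
  · rintro ⟨c, h⟩
    obtain ⟨a, b, hab⟩ := hpq
    have hab' : (a : ℝ) * p + b * q = 1 := by exact_mod_cast hab
    refine ⟨c * b, -(c * a), ?_⟩
    push_cast
    linear_combination h - 2 * c * hab'

theorem isPeriod_of_ne {p q : ℤ} {t : ℝ} (h1 : t ≠ 1) (h2 : t ≠ -1) {v : ℝ × ℝ} :
    IsPeriod p q t v ↔ ∃ a b : ℤ, v = (2 * (a : ℝ), 2 * (b : ℝ)) := by
  simp only [IsPeriod, crushed, if_neg h1, if_neg h2, Submodule.mem_bot, sub_eq_zero]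

theorem mem_link {p q : ℤ} {x : ℝ × ℝ} {t : Set.Icc (-1 : ℝ) 1} :
    mk p q (x, t) ∈ link p q ↔ ∃ a b : ℤ, IsPeriod p q t (x - ((a : ℝ), (b : ℝ))) := by
  constructor
  · rintro ⟨a, b, t', h⟩
    obtain ⟨_, h | h⟩ := mk_eq_mk.1 h
    · exact ⟨a, b, by simpa using h.neg⟩
    · refine ⟨-a, -b, ?_⟩
      convert h using 1
      ext <;> simp [add_comm]
  · rintro ⟨a, b, h⟩
    exact ⟨a, b, t, mk_eq_mk.2 ⟨rfl, Or.inl (by simpa using h.neg)⟩⟩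

theorem mem_link_one {p q : ℤ} {x : ℝ × ℝ} {t : Set.Icc (-1 : ℝ) 1} (ht : (t : ℝ) = 1) :
    mk p q (x, t) ∈ link p q ↔ ∃ a : ℤ, x.1 = a := by
  rw [mem_link, ht]
  simp only [isPeriod_one, Prod.fst_sub]
  constructor
  · rintro ⟨a, _, c, h⟩
    exact ⟨a + 2 * c, by push_cast; linear_combination h⟩
  · rintro ⟨a, h⟩
    exact ⟨a, 0, 0, by simp [h]⟩

theorem mem_link_neg_one {p q : ℤ} (hpq : IsCoprime p q) {x : ℝ × ℝ} {t : Set.Icc (-1 : ℝ) 1}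
    (ht : (t : ℝ) = -1) :
    mk p q (x, t) ∈ link p q ↔ ∃ c : ℤ, (q : ℝ) * x.1 - p * x.2 = c := by
  rw [mem_link, ht]
  simp only [isPeriod_neg_one hpq, Prod.fst_sub, Prod.snd_sub]
  constructor
  · rintro ⟨a, b, c, h⟩
    exact ⟨q * a - p * b + 2 * c, by push_cast; linear_combination h⟩
  · rintro ⟨c, h⟩
    obtain ⟨a, b, hab⟩ := hpq
    have hab' : (a : ℝ) * p + b * q = 1 := by exact_mod_cast hab
    refine ⟨c * b, -(c * a), 0, ?_⟩
    push_cast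
    linear_combination h - c * hab'

theorem mem_link_of_ne {p q : ℤ} {x : ℝ × ℝ} {t : Set.Icc (-1 : ℝ) 1} (h1 : (t : ℝ) ≠ 1)
    (h2 : (t : ℝ) ≠ -1) : mk p q (x, t) ∈ link p q ↔ ∃ a b : ℤ, x = ((a : ℝ), (b : ℝ)) := by
  rw [mem_link]
  simp only [isPeriod_of_ne h1 h2]
  constructor
  · rintro ⟨a, b, c, d, h⟩
    refine ⟨a + 2 * c, b + 2 * d, ?_⟩
    rw [sub_eq_iff_eq_add] at h
    rw [h]
    ext <;> simp <;> ring
  · rintro ⟨a, b, h⟩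
    exact ⟨a, b, 0, 0, by simp [h, ← Prod.zero_eq_mk]⟩

/-! ### Symmetries and tunnels

Translation of `ℝ²` by a vector of `ℤ²` induces a symmetry of `(S³, K(q / p))` which preserves
each level; these symmetries form the characteristic group `(ℤ / 2)²`. Translation by `(0, 1)`,
the direction of slope `∞`, fixes the upper tunnel pointwise; translation by `(p, q)`, the
direction of slope `q / p`, fixes the lower tunnel pointwise. For `p` odd these are the strong
inversions `h₊` and `h₋` of the knot `K(q / p)`; for `p` even they agree, and are the strong
inversion `h` of the two-component link `K(q / p)`. The long and the intermediate tunnels are the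
other arcs of the fixed point sets, as `fixed_upper`, `fixed_lower` and `fixed_even` below show. -/

/-- The symmetry of `(S³, K(q / p))` induced by `(x, t) ↦ (x + (a, b), t)`. -/
noncomputable def translate (p q a b : ℤ) : Sphere p q → Sphere p q :=
  Quotient.map' (s₁ := sphereSetoid p q) (s₂ := sphereSetoid p q)
    (fun c => (c.1 + ((a : ℝ), (b : ℝ)), c.2)) (fun c d h => ⟨h.1, by
      rcases h.2 with h | h
      · left
        simpa using h
      · right
        have h2 : IsPeriod p q c.2 (2 * (a : ℝ), 2 * (b : ℝ)) :=
          ⟨a, b, by simp⟩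
        convert h.add h2 using 1
        ext <;> simp <;> ring⟩)

theorem translate_mk (p q a b : ℤ) (x : ℝ × ℝ) (t : Set.Icc (-1 : ℝ) 1) :
    translate p q a b (mk p q (x, t)) = mk p q (x + ((a : ℝ), (b : ℝ)), t) := rfl

/-- The upper tunnel `τ₊`: the core of the rational tangle of slope `∞`. -/
def upperTunnel (p q : ℤ) : Set (Sphere p q) :=
  {P | ∃ (x : ℝ × ℝ) (t : Set.Icc (-1 : ℝ) 1), (t : ℝ) = 1 ∧ P = mk p q (x, t)}

/-- The lower tunnel `τ₋`: the core of the rational tangle of slope `q / p`. -/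
def lowerTunnel (p q : ℤ) : Set (Sphere p q) :=
  {P | ∃ (x : ℝ × ℝ) (t : Set.Icc (-1 : ℝ) 1), (t : ℝ) = -1 ∧ P = mk p q (x, t)}

/-- The level which moves from `1` down to `-1` for `u ∈ [0, 1/2]` and back up for
`u ∈ [1/2, 1]`. -/
noncomputable def downUp (u : unitInterval) : Set.Icc (-1 : ℝ) 1 :=
  ⟨|2 - 4 * (u : ℝ)| - 1, by
    have h0 := u.2.1
    have h1 := u.2.2
    constructor
    · linarith [abs_nonneg (2 - 4 * (u : ℝ))]
    · have : |2 - 4 * (u : ℝ)| ≤ 2 := abs_le.2 ⟨by linarith, by linarith⟩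
      linarith⟩

/-- The level which moves from `-1` up to `1` for `u ∈ [0, 1/2]` and back down for
`u ∈ [1/2, 1]`. -/
noncomputable def upDown (u : unitInterval) : Set.Icc (-1 : ℝ) 1 :=
  ⟨1 - |2 - 4 * (u : ℝ)|, by
    have h := (downUp u).2
    simp only [downUp, Set.mem_Icc] at h
    constructor <;> linarith [h.1, h.2]⟩

/-- The level which moves from `1` down to `-1`. -/
noncomputable def down (u : unitInterval) : Set.Icc (-1 : ℝ) 1 :=
  ⟨1 - 2 * (u : ℝ), by
    have h0 := u.2.1
    have h1 := u.2.2
    constructor <;> linarith⟩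

theorem continuous_downUp : Continuous downUp := by
  unfold downUp
  fun_prop

theorem continuous_upDown : Continuous upDown := by
  unfold upDown
  fun_prop

theorem continuous_down : Continuous down := by
  unfold down
  fun_prop

theorem IsPeriod.fst_even {p q : ℤ} {t : ℝ} (ht : t ≠ -1) {v : ℝ × ℝ} (h : IsPeriod p q t v) :
    ∃ a : ℤ, v.1 = 2 * a := by
  by_cases h1 : t = 1
  · exact isPeriod_one.1 (h1 ▸ h)
  · obtain ⟨a, b, rfl⟩ := (isPeriod_of_ne h1 ht).1 h
    exact ⟨a, rfl⟩

theorem IsPeriod.det_even {p q : ℤ} (hpq : IsCoprime p q) {t : ℝ} (ht : t ≠ 1) {v : ℝ × ℝ}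
    (h : IsPeriod p q t v) : ∃ c : ℤ, (q : ℝ) * v.1 - p * v.2 = 2 * c := by
  by_cases h1 : t = -1
  · exact (isPeriod_neg_one hpq).1 (h1 ▸ h)
  · obtain ⟨a, b, rfl⟩ := (isPeriod_of_ne ht h1).1 h
    exact ⟨q * a - p * b, by push_cast; ring⟩

/-- The long upper tunnel `τ₊ᶜ`, as a map: the vertical arcs over `(0, 1/2)` and
`(0, 1/2) + (p, q)`, which meet in the level `-1`. -/
noncomputable def longUpperFun (p q : ℤ) (u : unitInterval) : Sphere p q :=
  if (u : ℝ) ≤ 1 / 2 then mk p q (((0 : ℝ), (1 / 2 : ℝ)), downUp u)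
  else mk p q (((p : ℝ), (q : ℝ) + 1 / 2), downUp u)

/-- The long lower tunnel `τ₋ᶜ`, as a map: the vertical arcs over `(p/2, q/2)` and
`(p/2, q/2) + (0, 1)`, which meet in the level `1`. -/
noncomputable def longLowerFun (p q : ℤ) (u : unitInterval) : Sphere p q :=
  if (u : ℝ) ≤ 1 / 2 then mk p q (((p : ℝ) / 2, (q : ℝ) / 2), upDown u)
  else mk p q (((p : ℝ) / 2, (q : ℝ) / 2 + 1), upDown u)

theorem continuous_longUpperFun {p q : ℤ} (hpq : IsCoprime p q) :
    Continuous (longUpperFun p q) := by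
  refine Continuous.if_le (continuous_mk.comp (continuous_const.prodMk continuous_downUp))
    (continuous_mk.comp (continuous_const.prodMk continuous_downUp)) continuous_subtype_val
    continuous_const ?_
  intro u hu
  have ht : ((downUp u : Set.Icc (-1 : ℝ) 1) : ℝ) = -1 := by
    simp only [downUp, hu]
    norm_num
  refine mk_eq_mk.2 ⟨rfl, Or.inl ?_⟩
  simp only [ht]
  refine (isPeriod_neg_one hpq).2 ⟨0, ?_⟩
  simp only [Prod.fst_sub, Prod.snd_sub]
  push_cast
  ring

theorem continuous_longLowerFun (p q : ℤ) : Continuous (longLowerFun p q) := by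
  refine Continuous.if_le (continuous_mk.comp (continuous_const.prodMk continuous_upDown))
    (continuous_mk.comp (continuous_const.prodMk continuous_upDown)) continuous_subtype_val
    continuous_const ?_
  intro u hu
  have ht : ((upDown u : Set.Icc (-1 : ℝ) 1) : ℝ) = 1 := by
    simp only [upDown, hu]
    norm_num
  refine mk_eq_mk.2 ⟨rfl, Or.inl ?_⟩
  simp only [ht]
  exact isPeriod_one.2 ⟨0, by simp⟩

theorem eq_or_add_eq_one {u u' : unitInterval}
    (h : |2 - 4 * (u : ℝ)| = |2 - 4 * (u' : ℝ)|) : u = u' ∨ (u : ℝ) + u' = 1 := by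
  rcases abs_eq_abs.1 h with h | h
  · exact Or.inl (Subtype.ext (by linarith))
  · exact Or.inr (by linarith)

theorem longUpperFun_injective {p q : ℤ} (hp : Odd p) :
    Function.Injective (longUpperFun p q) := by
  have key : ∀ u u' : unitInterval, (u : ℝ) ≤ 1 / 2 → ¬ (u' : ℝ) ≤ 1 / 2 →
      longUpperFun p q u ≠ longUpperFun p q u' := by
    intro u u' hu hu' h
    rw [longUpperFun, longUpperFun, if_pos hu, if_neg hu'] at h
    obtain ⟨h1, h2⟩ := mk_eq_mk.1 h
    have ht : ((downUp u : Set.Icc (-1 : ℝ) 1) : ℝ) ≠ -1 := by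
      intro h3
      rw [show downUp u = downUp u' from h1] at h3
      simp only [downUp] at h3
      have : |2 - 4 * (u' : ℝ)| = 0 := by linarith
      rw [abs_eq_zero] at this
      exact hu' (by linarith)
    have h4 : ∃ a : ℤ, (p : ℝ) = 2 * a := by
      rcases h2 with h2 | h2
      · simpa using h2.fst_even ht
      · simpa using h2.fst_even ht
    obtain ⟨a, ha⟩ := h4
    have ha' : p = 2 * a := by exact_mod_cast ha
    obtain ⟨b, hb⟩ := hp
    omega
  have level : ∀ u u' : unitInterval, longUpperFun p q u = longUpperFun p q u' →
      downUp u = downUp u' := by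
    intro u u' h
    unfold longUpperFun at h
    split_ifs at h <;> exact (mk_eq_mk.1 h).1
  intro u u' h
  have h1 := congrArg Subtype.val (level u u' h)
  simp only [downUp, sub_left_inj] at h1
  rcases eq_or_add_eq_one h1 with h2 | h2
  · exact h2
  · by_cases hu : (u : ℝ) ≤ 1 / 2 <;> by_cases hu' : (u' : ℝ) ≤ 1 / 2
    · exact Subtype.ext (by linarith)
    · exact absurd h (key u u' hu hu')
    · exact absurd h.symm (key u' u hu' hu)
    · exact Subtype.ext (by linarith)

theorem longLowerFun_injective {p q : ℤ} (hpq : IsCoprime p q) (hp : Odd p) :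
    Function.Injective (longLowerFun p q) := by
  have key : ∀ u u' : unitInterval, (u : ℝ) ≤ 1 / 2 → ¬ (u' : ℝ) ≤ 1 / 2 →
      longLowerFun p q u ≠ longLowerFun p q u' := by
    intro u u' hu hu' h
    rw [longLowerFun, longLowerFun, if_pos hu, if_neg hu'] at h
    obtain ⟨h1, h2⟩ := mk_eq_mk.1 h
    have ht : ((upDown u : Set.Icc (-1 : ℝ) 1) : ℝ) ≠ 1 := by
      intro h3
      rw [show upDown u = upDown u' from h1] at h3
      simp only [upDown] at h3
      have : |2 - 4 * (u' : ℝ)| = 0 := by linarith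
      rw [abs_eq_zero] at this
      exact hu' (by linarith)
    have h4 : ∃ a : ℤ, (p : ℝ) = 2 * a := by
      rcases h2 with h2 | h2
      · obtain ⟨c, hc⟩ := h2.det_even hpq ht
        refine ⟨-c, ?_⟩
        simp only [Prod.fst_sub, Prod.snd_sub] at hc
        push_cast
        linear_combination -hc
      · obtain ⟨c, hc⟩ := h2.det_even hpq ht
        refine ⟨-c, ?_⟩
        simp only [Prod.fst_add, Prod.snd_add] at hc
        push_cast
        linear_combination -hc
    obtain ⟨a, ha⟩ := h4
    have ha' : p = 2 * a := by exact_mod_cast ha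
    obtain ⟨b, hb⟩ := hp
    omega
  have level : ∀ u u' : unitInterval, longLowerFun p q u = longLowerFun p q u' →
      upDown u = upDown u' := by
    intro u u' h
    unfold longLowerFun at h
    split_ifs at h <;> exact (mk_eq_mk.1 h).1
  intro u u' h
  have h1 := congrArg Subtype.val (level u u' h)
  simp only [upDown, sub_right_inj] at h1
  rcases eq_or_add_eq_one h1 with h2 | h2
  · exact h2
  · by_cases hu : (u : ℝ) ≤ 1 / 2 <;> by_cases hu' : (u' : ℝ) ≤ 1 / 2
    · exact Subtype.ext (by linarith)
    · exact absurd h (key u u' hu hu')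
    · exact absurd h.symm (key u' u hu' hu)
    · exact Subtype.ext (by linarith)

theorem downUp_eq_one {u : unitInterval} :
    ((downUp u : Set.Icc (-1 : ℝ) 1) : ℝ) = 1 ↔ u = 0 ∨ u = 1 := by
  have h0 := u.2.1
  have h1 := u.2.2
  simp only [downUp]
  constructor
  · intro h
    have h' : |2 - 4 * (u : ℝ)| = 2 := by linarith
    rcases (abs_eq (by norm_num)).1 h' with h | h
    · exact Or.inl (Subtype.ext (show (u : ℝ) = 0 by linarith))
    · exact Or.inr (Subtype.ext (show (u : ℝ) = 1 by linarith))
  · rintro (rfl | rfl) <;> norm_num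

theorem upDown_eq_neg_one {u : unitInterval} :
    ((upDown u : Set.Icc (-1 : ℝ) 1) : ℝ) = -1 ↔ u = 0 ∨ u = 1 := by
  rw [← downUp_eq_one]
  simp only [upDown, downUp]
  constructor <;> intro h <;> linarith

theorem half_ne_int (n : ℤ) : (n : ℝ) ≠ 1 / 2 := by
  intro h
  have h' : (2 * n : ℝ) = 1 := by linarith
  have : 2 * n = 1 := by exact_mod_cast h'
  omega

theorem half_odd_ne_int {p : ℤ} (hp : Odd p) (n : ℤ) : (n : ℝ) ≠ (p : ℝ) / 2 := by
  intro h
  have h' : (2 * n : ℝ) = p := by linarith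
  have : 2 * n = p := by exact_mod_cast h'
  obtain ⟨b, hb⟩ := hp
  omega

theorem longUpperFun_mem_link {p q : ℤ} (hpq : IsCoprime p q) (hp : Odd p) (u : unitInterval) :
    longUpperFun p q u ∈ link p q ↔ u = 0 ∨ u = 1 := by
  rw [← downUp_eq_one]
  by_cases h1 : ((downUp u : Set.Icc (-1 : ℝ) 1) : ℝ) = 1
  · simp only [h1, iff_true]
    unfold longUpperFun
    split_ifs
    · exact (mem_link_one h1).2 ⟨0, by simp⟩
    · exact (mem_link_one h1).2 ⟨p, rfl⟩
  · simp only [h1, iff_false]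
    intro h
    by_cases h2 : ((downUp u : Set.Icc (-1 : ℝ) 1) : ℝ) = -1
    · unfold longUpperFun at h
      split_ifs at h
      · obtain ⟨c, hc⟩ := (mem_link_neg_one hpq h2).1 h
        exact half_odd_ne_int hp (-c) (by push_cast; linear_combination hc)
      · obtain ⟨c, hc⟩ := (mem_link_neg_one hpq h2).1 h
        exact half_odd_ne_int hp (-c) (by push_cast; linear_combination hc)
    · unfold longUpperFun at h
      split_ifs at h
      · obtain ⟨a, b, hab⟩ := (mem_link_of_ne h1 h2).1 h
        exact half_ne_int b (by simpa using (congrArg Prod.snd hab).symm)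
      · obtain ⟨a, b, hab⟩ := (mem_link_of_ne h1 h2).1 h
        have := congrArg Prod.snd hab
        simp only at this
        exact half_ne_int (b - q) (by push_cast; linear_combination -this)

theorem longLowerFun_mem_link {p q : ℤ} (hpq : IsCoprime p q) (hp : Odd p) (u : unitInterval) :
    longLowerFun p q u ∈ link p q ↔ u = 0 ∨ u = 1 := by
  rw [← upDown_eq_neg_one]
  by_cases h1 : ((upDown u : Set.Icc (-1 : ℝ) 1) : ℝ) = -1
  · simp only [h1, iff_true]
    unfold longLowerFun
    split_ifs
    · exact (mem_link_neg_one hpq h1).2 ⟨0, by push_cast; ring⟩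
    · exact (mem_link_neg_one hpq h1).2 ⟨-p, by push_cast; ring⟩
  · simp only [h1, iff_false]
    intro h
    by_cases h2 : ((upDown u : Set.Icc (-1 : ℝ) 1) : ℝ) = 1
    · unfold longLowerFun at h
      split_ifs at h
      · obtain ⟨c, hc⟩ := (mem_link_one h2).1 h
        exact half_odd_ne_int hp c hc.symm
      · obtain ⟨c, hc⟩ := (mem_link_one h2).1 h
        exact half_odd_ne_int hp c hc.symm
    · unfold longLowerFun at h
      split_ifs at h
      · obtain ⟨a, b, hab⟩ := (mem_link_of_ne h2 h1).1 h
        exact half_odd_ne_int hp a (by simpa using (congrArg Prod.fst hab).symm)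
      · obtain ⟨a, b, hab⟩ := (mem_link_of_ne h2 h1).1 h
        exact half_odd_ne_int hp a (by simpa using (congrArg Prod.fst hab).symm)

/-- The long upper tunnel `τ₊ᶜ` of the two-bridge knot `K(q / p)`, `p` odd: the arc of the fixed
circle of the strong inversion `h₊` complementary to the upper tunnel `τ₊`. -/
noncomputable def longUpperTunnel {p q : ℤ} (hpq : IsCoprime p q) (hp : Odd p) :
    Tunnel (link p q) where
  left := longUpperFun p q 0
  right := longUpperFun p q 1
  path := ⟨⟨longUpperFun p q, continuous_longUpperFun hpq⟩, rfl, rfl⟩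
  injective := longUpperFun_injective hp
  mem_iff := longUpperFun_mem_link hpq hp

/-- The long lower tunnel `τ₋ᶜ` of the two-bridge knot `K(q / p)`, `p` odd: the arc of the fixed
circle of the strong inversion `h₋` complementary to the lower tunnel `τ₋`. -/
noncomputable def longLowerTunnel {p q : ℤ} (hpq : IsCoprime p q) (hp : Odd p) :
    Tunnel (link p q) where
  left := longLowerFun p q 0
  right := longLowerFun p q 1
  path := ⟨⟨longLowerFun p q, continuous_longLowerFun p q⟩, rfl, rfl⟩
  injective := longLowerFun_injective hpq hp
  mem_iff := longLowerFun_mem_link hpq hp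

/-- The vertical arc over `(k, 1/2)`, as a map. -/
noncomputable def intermediateFun (p q k : ℤ) (u : unitInterval) : Sphere p q :=
  mk p q (((k : ℝ), (1 / 2 : ℝ)), down u)

theorem intermediateFun_mem_link {p q : ℤ} (hpq : IsCoprime p q) (hp : Even p) (k : ℤ)
    (u : unitInterval) : intermediateFun p q k u ∈ link p q ↔ u = 0 ∨ u = 1 := by
  unfold intermediateFun
  obtain ⟨r, rfl⟩ := hp
  constructor
  · intro h
    by_contra hu
    rw [not_or] at hu
    have h1 : ((down u : Set.Icc (-1 : ℝ) 1) : ℝ) ≠ 1 := fun h1 =>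
      hu.1 (Subtype.ext (by simp only [down] at h1; show (u : ℝ) = 0; linarith))
    have h2 : ((down u : Set.Icc (-1 : ℝ) 1) : ℝ) ≠ -1 := fun h1 =>
      hu.2 (Subtype.ext (by simp only [down] at h1; show (u : ℝ) = 1; linarith))
    obtain ⟨a, b, hab⟩ := (mem_link_of_ne h1 h2).1 h
    exact half_ne_int b (by simpa using (congrArg Prod.snd hab).symm)
  · rintro (rfl | rfl)
    · exact (mem_link_one (by simp [down])).2 ⟨k, rfl⟩
    · exact (mem_link_neg_one hpq (by simp [down]; norm_num)).2
        ⟨q * k - r, by push_cast; ring⟩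

/-- The arc over `(k, 1/2)` joining the upper and the lower tunnel of the two-component two-bridge
link `K(q / p)`, `p` even. -/
noncomputable def intermediateTunnel {p q : ℤ} (hpq : IsCoprime p q) (hp : Even p) (k : ℤ) :
    Tunnel (link p q) where
  left := intermediateFun p q k 0
  right := intermediateFun p q k 1
  path := ⟨⟨intermediateFun p q k,
    continuous_mk.comp (continuous_const.prodMk continuous_down)⟩, rfl, rfl⟩
  injective := fun u u' h => by
    have h1 := congrArg Subtype.val (mk_eq_mk.1 h).1
    simp only [down] at h1
    exact Subtype.ext (by linarith)
  mem_iff := intermediateFun_mem_link hpq hp k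

/-- The intermediate tunnel `τ_L`: one of the two arcs which, together with the upper and the
lower tunnel, make up the fixed circle of the strong inversion `h`. -/
noncomputable def intermediateLeft {p q : ℤ} (hpq : IsCoprime p q) (hp : Even p) :
    Tunnel (link p q) :=
  intermediateTunnel hpq hp 0

/-- The intermediate tunnel `τ_R`: the other one of these two arcs. -/
noncomputable def intermediateRight {p q : ℤ} (hpq : IsCoprime p q) (hp : Even p) :
    Tunnel (link p q) :=
  intermediateTunnel hpq hp 1

/-! ### The fixed point sets of the strong inversions -/

theorem isPeriod_even (p q : ℤ) (t : ℝ) (a b : ℤ) {v : ℝ × ℝ} (h1 : v.1 = 2 * (a : ℝ))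
    (h2 : v.2 = 2 * (b : ℝ)) : IsPeriod p q t v := by
  refine ⟨a, b, ?_⟩
  rw [show v = (2 * (a : ℝ), 2 * (b : ℝ)) from Prod.ext h1 h2, sub_self]
  exact Submodule.zero_mem _

theorem exists_downUp (t : Set.Icc (-1 : ℝ) 1) :
    ∃ u : unitInterval, (u : ℝ) ≤ 1 / 2 ∧ downUp u = t := by
  have h1 := t.2.1
  have h2 := t.2.2
  refine ⟨⟨(1 - (t : ℝ)) / 4, by linarith, by linarith⟩, by simp only; linarith, ?_⟩
  apply Subtype.ext
  simp only [downUp]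
  rw [abs_of_nonneg (by linarith)]
  ring

theorem exists_downUp' (t : Set.Icc (-1 : ℝ) 1) (ht : (t : ℝ) ≠ -1) :
    ∃ u : unitInterval, ¬ (u : ℝ) ≤ 1 / 2 ∧ downUp u = t := by
  have h1 := lt_of_le_of_ne t.2.1 ht.symm
  have h2 := t.2.2
  refine ⟨⟨(3 + (t : ℝ)) / 4, by linarith, by linarith⟩, by simp only; linarith, ?_⟩
  apply Subtype.ext
  simp only [downUp]
  rw [abs_of_nonpos (by linarith)]
  ring

theorem exists_upDown (t : Set.Icc (-1 : ℝ) 1) :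
    ∃ u : unitInterval, (u : ℝ) ≤ 1 / 2 ∧ upDown u = t := by
  have h1 := t.2.1
  have h2 := t.2.2
  refine ⟨⟨(1 + (t : ℝ)) / 4, by linarith, by linarith⟩, by simp only; linarith, ?_⟩
  apply Subtype.ext
  simp only [upDown]
  rw [abs_of_nonneg (by linarith)]
  ring

theorem exists_upDown' (t : Set.Icc (-1 : ℝ) 1) (ht : (t : ℝ) ≠ 1) :
    ∃ u : unitInterval, ¬ (u : ℝ) ≤ 1 / 2 ∧ upDown u = t := by
  have h1 := t.2.1
  have h2 := lt_of_le_of_ne t.2.2 ht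
  refine ⟨⟨(3 - (t : ℝ)) / 4, by linarith, by linarith⟩, by simp only; linarith, ?_⟩
  apply Subtype.ext
  simp only [upDown]
  rw [abs_of_nonpos (by linarith)]
  ring

theorem exists_down (t : Set.Icc (-1 : ℝ) 1) : ∃ u : unitInterval, down u = t := by
  have h1 := t.2.1
  have h2 := t.2.2
  refine ⟨⟨(1 - (t : ℝ)) / 2, by linarith, by linarith⟩, ?_⟩
  apply Subtype.ext
  simp only [down]
  ring

/-- For `p` odd, the fixed circle of `h₊` is the union of the upper and the long upper tunnel. -/
theorem fixed_upper {p q : ℤ} (hpq : IsCoprime p q) (hp : Odd p) :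
    {P | translate p q 0 1 P = P} =
      upperTunnel p q ∪ Set.range (longUpperTunnel hpq hp).path := by
  ext P
  obtain ⟨⟨x, t⟩, rfl⟩ := mk_surjective P
  simp only [Set.mem_ofPred_eq, Set.mem_union]
  constructor
  · intro h
    by_cases h1 : (t : ℝ) = 1
    · exact Or.inl ⟨x, t, h1, rfl⟩
    right
    have h3 : IsPeriod p q t (x + (x + (((0 : ℤ) : ℝ), ((1 : ℤ) : ℝ)))) := by
      rw [translate_mk] at h
      rcases (mk_eq_mk.1 h).2 with h | h
      · exfalso
        obtain ⟨c, hc⟩ := h.det_even hpq h1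
        simp only [Prod.fst_sub, Prod.snd_sub, Prod.fst_add, Prod.snd_add] at hc
        push_cast at hc
        exact half_odd_ne_int hp c (by linear_combination -hc / 2)
      · exact h
    by_cases h2 : (t : ℝ) = -1
    · obtain ⟨u, hu, hut⟩ := exists_downUp t
      refine ⟨u, (?_ : longUpperFun p q u = _)⟩
      rw [longUpperFun, if_pos hu, hut]
      rw [h2] at h3
      obtain ⟨c, hc⟩ := (isPeriod_neg_one hpq).1 h3
      simp only [Prod.fst_add, Prod.snd_add] at hc
      push_cast at hc
      obtain ⟨r, rfl⟩ := hp
      rw [mk_eq_mk]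
      refine ⟨rfl, ?_⟩
      simp only [h2, isPeriod_neg_one hpq, Prod.fst_add, Prod.snd_add, Prod.fst_sub, Prod.snd_sub]
      push_cast at hc ⊢
      rcases Int.even_or_odd c with ⟨d, rfl⟩ | ⟨d, rfl⟩
      · right
        exact ⟨d, by push_cast at hc; linear_combination hc / 2⟩
      · left
        exact ⟨d + r + 1, by push_cast at hc ⊢; linear_combination hc / 2⟩
    · obtain ⟨a, b, hab⟩ := (isPeriod_of_ne h1 h2).1 h3
      have ha := congrArg Prod.fst hab
      have hb := congrArg Prod.snd hab
      simp only [Prod.fst_add, Prod.snd_add] at ha hb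
      push_cast at ha hb
      obtain ⟨r, rfl⟩ := hp
      rcases Int.even_or_odd a with ⟨d, rfl⟩ | ⟨d, rfl⟩
      · obtain ⟨u, hu, hut⟩ := exists_downUp t
        refine ⟨u, (?_ : longUpperFun _ q u = _)⟩
        rw [longUpperFun, if_pos hu, hut, mk_eq_mk]
        refine ⟨rfl, ?_⟩
        push_cast at ha
        rcases Int.even_or_odd b with ⟨e, rfl⟩ | ⟨e, rfl⟩
        · push_cast at hb
          exact Or.inr (isPeriod_even _ _ _ d e (by simp; linarith) (by simp; linarith))
        · push_cast at hb
          exact Or.inl (isPeriod_even _ _ _ d e (by simp; linarith) (by simp; linarith))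
      · obtain ⟨u, hu, hut⟩ := exists_downUp' t h2
        refine ⟨u, (?_ : longUpperFun _ q u = _)⟩
        rw [longUpperFun, if_neg hu, hut, mk_eq_mk]
        refine ⟨rfl, ?_⟩
        push_cast at ha
        rcases Int.even_or_odd (b + q) with ⟨e, he⟩ | ⟨e, he⟩
        · have he' : (b : ℝ) + q = e + e := by exact_mod_cast he
          exact Or.inr (isPeriod_even _ _ _ (d + r + 1) e (by simp; linarith)
            (by simp; linarith))
        · have he' : (b : ℝ) + q = 2 * e + 1 := by exact_mod_cast he
          exact Or.inl (isPeriod_even _ _ _ (d - r) (e - q) (by simp; linarith)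
            (by simp; linarith))
  · rintro (⟨y, s, hs, h⟩ | ⟨u, hu⟩)
    · rw [h, translate_mk, mk_eq_mk]
      refine ⟨rfl, Or.inl ?_⟩
      simp only [hs]
      exact isPeriod_one.2 ⟨0, by simp⟩
    · rw [← hu]
      change translate p q 0 1 (longUpperFun p q u) = longUpperFun p q u
      unfold longUpperFun
      split_ifs
      · rw [translate_mk, mk_eq_mk]
        exact ⟨rfl, Or.inr (isPeriod_even _ _ _ 0 1 (by simp) (by simp; norm_num))⟩
      · rw [translate_mk, mk_eq_mk]
        exact ⟨rfl, Or.inr (isPeriod_even _ _ _ p (q + 1) (by simp; ring) (by simp; ring))⟩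

/-- For `p` odd, the fixed circle of `h₋` is the union of the lower and the long lower tunnel. -/
theorem fixed_lower {p q : ℤ} (hpq : IsCoprime p q) (hp : Odd p) :
    {P | translate p q p q P = P} =
      lowerTunnel p q ∪ Set.range (longLowerTunnel hpq hp).path := by
  ext P
  obtain ⟨⟨x, t⟩, rfl⟩ := mk_surjective P
  simp only [Set.mem_ofPred_eq, Set.mem_union]
  constructor
  · intro h
    by_cases h2 : (t : ℝ) = -1
    · exact Or.inl ⟨x, t, h2, rfl⟩
    right
    have h3 : IsPeriod p q t (x + (x + ((p : ℝ), (q : ℝ)))) := by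
      rw [translate_mk] at h
      rcases (mk_eq_mk.1 h).2 with h | h
      · exfalso
        obtain ⟨c, hc⟩ := h.fst_even h2
        simp only [Prod.fst_sub, Prod.fst_add] at hc
        exact half_odd_ne_int hp (-c) (by push_cast; linear_combination hc / 2)
      · exact h
    obtain ⟨a, ha⟩ := h3.fst_even h2
    simp only [Prod.fst_add] at ha
    obtain ⟨r, rfl⟩ := hp
    by_cases h1 : (t : ℝ) = 1
    · obtain ⟨u, hu, hut⟩ := exists_upDown t
      refine ⟨u, (?_ : longLowerFun _ q u = _)⟩
      rw [longLowerFun, if_pos hu, hut, mk_eq_mk]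
      refine ⟨rfl, ?_⟩
      simp only [h1, isPeriod_one, Prod.fst_add, Prod.fst_sub]
      push_cast at ha ⊢
      rcases Int.even_or_odd a with ⟨d, rfl⟩ | ⟨d, rfl⟩
      · right
        exact ⟨d, by push_cast at ha; linear_combination ha / 2⟩
      · left
        exact ⟨d - r, by push_cast at ha ⊢; linear_combination ha / 2⟩
    · obtain ⟨a', b, hab⟩ := (isPeriod_of_ne h1 h2).1 h3
      have hb := congrArg Prod.snd hab
      simp only [Prod.snd_add] at hb
      push_cast at ha
      rcases Int.even_or_odd a with ⟨d, rfl⟩ | ⟨d, rfl⟩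
      · push_cast at ha
        rcases Int.even_or_odd b with ⟨e, rfl⟩ | ⟨e, rfl⟩
        · push_cast at hb
          obtain ⟨u, hu, hut⟩ := exists_upDown t
          refine ⟨u, (?_ : longLowerFun _ q u = _)⟩
          rw [longLowerFun, if_pos hu, hut, mk_eq_mk]
          exact ⟨rfl, Or.inr (isPeriod_even _ _ _ d e (by simp; linarith) (by simp; linarith))⟩
        · push_cast at hb
          obtain ⟨u, hu, hut⟩ := exists_upDown' t h1
          refine ⟨u, (?_ : longLowerFun _ q u = _)⟩
          rw [longLowerFun, if_neg hu, hut, mk_eq_mk]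
          exact ⟨rfl, Or.inr (isPeriod_even _ _ _ d (e + 1) (by simp; linarith)
            (by simp; linarith))⟩
      · push_cast at ha
        rcases Int.even_or_odd (b - q) with ⟨e, he⟩ | ⟨e, he⟩
        · have he' : (b : ℝ) - q = e + e := by exact_mod_cast he
          obtain ⟨u, hu, hut⟩ := exists_upDown t
          refine ⟨u, (?_ : longLowerFun _ q u = _)⟩
          rw [longLowerFun, if_pos hu, hut, mk_eq_mk]
          exact ⟨rfl, Or.inl (isPeriod_even _ _ _ (d - r) e (by simp; linarith)
            (by simp; linarith))⟩
        · have he' : (b : ℝ) - q = 2 * e + 1 := by exact_mod_cast he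
          obtain ⟨u, hu, hut⟩ := exists_upDown' t h1
          refine ⟨u, (?_ : longLowerFun _ q u = _)⟩
          rw [longLowerFun, if_neg hu, hut, mk_eq_mk]
          exact ⟨rfl, Or.inl (isPeriod_even _ _ _ (d - r) e (by simp; linarith)
            (by simp; linarith))⟩
  · rintro (⟨y, s, hs, h⟩ | ⟨u, hu⟩)
    · rw [h, translate_mk, mk_eq_mk]
      refine ⟨rfl, Or.inl ?_⟩
      simp only [hs]
      exact (isPeriod_neg_one hpq).2 ⟨0, by simp; ring⟩
    · rw [← hu]
      change translate p q p q (longLowerFun p q u) = longLowerFun p q u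
      unfold longLowerFun
      split_ifs
      · rw [translate_mk, mk_eq_mk]
        exact ⟨rfl, Or.inr (isPeriod_even _ _ _ p q (by simp; ring) (by simp; ring))⟩
      · rw [translate_mk, mk_eq_mk]
        exact ⟨rfl, Or.inr (isPeriod_even _ _ _ p (q + 1) (by simp; ring) (by simp; ring))⟩

/-- For `p` even, the fixed circle of `h` is the union of the upper and the lower tunnel and the
two intermediate tunnels. -/
theorem fixed_even {p q : ℤ} (hpq : IsCoprime p q) (hp : Even p) :
    {P | translate p q 0 1 P = P} =
      upperTunnel p q ∪ lowerTunnel p q ∪ Set.range (intermediateLeft hpq hp).path ∪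
        Set.range (intermediateRight hpq hp).path := by
  ext P
  obtain ⟨⟨x, t⟩, rfl⟩ := mk_surjective P
  simp only [Set.mem_ofPred_eq, Set.mem_union]
  constructor
  · intro h
    by_cases h1 : (t : ℝ) = 1
    · exact Or.inl (Or.inl (Or.inl ⟨x, t, h1, rfl⟩))
    by_cases h2 : (t : ℝ) = -1
    · exact Or.inl (Or.inl (Or.inr ⟨x, t, h2, rfl⟩))
    rw [translate_mk] at h
    have h3 : ∃ a b : ℤ, x + (x + (((0 : ℤ) : ℝ), ((1 : ℤ) : ℝ))) =
        (2 * (a : ℝ), 2 * (b : ℝ)) := by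
      rcases (mk_eq_mk.1 h).2 with h | h
      · exfalso
        obtain ⟨a, b, hab⟩ := (isPeriod_of_ne h1 h2).1 h
        have := congrArg Prod.snd hab
        simp only [Prod.snd_sub, Prod.snd_add] at this
        push_cast at this
        exact half_ne_int (-b) (by push_cast; linear_combination this / 2)
      · exact (isPeriod_of_ne h1 h2).1 h
    obtain ⟨a, b, hab⟩ := h3
    have ha := congrArg Prod.fst hab
    have hb := congrArg Prod.snd hab
    simp only [Prod.fst_add, Prod.snd_add] at ha hb
    push_cast at ha hb
    obtain ⟨u, hut⟩ := exists_down t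
    rcases Int.even_or_odd a with ⟨d, rfl⟩ | ⟨d, rfl⟩
    · refine Or.inl (Or.inr ⟨u, (?_ : intermediateFun p q 0 u = _)⟩)
      rw [intermediateFun, hut, mk_eq_mk]
      refine ⟨rfl, ?_⟩
      push_cast at ha
      rcases Int.even_or_odd b with ⟨e, rfl⟩ | ⟨e, rfl⟩
      · push_cast at hb
        exact Or.inr (isPeriod_even _ _ _ d e (by simp; linarith) (by simp; linarith))
      · push_cast at hb
        exact Or.inl (isPeriod_even _ _ _ d e (by simp; linarith) (by simp; linarith))
    · refine Or.inr ⟨u, (?_ : intermediateFun p q 1 u = _)⟩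
      rw [intermediateFun, hut, mk_eq_mk]
      refine ⟨rfl, ?_⟩
      push_cast at ha
      rcases Int.even_or_odd b with ⟨e, rfl⟩ | ⟨e, rfl⟩
      · push_cast at hb
        exact Or.inr (isPeriod_even _ _ _ (d + 1) e (by simp; linarith) (by simp; linarith))
      · push_cast at hb
        exact Or.inl (isPeriod_even _ _ _ d e (by simp; linarith) (by simp; linarith))
  · rintro (((⟨y, s, hs, h⟩ | ⟨y, s, hs, h⟩) | ⟨u, hu⟩) | ⟨u, hu⟩)
    · rw [h, translate_mk, mk_eq_mk]
      refine ⟨rfl, Or.inl ?_⟩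
      simp only [hs]
      exact isPeriod_one.2 ⟨0, by simp⟩
    · rw [h, translate_mk, mk_eq_mk]
      refine ⟨rfl, Or.inl ?_⟩
      simp only [hs]
      obtain ⟨r, rfl⟩ := hp
      exact (isPeriod_neg_one hpq).2 ⟨r, by simp; ring⟩
    · rw [← hu]
      change translate p q 0 1 (intermediateFun p q 0 u) = intermediateFun p q 0 u
      rw [intermediateFun, translate_mk, mk_eq_mk]
      exact ⟨rfl, Or.inr (isPeriod_even _ _ _ 0 1 (by simp) (by simp; norm_num))⟩
    · rw [← hu]
      change translate p q 0 1 (intermediateFun p q 1 u) = intermediateFun p q 1 u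
      rw [intermediateFun, translate_mk, mk_eq_mk]
      exact ⟨rfl, Or.inr (isPeriod_even _ _ _ 1 1 (by simp; norm_num) (by simp; norm_num))⟩

end TwoBridge

/-!
The sphere of `Sphere p q`, its double branched covering and their universal covering are quotients
of `ℝ² × [-1, 1]`, so that everything can be computed there. In the linear coordinates `α = x₁` and
`β = q x₁ - p x₂` of the plane, crushing forgets `α` at level `-1`, and `β` at level `1`. Hence the
quotient `UCover p q` of `ℝ² × [-1, 1]` by the lattice `2pℤ × 2pℤ` and the crushing is the join of
two circles, a three-sphere. The dihedral group of order `2p` acts on it: the rotations act freely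
with quotient the double branched covering (a lens space), and the reflections have the preimage of
the link as their fixed points. So the rotations are the deck group of `UCover p q → DoubleCover p q`
(`isQuotientCoveringMap_toDouble`), and the dihedral group is the deck group of the covering of
the complement of the link by the complement of the fixed points (`isQuotientCoveringMap_regProj`).

The two monodromy homomorphisms induce isomorphisms `O(r) ≅ D_p` (`orbifoldEquiv`) and
`H₁(M) ≅ ℤ / p` (`homologyEquiv`). Surjectivity is path-connectedness of the coverings. For injectivity, a
homomorphism from a fundamental group to a group is extended to a functor on paths, a `PathHom`. It
has to be shown that such a functor on the complement of the link, trivial on the squares of the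
meridians, is trivial on the loops which lift to the covering (`toFun_regProj_loop`). The complement
in `ℝ² × [-1, 1]` of the lines over `ℤ²` retracts to the plane without `ℤ²`, where a functor which
is trivial on the unit squares around the lattice points is path-independent; the boundary of such a
square maps to a meridian that is run twice, since the Conway sphere is the quotient of the plane by
rotations by `π` about these points. Path-independence upstairs gives triviality on all loops of the
quotient (`toFun_eq_one_of_loop`), because the lattice `2pℤ × 2pℤ` is generated by translations
along circles which are crushed at one of the two ends. The same lemma, applied with nothing
removed, shows that `UCover p q` is simply connected in the relevant sense (`toFun_ucover_loop`).

A meridian acts on the covering as a reflection, which fixes the end point over the link of the lift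
of its arc. This holds for any tubular chart around the link: the monodromy around its axis fixes
the points over the axis, by continuity, so it is a reflection or trivial, and a small half circle
around one of the vertical strings in the chart shows that it is not trivial
(`chartLift_exists_g_eq_sr`). Therefore `ω(m₁, m₂)` is, up to conjugation, the product of the two
reflections which fix the ends of a lift of the tunnel (`exists_omega`). For the two long tunnels
these reflections are equal (`exists_lift_longUpperTunnel`, `exists_lift_longLowerTunnel`), and for
the intermediate ones their product is a rotation of order at most two
(`exists_lift_intermediateTunnel`). In both cases the two reflections commute, so they generate at
most four elements, whereas the monodromy maps the link group onto a group of order `2p`.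
-/

/-! ### Homomorphisms from paths to a group -/

section PathHom

open scoped unitInterval
open CategoryTheory

/-- A functor from the fundamental groupoid of `X` to a group, spelled out on paths: it only
depends on the homotopy class of a path, and takes concatenations to products. -/
structure PathHom (X : Type*) [TopologicalSpace X] (Γ : Type*) [Group Γ] where
  toFun : ∀ {a b : X}, Path a b → Γ
  map_homotopic : ∀ {a b : X} {γ γ' : Path a b}, γ.Homotopic γ' → toFun γ = toFun γ'
  map_trans : ∀ {a b c : X} (γ : Path a b) (γ' : Path b c),
    toFun (γ.trans γ') = toFun γ * toFun γ'

namespace PathHom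

variable {X Y Γ : Type*} [TopologicalSpace X] [TopologicalSpace Y] [Group Γ] (T : PathHom X Γ)

theorem map_refl (a : X) : T.toFun (Path.refl a) = 1 := by
  have h := T.map_trans (Path.refl a) (Path.refl a)
  rw [Path.refl_trans_refl] at h
  exact (mul_eq_left (a := T.toFun (Path.refl a))).1 h.symm

/-- The value on a path only depends on the underlying function. -/
theorem congr {a b a' b' : X} {γ : Path a b} {γ' : Path a' b'} (h : ∀ t, γ t = γ' t) :
    T.toFun γ = T.toFun γ' := by
  have h0 : a = a' := by simpa using h 0
  have h1 : b = b' := by simpa using h 1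
  subst h0 h1
  rw [show γ = γ' from Path.ext (funext h)]

theorem map_const {a b : X} {γ : Path a b} {c : X} (h : ∀ t, γ t = c) : T.toFun γ = 1 := by
  rw [T.congr (γ' := Path.refl c) (fun t => h t), T.map_refl]

/-- Pullback along a continuous map. -/
def comap (f : C(Y, X)) : PathHom Y Γ where
  toFun γ := T.toFun (γ.map f.continuous)
  map_homotopic h := T.map_homotopic (h.map f)
  map_trans γ γ' := by rw [Path.map_trans, T.map_trans]

theorem comap_apply (f : C(Y, X)) {a b : Y} (γ : Path a b) :
    (T.comap f).toFun γ = T.toFun (γ.map f.continuous) := rfl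

theorem map_cast {a b a' b' : X} (γ : Path a b) (ha : a' = a) (hb : b' = b) :
    T.toFun (γ.cast ha hb) = T.toFun γ := T.congr fun _ => rfl

/-- The coboundary of a function. -/
def coboundary (κ : X → Γ) : PathHom X Γ where
  toFun {a b} _ := (κ a)⁻¹ * κ b
  map_homotopic _ := rfl
  map_trans _ _ := by group

/-- A functor to a group is determined by its values on short paths. -/
theorem eq_of_locally_eq {T T' : PathHom X Γ}
    (h : ∀ x : X, ∃ U ∈ nhds x, ∀ {a b : X} (γ : Path a b), (∀ t, γ t ∈ U) →
      T.toFun γ = T'.toFun γ) {a b : X} (γ : Path a b) : T.toFun γ = T'.toFun γ := by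
  choose U hU hT using h
  obtain ⟨t, t0, tmono, ⟨n, hn⟩, ht⟩ := exists_monotone_Icc_subset_open_cover_unitInterval
    (c := fun x : X => γ ⁻¹' interior (U x))
    (fun _ => isOpen_interior.preimage γ.continuous)
    (fun s _ => Set.mem_iUnion.2 ⟨γ s, mem_interior_iff_mem_nhds.2 (hU (γ s))⟩)
  have key : ∀ k, T.toFun (γ.subpath 0 (t k)) = T'.toFun (γ.subpath 0 (t k)) := by
    intro k
    induction k with
    | zero =>
      rw [t0, T.map_const (c := γ 0), T'.map_const (c := γ 0)] <;>
        intro s <;> simp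
    | succ k ih =>
      have e : ∀ S : PathHom X Γ, S.toFun (γ.subpath 0 (t (k + 1))) =
          S.toFun (γ.subpath 0 (t k)) * S.toFun (γ.subpath (t k) (t (k + 1))) := fun S => by
        rw [← S.map_trans]
        exact S.map_homotopic ⟨(Path.Homotopy.subpathTransSubpath γ 0 (t k) (t (k + 1))).symm⟩
      rw [e, e, ih]
      obtain ⟨x, hx⟩ := ht k
      rw [hT x]
      intro s
      have hs : γ.subpath (t k) (t (k + 1)) s ∈ Set.range (γ.subpath (t k) (t (k + 1))) := ⟨s, rfl⟩
      rw [Path.range_subpath_of_le _ _ _ (tmono (Nat.le_succ k))] at hs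
      obtain ⟨r, hr, hrs⟩ := hs
      rw [← hrs]
      exact interior_subset (hx hr)
  have h1 := key n
  rw [hn n le_rfl] at h1
  have e : ∀ S : PathHom X Γ, S.toFun (γ.subpath 0 1) = S.toFun γ := fun S => by
    rw [Path.subpath_zero_one, S.map_cast]
  rwa [e, e] at h1

theorem _root_.contractibleSpace_unitInterval_prod : ContractibleSpace (I × I) :=
  (contractible_iff_id_nullhomotopic _).2 ⟨(0, 0), ⟨
    { toFun := fun z => (unitInterval.symm z.1 * z.2.1, unitInterval.symm z.1 * z.2.2)
      continuous_toFun := by fun_prop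
      map_zero_left := fun z => by simp
      map_one_left := fun z => by simp }⟩⟩

/-- The sides of a square: going round one way or the other gives the same value. -/
theorem square (F : C(I × I, X)) {a b c d : X} (l : Path a b) (r : Path c d) (u : Path a c)
    (v : Path b d) (hl : ∀ s, l s = F (s, 0)) (hr : ∀ s, r s = F (s, 1))
    (hu : ∀ s, u s = F (0, s)) (hv : ∀ s, v s = F (1, s)) :
    T.toFun l * T.toFun v = T.toFun u * T.toFun r := by
  have := contractibleSpace_unitInterval_prod
  let l' : Path ((0 : I), (0 : I)) (1, 0) := ⟨⟨fun s => (s, 0), by fun_prop⟩, rfl, rfl⟩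
  let r' : Path ((0 : I), (1 : I)) (1, 1) := ⟨⟨fun s => (s, 1), by fun_prop⟩, rfl, rfl⟩
  let u' : Path ((0 : I), (0 : I)) (0, 1) := ⟨⟨fun s => (0, s), by fun_prop⟩, rfl, rfl⟩
  let v' : Path ((1 : I), (0 : I)) (1, 1) := ⟨⟨fun s => (1, s), by fun_prop⟩, rfl, rfl⟩
  have e := (T.comap F).map_homotopic
    (SimplyConnectedSpace.paths_homotopic (l'.trans v') (u'.trans r'))
  rw [map_trans, map_trans] at e
  rw [T.congr (γ := l) (γ' := l'.map F.continuous) hl,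
    T.congr (γ := r) (γ' := r'.map F.continuous) hr,
    T.congr (γ := u) (γ' := u'.map F.continuous) hu,
    T.congr (γ := v) (γ' := v'.map F.continuous) hv]
  exact e

/-- In a simply connected space, the value only depends on the end points. -/
theorem eq_of_simplyConnected [SimplyConnectedSpace X] {a b : X} (γ γ' : Path a b) :
    T.toFun γ = T.toFun γ' :=
  T.map_homotopic (SimplyConnectedSpace.paths_homotopic γ γ')

/-- The functor which extends a homomorphism from the fundamental group of a path-connected space,
after a choice of paths from the base point. Composition in `FundamentalGroup` is written from
right to left, whence the opposite group. -/
noncomputable def ofHom [PathConnectedSpace X] {x : X} (ψ : FundamentalGroup X x →* Γ) :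
    PathHom X Γᵐᵒᵖ where
  toFun {a b} γ := MulOpposite.op (ψ (loopClass
    (((PathConnectedSpace.somePath x a).trans γ).trans (PathConnectedSpace.somePath x b).symm)))
  map_homotopic {a b γ γ'} h := by
    have : loopClass (((PathConnectedSpace.somePath x a).trans γ).trans
        (PathConnectedSpace.somePath x b).symm) = loopClass
        (((PathConnectedSpace.somePath x a).trans γ').trans
        (PathConnectedSpace.somePath x b).symm) :=
      Path.Homotopic.Quotient.eq.2 (((Path.Homotopic.refl _).hcomp h).hcomp (Path.Homotopic.refl _))
    rw [this]
  map_trans {a b c} γ γ' := by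
    rw [← MulOpposite.op_mul, ← map_mul]
    congr 2
    let hom : ∀ {y z : X}, Path y z → (FundamentalGroupoid.mk y ⟶ FundamentalGroupoid.mk z) :=
      fun γ => Path.Homotopic.Quotient.mk γ
    let d : ∀ y : X, FundamentalGroupoid.mk x ⟶ FundamentalGroupoid.mk y :=
      fun y => hom (PathConnectedSpace.somePath x y)
    have key : (d a ≫ (hom γ ≫ hom γ')) ≫ CategoryTheory.Groupoid.inv (d c) =
        ((d a ≫ hom γ) ≫ CategoryTheory.Groupoid.inv (d b)) ≫
          ((d b ≫ hom γ') ≫ CategoryTheory.Groupoid.inv (d c)) := by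
      simp
    exact key

/-- If the functor which extends `ψ` is trivial on a loop at the base point, so is `ψ`. -/
theorem eq_one_of_ofHom_eq_one [PathConnectedSpace X] {x : X} (ψ : FundamentalGroup X x →* Γ)
    {γ : Path x x} (h : (ofHom ψ).toFun γ = 1) : ψ (loopClass γ) = 1 := by
  have h1 : ψ (loopClass (((PathConnectedSpace.somePath x x).trans γ).trans
      (PathConnectedSpace.somePath x x).symm)) = 1 := MulOpposite.op_injective h
  have h2 : loopClass (((PathConnectedSpace.somePath x x).trans γ).trans
      (PathConnectedSpace.somePath x x).symm) = (loopClass (PathConnectedSpace.somePath x x))⁻¹ *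
        (loopClass γ * loopClass (PathConnectedSpace.somePath x x)) := rfl
  rw [h2, map_mul, map_mul, map_inv, inv_mul_eq_one] at h1
  exact mul_eq_right.1 h1.symm

end PathHom

end PathHom

/-! ### Quotients by free actions of finite groups -/

section FiniteAction

open Topology

variable {G E X : Type*} [Group G] [Finite G] [MulAction G E] [TopologicalSpace E] [T2Space E]
  [ContinuousConstSMul G E] [TopologicalSpace X]

theorem exists_isOpen_smul_eq_of_nonempty (e : E) :
    ∃ U : Set E, IsOpen U ∧ e ∈ U ∧ ∀ g : G, ((g • ·) '' U ∩ U).Nonempty → g • e = e := by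
  have h : ∀ g : G, ∃ V : Set E, IsOpen V ∧ e ∈ V ∧ (((g • ·) '' V ∩ V).Nonempty → g • e = e) := by
    intro g
    by_cases hg : g • e = e
    · exact ⟨Set.univ, isOpen_univ, trivial, fun _ => hg⟩
    · obtain ⟨A, B, hA, hB, heA, heB, hAB⟩ := t2_separation hg
      refine ⟨(g • ·) ⁻¹' A ∩ B, (hA.preimage (continuous_const_smul g)).inter hB, ⟨heA, heB⟩, ?_⟩
      rintro ⟨_, ⟨y, hy, rfl⟩, hy'⟩
      exact absurd hy'.2 (Set.disjoint_left.1 hAB hy.1)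
  choose V hV heV hgV using h
  refine ⟨⋂ g, V g, isOpen_iInter_of_finite hV, Set.mem_iInter.2 heV, fun g hg => hgV g ?_⟩
  exact hg.mono (Set.inter_subset_inter (Set.image_mono (Set.iInter_subset _ _))
    (Set.iInter_subset _ _))

theorem Topology.IsQuotientMap.isQuotientCoveringMap_of_finite {f : E → X} (hf : IsQuotientMap f)
    (hfG : ∀ {e₁ e₂}, f e₁ = f e₂ ↔ e₁ ∈ MulAction.orbit G e₂)
    (free : ∀ (g : G) (e : E), g • e = e → g = 1) : IsQuotientCoveringMap f G where
  __ := hf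
  continuous_const_smul := continuous_const_smul
  apply_eq_iff_mem_orbit := hfG
  disjoint e := by
    obtain ⟨U, hU, heU, h⟩ := exists_isOpen_smul_eq_of_nonempty (G := G) e
    exact ⟨U, hU.mem_nhds heU, fun g hg => free g e (h g hg)⟩

end FiniteAction

/-! ### Monodromy along explicit lifts -/

section Monodromy

open Topology

variable {G E X : Type*} [Group G] [MulAction G E] [TopologicalSpace E] [TopologicalSpace X]
  {f : E → X}

theorem IsCoveringMap.monodromy_mk_of_lift (cov : IsCoveringMap f) {x y : X} (γ : Path x y)
    {a b : E} (Γ : Path a b) (ha : f a = x) (hb : f b = y) (h : ∀ t, f (Γ t) = γ t) :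
    cov.monodromy (Path.Homotopic.Quotient.mk γ) ⟨a, ha⟩ = ⟨b, hb⟩ := by
  refine cov.monodromy_eq_of_map_eq (Path.Homotopic.Quotient.mk Γ) ?_
  refine congrArg Path.Homotopic.Quotient.mk (Path.ext (funext fun t => ?_))
  exact h t

theorem IsCoveringMap.exists_path_lift (cov : IsCoveringMap f) {x y : X} (γ : Path x y)
    {a : E} (ha : f a = x) : ∃ (b : E) (Γ : Path a b), f b = y ∧ ∀ t, f (Γ t) = γ t := by
  have h0 : (γ : C(unitInterval, X)) 0 = f a := by simp [ha]
  have h := cov.liftPath_lifts (γ : C(unitInterval, X)) a h0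
  refine ⟨_, ⟨cov.liftPath γ a h0, cov.liftPath_zero _ _ _, rfl⟩, ?_, fun t => congrFun h t⟩
  simpa using congrFun h 1

namespace IsQuotientCoveringMap

variable (hf : IsQuotientCoveringMap f G)
include hf

theorem fundamentalGroupToMulOpposite_loopClass {x : X} {e : E} (he : f e = x) (γ : Path x x)
    (g : G) (Γ : Path e (g • e)) (h : ∀ t, f (Γ t) = γ t) :
    hf.fundamentalGroupToMulOpposite ⟨e, he⟩ (loopClass γ) = MulOpposite.op g := by
  rw [hf.fundamentalGroupToMulOpposite_apply_eq_Iff]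
  have hb : f (g • e) = x := (hf.map_smul g).trans he
  exact (congrArg Subtype.val
    (hf.isCoveringMap.monodromy_mk_of_lift γ Γ he hb h)).symm

/-- A loop with trivial monodromy lifts to a loop. -/
theorem exists_loop_lift {x : X} {e : E} (he : f e = x) (γ : Path x x)
    (h : hf.fundamentalGroupToMulOpposite ⟨e, he⟩ (loopClass γ) = 1) :
    ∃ Γ : Path e e, ∀ t, f (Γ t) = γ t := by
  obtain ⟨b, Γ, hb, hΓ⟩ := hf.isCoveringMap.exists_path_lift γ he
  have h1 := hf.isCoveringMap.monodromy_mk_of_lift γ Γ he hb hΓ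
  rw [hf.fundamentalGroupToMulOpposite_eq_one_iff] at h
  have : b = e := congrArg Subtype.val (h1.symm.trans h)
  exact ⟨Γ.cast rfl this.symm, hΓ⟩

theorem exists_lift_smul {x : X} {e : E} (he : f e = x) (γ : Path x x) :
    ∃ (g : G) (Γ : Path e (g • e)), ∀ t, f (Γ t) = γ t := by
  obtain ⟨b, Γ, hb, hΓ⟩ := hf.isCoveringMap.exists_path_lift γ he
  obtain ⟨g, hg⟩ := hf.apply_eq_iff_mem_orbit.1 (hb.trans he.symm)
  exact ⟨g, Γ.cast rfl hg, hΓ⟩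

end IsQuotientCoveringMap

end Monodromy

/-! ### The universal covering of the double branched covering -/

namespace TwoBridge

open Topology

/-- The equivalence relation on `ℝ² × [-1, 1]`, with coordinates `((α, β), t)`, whose quotient is
the join of the circles `ℝ / 2pℤ` of the coordinates `α` and `β`. -/
def ucoverSetoid (p : ℤ) : Setoid Pt where
  r a b := a.2 = b.2 ∧ ((a.2 : ℝ) ≠ -1 → ∃ m : ℤ, b.1.1 - a.1.1 = 2 * p * m) ∧
    ((a.2 : ℝ) ≠ 1 → ∃ m : ℤ, b.1.2 - a.1.2 = 2 * p * m)
  iseqv :=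
    { refl := fun a => ⟨rfl, fun _ => ⟨0, by simp⟩, fun _ => ⟨0, by simp⟩⟩
      symm := fun {a b} h => ⟨h.1.symm,
        fun ht => (h.2.1 (h.1 ▸ ht)).imp' (fun m => -m) fun m hm => by push_cast; linarith,
        fun ht => (h.2.2 (h.1 ▸ ht)).imp' (fun m => -m) fun m hm => by push_cast; linarith⟩
      trans := fun {a b c} h h' => ⟨h.1.trans h'.1,
        fun ht => by
          obtain ⟨m, hm⟩ := h.2.1 ht
          obtain ⟨n, hn⟩ := h'.2.1 (h.1 ▸ ht)
          exact ⟨m + n, by push_cast; linarith⟩,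
        fun ht => by
          obtain ⟨m, hm⟩ := h.2.2 ht
          obtain ⟨n, hn⟩ := h'.2.2 (h.1 ▸ ht)
          exact ⟨m + n, by push_cast; linarith⟩⟩ }

/-- The universal covering space of the double branched covering `DoubleCover p q`, in the linear
coordinates `α = x₁`, `β = q x₁ - p x₂` of the plane, each of which is constant along one of the
two directions that are crushed. (The space does not depend on `q`, but the group action below
does.) -/
def UCover (p _q : ℤ) : Type := Quotient (ucoverSetoid p)

instance (p q : ℤ) : TopologicalSpace (UCover p q) :=
  inferInstanceAs (TopologicalSpace (Quotient (ucoverSetoid p)))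

variable {p q : ℤ}

/-- The point of the universal covering represented by `((α, β), t)`. -/
def umk (p q : ℤ) (a : Pt) : UCover p q := Quotient.mk (ucoverSetoid p) a

theorem umk_eq_umk {a b : Pt} : umk p q a = umk p q b ↔
    a.2 = b.2 ∧ ((a.2 : ℝ) ≠ -1 → ∃ m : ℤ, b.1.1 - a.1.1 = 2 * p * m) ∧
    ((a.2 : ℝ) ≠ 1 → ∃ m : ℤ, b.1.2 - a.1.2 = 2 * p * m) :=
  Quotient.eq (r := ucoverSetoid p)

theorem umk_surjective : Function.Surjective (umk p q) := Quotient.mk_surjective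

theorem continuous_umk : Continuous (umk p q) := continuous_quotient_mk'

theorem isQuotientMap_umk : IsQuotientMap (umk p q) := isQuotientMap_quotient_mk'

/-- The level `t` of a point. -/
def level : UCover p q → Set.Icc (-1 : ℝ) 1 :=
  Quotient.lift (fun a : Pt => a.2) fun _ _ h => h.1

@[simp] theorem level_umk (a : Pt) : level (umk p q a) = a.2 := rfl

theorem continuous_level : Continuous (level : UCover p q → _) :=
  continuous_snd.quotient_lift _

theorem exp_eq_exp_iff (hp : 0 < p) (a b : ℝ) :
    Complex.exp (Complex.I * Real.pi * a / p) = Complex.exp (Complex.I * Real.pi * b / p) ↔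
      ∃ m : ℤ, b - a = 2 * p * m := by
  have hp' : (p : ℂ) ≠ 0 := by exact_mod_cast hp.ne'
  have hpi : (Real.pi : ℂ) ≠ 0 := by exact_mod_cast Real.pi_ne_zero
  rw [Complex.exp_eq_exp_iff_exists_int]
  constructor
  · rintro ⟨n, hn⟩
    refine ⟨-n, ?_⟩
    have h1 : (a : ℂ) = b + 2 * p * n := by
      have h2 : Complex.I * Real.pi * a = Complex.I * Real.pi * (b + 2 * p * n) := by
        field_simp at hn
        linear_combination Complex.I * Real.pi * hn
      exact mul_left_cancel₀ (mul_ne_zero Complex.I_ne_zero hpi) h2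
    have h3 : a = b + 2 * p * n := by exact_mod_cast h1
    push_cast
    linarith
  · rintro ⟨n, hn⟩
    refine ⟨-n, ?_⟩
    have h1 : b = a + 2 * p * n := by linarith
    rw [h1]
    push_cast
    field_simp
    ring

/-- The universal covering space in `ℂ²`, up to radial projection the standard picture of the
three-sphere as a join of two circles. -/
noncomputable def toComplex : UCover p q → ℂ × ℂ :=
  Quotient.lift (fun a : Pt =>
    (((1 + (a.2 : ℝ) : ℝ) : ℂ) * Complex.exp (Complex.I * Real.pi * a.1.1 / p),
      ((1 - (a.2 : ℝ) : ℝ) : ℂ) * Complex.exp (Complex.I * Real.pi * a.1.2 / p))) <| by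
    rintro ⟨⟨a, b⟩, t⟩ ⟨⟨a', b'⟩, t'⟩ ⟨h1, h2, h3⟩
    simp only at h1 h2 h3
    subst h1
    by_cases hp : (p : ℂ) = 0
    · simp [hp]
    have key : ∀ {a b : ℝ}, (∃ m : ℤ, b - a = 2 * p * m) →
        Complex.exp (Complex.I * Real.pi * a / p) = Complex.exp (Complex.I * Real.pi * b / p) := by
      rintro a b ⟨m, hm⟩
      refine Complex.exp_eq_exp_iff_exists_int.2 ⟨-m, ?_⟩
      rw [show b = a + 2 * p * m by linarith]
      push_cast
      field_simp
      ring
    refine Prod.ext ?_ ?_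
    · by_cases ht : (t : ℝ) = -1
      · simp [ht]
      · simp only [key (h2 ht)]
    · by_cases ht : (t : ℝ) = 1
      · simp [ht]
      · simp only [key (h3 ht)]

theorem continuous_toComplex : Continuous (toComplex : UCover p q → _) := by
  refine Continuous.quotient_lift ?_ _
  fun_prop

theorem toComplex_injective (hp : 0 < p) : Function.Injective (toComplex : UCover p q → _) := by
  intro P Q h
  obtain ⟨⟨⟨a, b⟩, t⟩, rfl⟩ := umk_surjective P
  obtain ⟨⟨⟨a', b'⟩, t'⟩, rfl⟩ := umk_surjective Q
  have h1 : ((1 + (t : ℝ) : ℝ) : ℂ) * Complex.exp (Complex.I * Real.pi * a / p) =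
      ((1 + (t' : ℝ) : ℝ) : ℂ) * Complex.exp (Complex.I * Real.pi * a' / p) := congrArg Prod.fst h
  have h2 : ((1 - (t : ℝ) : ℝ) : ℂ) * Complex.exp (Complex.I * Real.pi * b / p) =
      ((1 - (t' : ℝ) : ℝ) : ℂ) * Complex.exp (Complex.I * Real.pi * b' / p) := congrArg Prod.snd h
  have hn : ∀ x : ℝ, ‖Complex.exp (Complex.I * Real.pi * x / p)‖ = 1 := fun x => by
    rw [show Complex.I * Real.pi * x / p = ((Real.pi * x / p : ℝ) : ℂ) * Complex.I by
      push_cast; ring, Complex.norm_exp_ofReal_mul_I]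
  have ht : t = t' := by
    have h3 := congrArg norm h1
    rw [norm_mul, norm_mul, hn, hn, Complex.norm_real, Complex.norm_real, mul_one, mul_one,
      Real.norm_of_nonneg (by linarith [t.2.1]), Real.norm_of_nonneg (by linarith [t'.2.1])] at h3
    exact Subtype.ext (by linarith)
  subst ht
  refine umk_eq_umk.2 ⟨rfl, fun ht => ?_, fun ht => ?_⟩
  · refine (exp_eq_exp_iff hp _ _).1 (mul_left_cancel₀ ?_ h1)
    rw [Complex.ofReal_ne_zero]
    exact fun h => ht (by simp only; linarith)
  · refine (exp_eq_exp_iff hp _ _).1 (mul_left_cancel₀ ?_ h2)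
    rw [Complex.ofReal_ne_zero]
    exact fun h => ht (by simp only; linarith)

theorem t2Space_ucover (hp : 0 < p) : T2Space (UCover p q) :=
  T2Space.of_injective_continuous (toComplex_injective hp) continuous_toComplex

/-! ### The action of the dihedral group -/

/-- The rotation by `a`, lifted to the plane. -/
def shift (q a : ℤ) (c : Pt) : Pt := ((c.1.1 + 2 * a, c.1.2 + 2 * q * a), c.2)

/-- The rotation by `π` about the origin. -/
def flip (c : Pt) : Pt := ((-c.1.1, -c.1.2), c.2)

theorem umk_shift_congr {c d : Pt} (h : umk p q c = umk p q d) {a b : ℤ}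
    (hab : (a : ZMod p.natAbs) = b) : umk p q (shift q a c) = umk p q (shift q b d) := by
  obtain ⟨h1, h2, h3⟩ := umk_eq_umk.1 h
  rw [eq_comm, eq_comm, ZMod.intCast_eq_intCast_iff_dvd_sub, Int.natAbs_dvd] at hab
  obtain ⟨k, hk⟩ := hab
  have hk' : (b : ℝ) - a = p * k := by exact_mod_cast hk
  refine umk_eq_umk.2 ⟨h1, fun ht => ?_, fun ht => ?_⟩
  · obtain ⟨m, hm⟩ := h2 ht
    exact ⟨m + k, by simp only [shift]; push_cast; linear_combination hm + 2 * hk'⟩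
  · obtain ⟨m, hm⟩ := h3 ht
    exact ⟨m + q * k, by simp only [shift]; push_cast; linear_combination hm + 2 * q * hk'⟩

theorem umk_flip_congr {c d : Pt} (h : umk p q c = umk p q d) :
    umk p q (flip c) = umk p q (flip d) := by
  obtain ⟨h1, h2, h3⟩ := umk_eq_umk.1 h
  refine umk_eq_umk.2 ⟨h1, fun ht => ?_, fun ht => ?_⟩
  · obtain ⟨m, hm⟩ := h2 ht
    exact ⟨-m, by simp only [flip]; push_cast; linear_combination -hm⟩
  · obtain ⟨m, hm⟩ := h3 ht
    exact ⟨-m, by simp only [flip]; push_cast; linear_combination -hm⟩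

/-- The transformation of the plane by which an element of the dihedral group acts. -/
def dihedralFun (p q : ℤ) : DihedralGroup p.natAbs → Pt → Pt
  | .r i, c => shift q (i.cast : ℤ) c
  | .sr i, c => flip (shift q (i.cast : ℤ) c)

theorem continuous_shift (q a : ℤ) : Continuous (shift q a) := by unfold shift; fun_prop

theorem continuous_flip : Continuous flip := by unfold flip; fun_prop

theorem continuous_dihedralFun (g : DihedralGroup p.natAbs) : Continuous (dihedralFun p q g) := by
  cases g
  · exact continuous_shift _ _
  · exact continuous_flip.comp (continuous_shift _ _)

theorem umk_dihedralFun_congr (g : DihedralGroup p.natAbs) {c d : Pt}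
    (h : umk p q c = umk p q d) :
    umk p q (dihedralFun p q g c) = umk p q (dihedralFun p q g d) := by
  cases g
  · exact umk_shift_congr h rfl
  · exact umk_flip_congr (umk_shift_congr h rfl)

theorem shift_shift (a b : ℤ) (c : Pt) : shift q a (shift q b c) = shift q (a + b) c := by
  simp only [shift]
  push_cast
  ext <;> simp <;> ring

theorem shift_flip (a : ℤ) (c : Pt) : shift q a (flip c) = flip (shift q (-a) c) := by
  simp only [shift, flip]
  push_cast
  ext <;> simp <;> ring

theorem flip_flip (c : Pt) : flip (flip c) = c := by simp [flip]

/-- The dihedral group of order `2p` acts on the universal covering: `r i` is the rotation induced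
by the translation of the plane by `(2i, 0)`, and `sr 0` is induced by the rotation by `π` about
the origin. -/
instance : MulAction (DihedralGroup p.natAbs) (UCover p q) where
  smul g := Quotient.lift (fun c => umk p q (dihedralFun p q g c))
    fun _ _ h => umk_dihedralFun_congr g (Quotient.sound h)
  one_smul P := by
    obtain ⟨c, rfl⟩ := umk_surjective P
    change umk p q (shift q ((0 : ZMod p.natAbs).cast : ℤ) c) = umk p q c
    rw [ZMod.cast_zero]
    simp [shift]
  mul_smul g h P := by
    obtain ⟨c, rfl⟩ := umk_surjective P
    change umk p q (dihedralFun p q (g * h) c) =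
      umk p q (dihedralFun p q g (dihedralFun p q h c))
    rcases g with i | i <;> rcases h with j | j
    · change umk p q (shift q _ _) = umk p q (shift q _ (shift q _ _))
      rw [shift_shift]
      exact umk_shift_congr rfl (by simp)
    · change umk p q (flip (shift q _ _)) = umk p q (shift q _ (flip (shift q _ _)))
      rw [shift_flip, shift_shift]
      exact umk_flip_congr (umk_shift_congr rfl (by simp; ring))
    · change umk p q (flip (shift q _ _)) = umk p q (flip (shift q _ (shift q _ _)))
      rw [shift_shift]
      exact umk_flip_congr (umk_shift_congr rfl (by simp))
    · change umk p q (shift q _ _) = umk p q (flip (shift q _ (flip (shift q _ _))))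
      rw [shift_flip, flip_flip, shift_shift]
      exact umk_shift_congr rfl (by simp; ring)

theorem r_smul_umk (a : ℤ) (c : Pt) :
    (DihedralGroup.r (a : ZMod p.natAbs)) • umk p q c = umk p q (shift q a c) :=
  umk_shift_congr rfl (by simp)

theorem sr_smul_umk (a : ℤ) (c : Pt) :
    (DihedralGroup.sr (a : ZMod p.natAbs)) • umk p q c = umk p q (flip (shift q a c)) :=
  umk_flip_congr (umk_shift_congr rfl (by simp))

instance : ContinuousConstSMul (DihedralGroup p.natAbs) (UCover p q) where
  continuous_const_smul g :=
    (continuous_umk.comp (continuous_dihedralFun g)).quotient_lift _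

theorem int_eq_zero_of_dvd {a : ℤ} (h : p ∣ a) : (a : ZMod p.natAbs) = 0 :=
  (ZMod.intCast_zmod_eq_zero_iff_dvd a p.natAbs).2 (Int.natAbs_dvd.2 h)

/-- The rotations act freely. -/
theorem eq_zero_of_r_smul_eq (hpq : IsCoprime p q) {i : ZMod p.natAbs} {P : UCover p q}
    (h : DihedralGroup.r i • P = P) : i = 0 := by
  obtain ⟨a, rfl⟩ := ZMod.intCast_surjective i
  obtain ⟨⟨⟨x, y⟩, t⟩, rfl⟩ := umk_surjective P
  rw [r_smul_umk] at h
  obtain ⟨-, h2, h3⟩ := umk_eq_umk.1 h.symm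
  simp only [shift] at h2 h3
  refine int_eq_zero_of_dvd ?_
  by_cases ht : (t : ℝ) = -1
  · obtain ⟨m, hm⟩ := h3 (by rw [ht]; norm_num)
    have : (q * a : ℝ) = p * m := by linarith
    exact hpq.dvd_of_dvd_mul_left ⟨m, by exact_mod_cast this⟩
  · obtain ⟨m, hm⟩ := h2 ht
    have : (a : ℝ) = p * m := by linarith
    exact ⟨m, by exact_mod_cast this⟩

/-! ### The projections -/

/-- The plane in the coordinates `(x₁, x₂)`. -/
noncomputable def plane (p q : ℤ) (c : Pt) : Pt := ((c.1.1, (q * c.1.1 - c.1.2) / p), c.2)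

/-- The plane in the coordinates `(α, β)`. -/
def coord (p q : ℤ) (c : Pt) : Pt := ((c.1.1, q * c.1.1 - p * c.1.2), c.2)

theorem continuous_plane (p q : ℤ) : Continuous (plane p q) := by unfold plane; fun_prop

theorem continuous_coord (p q : ℤ) : Continuous (coord p q) := by unfold coord; fun_prop

theorem plane_coord (hp : 0 < p) (c : Pt) : plane p q (coord p q c) = c := by
  have hp' : (p : ℝ) ≠ 0 := by exact_mod_cast hp.ne'
  refine Prod.ext (Prod.ext rfl ?_) rfl
  simp only [plane, coord]
  field_simp
  ring

theorem coord_plane (hp : 0 < p) (c : Pt) : coord p q (plane p q c) = c := by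
  have hp' : (p : ℝ) ≠ 0 := by exact_mod_cast hp.ne'
  refine Prod.ext (Prod.ext rfl ?_) rfl
  simp only [plane, coord]
  field_simp
  ring

/-- The periods of the double branched covering, in the coordinates `(α, β)`. -/
theorem isPeriod_iff (hp : 0 < p) (hpq : IsCoprime p q) {t : ℝ} {v : ℝ × ℝ} :
    IsPeriod p q t (v.1, (q * v.1 - v.2) / p) ↔ ∃ i : ℤ,
      (t ≠ -1 → ∃ m : ℤ, v.1 = 2 * i + 2 * p * m) ∧
      (t ≠ 1 → ∃ m : ℤ, v.2 = 2 * q * i + 2 * p * m) := by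
  have hp' : (p : ℝ) ≠ 0 := by exact_mod_cast hp.ne'
  have e : (q : ℝ) * v.1 - p * ((q * v.1 - v.2) / p) = v.2 := by field_simp; ring
  by_cases h1 : t = 1
  · subst h1
    rw [isPeriod_one]
    constructor
    · rintro ⟨a, ha⟩
      exact ⟨a, fun _ => ⟨0, by simpa using ha⟩, fun h => absurd rfl h⟩
    · rintro ⟨i, h, -⟩
      obtain ⟨m, hm⟩ := h (by norm_num)
      exact ⟨i + p * m, by push_cast; linarith⟩
  by_cases h2 : t = -1
  · subst h2
    rw [isPeriod_neg_one hpq]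
    simp only [e]
    constructor
    · rintro ⟨c, hc⟩
      obtain ⟨a, b, hab⟩ := hpq
      have hab' : (a : ℝ) * p + b * q = 1 := by exact_mod_cast hab
      exact ⟨b * c, fun h => absurd rfl h, fun _ => ⟨a * c, by
        push_cast; linear_combination hc - 2 * c * hab'⟩⟩
    · rintro ⟨i, -, h⟩
      obtain ⟨m, hm⟩ := h (by norm_num)
      exact ⟨q * i + p * m, by push_cast; linarith⟩
  rw [isPeriod_of_ne h1 h2]
  constructor
  · rintro ⟨a, b, hab⟩
    have ha := congrArg Prod.fst hab
    have hb := congrArg Prod.snd hab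
    simp only at ha hb
    rw [hb] at e
    exact ⟨a, fun _ => ⟨0, by simpa using ha⟩, fun _ => ⟨-b, by
      rw [← e, ha]; push_cast; ring⟩⟩
  · rintro ⟨i, h, h'⟩
    obtain ⟨m, hm⟩ := h h2
    obtain ⟨n, hn⟩ := h' h1
    refine ⟨i + p * m, q * m - n, Prod.ext (by push_cast; linarith) ?_⟩
    simp only [hm, hn]
    push_cast
    field_simp
    ring

theorem isPeriod_plane_sub (hp : 0 < p) (hpq : IsCoprime p q) {c d : Pt} :
    IsPeriod p q c.2 ((plane p q d).1 - (plane p q c).1) ↔ ∃ i : ℤ,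
      ((c.2 : ℝ) ≠ -1 → ∃ m : ℤ, d.1.1 - c.1.1 = 2 * i + 2 * p * m) ∧
      ((c.2 : ℝ) ≠ 1 → ∃ m : ℤ, d.1.2 - c.1.2 = 2 * q * i + 2 * p * m) := by
  rw [← isPeriod_iff hp hpq (v := (d.1.1 - c.1.1, d.1.2 - c.1.2))]
  have : (plane p q d).1 - (plane p q c).1 =
      (d.1.1 - c.1.1, (q * (d.1.1 - c.1.1) - (d.1.2 - c.1.2)) / p) := by
    simp only [plane]
    ext <;> simp
    ring
  rw [this]

theorem isPeriod_plane_add (hp : 0 < p) (hpq : IsCoprime p q) {c d : Pt} :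
    IsPeriod p q c.2 ((plane p q d).1 + (plane p q c).1) ↔ ∃ i : ℤ,
      ((c.2 : ℝ) ≠ -1 → ∃ m : ℤ, d.1.1 + c.1.1 = 2 * i + 2 * p * m) ∧
      ((c.2 : ℝ) ≠ 1 → ∃ m : ℤ, d.1.2 + c.1.2 = 2 * q * i + 2 * p * m) := by
  rw [← isPeriod_iff hp hpq (v := (d.1.1 + c.1.1, d.1.2 + c.1.2))]
  have : (plane p q d).1 + (plane p q c).1 =
      (d.1.1 + c.1.1, (q * (d.1.1 + c.1.1) - (d.1.2 + c.1.2)) / p) := by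
    simp only [plane]
    ext <;> simp
    ring
  rw [this]

theorem r_smul_eq_iff {c d : Pt} (i : ℤ) :
    (DihedralGroup.r (i : ZMod p.natAbs)) • umk p q c = umk p q d ↔ c.2 = d.2 ∧
      ((c.2 : ℝ) ≠ -1 → ∃ m : ℤ, d.1.1 - c.1.1 = 2 * i + 2 * p * m) ∧
      ((c.2 : ℝ) ≠ 1 → ∃ m : ℤ, d.1.2 - c.1.2 = 2 * q * i + 2 * p * m) := by
  rw [r_smul_umk, umk_eq_umk]
  simp only [shift]
  refine and_congr Iff.rfl (and_congr (imp_congr Iff.rfl (exists_congr fun m => ?_))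
    (imp_congr Iff.rfl (exists_congr fun m => ?_))) <;>
  constructor <;> intro h <;> linarith

theorem sr_smul_eq_iff {c d : Pt} (i : ℤ) :
    (DihedralGroup.sr (i : ZMod p.natAbs)) • umk p q c = umk p q d ↔ c.2 = d.2 ∧
      ((c.2 : ℝ) ≠ -1 → ∃ m : ℤ, d.1.1 + c.1.1 = -(2 * i) + 2 * p * m) ∧
      ((c.2 : ℝ) ≠ 1 → ∃ m : ℤ, d.1.2 + c.1.2 = -(2 * q * i) + 2 * p * m) := by
  rw [sr_smul_umk, umk_eq_umk]
  simp only [shift, flip]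
  refine and_congr Iff.rfl (and_congr (imp_congr Iff.rfl (exists_congr fun m => ?_))
    (imp_congr Iff.rfl (exists_congr fun m => ?_))) <;>
  constructor <;> intro h <;> linarith

/-- The covering of the double branched covering by its universal covering space. -/
noncomputable def toDouble (hp : 0 < p) (hpq : IsCoprime p q) : UCover p q → DoubleCover p q :=
  Quotient.lift (fun c => Quotient.mk (coverSetoid p q) (plane p q c)) fun c d h =>
    Quotient.sound ⟨h.1, (isPeriod_plane_sub hp hpq).2
      ⟨0, fun ht => (h.2.1 ht).imp fun m hm => by rw [hm]; push_cast; ring,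
        fun ht => (h.2.2 ht).imp fun m hm => by rw [hm]; push_cast; ring⟩⟩

/-- The projection of the universal covering space of the double branched covering to the
three-sphere. -/
noncomputable def toSphere (hp : 0 < p) (hpq : IsCoprime p q) : UCover p q → Sphere p q :=
  fun P => proj p q (toDouble hp hpq P)

variable (hp : 0 < p) (hpq : IsCoprime p q)

theorem toSphere_umk (c : Pt) : toSphere hp hpq (umk p q c) = mk p q (plane p q c) := rfl

theorem toSphere_umk_coord (c : Pt) : toSphere hp hpq (umk p q (coord p q c)) = mk p q c := by
  rw [toSphere_umk, plane_coord hp]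

theorem continuous_proj : Continuous (proj p q) := continuous_id.quotient_map' _

theorem continuous_toDouble : Continuous (toDouble hp hpq) :=
  Continuous.quotient_lift (continuous_quotient_mk'.comp (continuous_plane p q)) _

theorem continuous_toSphere : Continuous (toSphere hp hpq) :=
  continuous_proj.comp (continuous_toDouble hp hpq)

theorem isQuotientMap_toDouble : IsQuotientMap (toDouble hp hpq) := by
  refine IsQuotientMap.of_comp (continuous_umk.comp (continuous_coord p q))
    (continuous_toDouble hp hpq) ?_
  have : toDouble hp hpq ∘ (umk p q ∘ coord p q) = Quotient.mk (coverSetoid p q) :=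
    funext fun c => congrArg (Quotient.mk (coverSetoid p q)) (plane_coord hp c)
  rw [this]
  exact isQuotientMap_quotient_mk'

theorem isQuotientMap_toSphere : IsQuotientMap (toSphere hp hpq) := by
  refine IsQuotientMap.of_comp (continuous_umk.comp (continuous_coord p q))
    (continuous_toSphere hp hpq) ?_
  have : toSphere hp hpq ∘ (umk p q ∘ coord p q) = Quotient.mk (sphereSetoid p q) :=
    funext fun c => toSphere_umk_coord hp hpq c
  rw [this]
  exact isQuotientMap_quotient_mk'

theorem toDouble_eq_iff {P Q : UCover p q} : toDouble hp hpq P = toDouble hp hpq Q ↔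
    ∃ i : ZMod p.natAbs, DihedralGroup.r i • P = Q := by
  obtain ⟨c, rfl⟩ := umk_surjective P
  obtain ⟨d, rfl⟩ := umk_surjective Q
  have h : toDouble hp hpq (umk p q c) = toDouble hp hpq (umk p q d) ↔
    c.2 = d.2 ∧ IsPeriod p q c.2 ((plane p q d).1 - (plane p q c).1) :=
    Quotient.eq (r := coverSetoid p q)
  rw [h, isPeriod_plane_sub hp hpq, ZMod.intCast_surjective.exists]
  simp only [r_smul_eq_iff, exists_and_left]

theorem toSphere_eq_iff {P Q : UCover p q} : toSphere hp hpq P = toSphere hp hpq Q ↔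
    ∃ g : DihedralGroup p.natAbs, g • P = Q := by
  have hg : (∃ g : DihedralGroup p.natAbs, g • P = Q) ↔
      (∃ i : ZMod p.natAbs, DihedralGroup.r i • P = Q) ∨
      (∃ i : ZMod p.natAbs, DihedralGroup.sr i • P = Q) := by
    constructor
    · rintro ⟨i | i, h⟩
      · exact Or.inl ⟨i, h⟩
      · exact Or.inr ⟨i, h⟩
    · rintro (⟨i, h⟩ | ⟨i, h⟩) <;> exact ⟨_, h⟩
  obtain ⟨c, rfl⟩ := umk_surjective P
  obtain ⟨d, rfl⟩ := umk_surjective Q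
  rw [hg, toSphere_umk, toSphere_umk, mk_eq_mk]
  change c.2 = d.2 ∧ (IsPeriod p q c.2 ((plane p q d).1 - (plane p q c).1) ∨
    IsPeriod p q c.2 ((plane p q d).1 + (plane p q c).1)) ↔ _
  rw [isPeriod_plane_sub hp hpq, isPeriod_plane_add hp hpq, and_or_left]
  refine or_congr ?_ ?_
  · rw [ZMod.intCast_surjective.exists]
    simp only [r_smul_eq_iff, exists_and_left]
  · rw [ZMod.intCast_surjective.exists, (Equiv.neg ℤ).surjective.exists
      (p := fun i : ℤ => DihedralGroup.sr (i : ZMod p.natAbs) • umk p q c = umk p q d)]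
    simp only [sr_smul_eq_iff, exists_and_left, Equiv.neg_apply]
    push_cast
    simp only [mul_neg, neg_neg]

theorem toSphere_smul (g : DihedralGroup p.natAbs) (P : UCover p q) :
    toSphere hp hpq (g • P) = toSphere hp hpq P :=
  ((toSphere_eq_iff hp hpq).2 ⟨g, rfl⟩).symm

end TwoBridge

/-! ### The two coverings -/

namespace TwoBridge

open Topology

variable {p q : ℤ} (hp : 0 < p) (hpq : IsCoprime p q)

theorem isClosed_setOf_int {Y : Type*} [TopologicalSpace Y] {f : Y → ℝ} (hf : Continuous f) :
    IsClosed {y | ∃ a : ℤ, f y = a} := by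
  have h : {y | ∃ a : ℤ, f y = a} = f ⁻¹' Set.range ((↑) : ℤ → ℝ) := by
    ext y
    simp [eq_comm]
  rw [h]
  exact Int.isClosedEmbedding_coe_real.isClosed_range.preimage hf

include hpq in
theorem isClosed_link : IsClosed (link p q) := by
  have hmk : IsQuotientMap (mk p q) := isQuotientMap_quotient_mk'
  rw [← hmk.isClosed_preimage]
  have h : mk p q ⁻¹' link p q =
      ({c : Pt | ∃ a : ℤ, c.1.1 = a} ∩ {c : Pt | ∃ a : ℤ, c.1.2 = a}) ∪
      ({c : Pt | (c.2 : ℝ) = 1} ∩ {c : Pt | ∃ a : ℤ, c.1.1 = a}) ∪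
      ({c : Pt | (c.2 : ℝ) = -1} ∩ {c : Pt | ∃ a : ℤ, (q : ℝ) * c.1.1 - p * c.1.2 = a}) := by
    ext ⟨x, t⟩
    simp only [Set.mem_preimage, Set.mem_union, Set.mem_inter_iff, Set.mem_ofPred_eq]
    by_cases h1 : (t : ℝ) = 1
    · rw [mem_link_one h1]
      have : (t : ℝ) ≠ -1 := by rw [h1]; norm_num
      tauto
    by_cases h2 : (t : ℝ) = -1
    · rw [mem_link_neg_one hpq h2]
      constructor
      · intro h
        exact Or.inr ⟨h2, h⟩
      · rintro ((⟨⟨a, ha⟩, ⟨b, hb⟩⟩ | h) | h)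
        · exact ⟨q * a - p * b, by rw [ha, hb]; push_cast; ring⟩
        · exact absurd h.1 h1
        · exact h.2
    · rw [mem_link_of_ne h1 h2]
      constructor
      · rintro ⟨a, b, h⟩
        exact Or.inl (Or.inl ⟨⟨a, congrArg Prod.fst h⟩, ⟨b, congrArg Prod.snd h⟩⟩)
      · rintro ((⟨⟨a, ha⟩, ⟨b, hb⟩⟩ | h) | h)
        · exact ⟨a, b, Prod.ext ha hb⟩
        · exact absurd h.1 h1
        · exact absurd h.1 h2
  rw [h]
  refine ((IsClosed.inter ?_ ?_).union (IsClosed.inter ?_ ?_)).union (IsClosed.inter ?_ ?_)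
  · exact isClosed_setOf_int (by fun_prop)
  · exact isClosed_setOf_int (by fun_prop)
  · exact isClosed_eq (by fun_prop) continuous_const
  · exact isClosed_setOf_int (by fun_prop)
  · exact isClosed_eq (by fun_prop) continuous_const
  · exact isClosed_setOf_int (by fun_prop)

/-- The points over the link, in coordinates. -/
theorem toSphere_umk_mem_link {c : Pt} : toSphere hp hpq (umk p q c) ∈ link p q ↔
    ∃ k : ℤ, ((c.2 : ℝ) ≠ -1 → ∃ m : ℤ, c.1.1 = k + p * m) ∧
      ((c.2 : ℝ) ≠ 1 → ∃ m : ℤ, c.1.2 = q * k + p * m) := by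
  have hp' : (p : ℝ) ≠ 0 := by exact_mod_cast hp.ne'
  have h0 : toSphere hp hpq (umk p q c) ∈ link p q ↔ ∃ a b : ℤ,
      IsPeriod p q c.2 ((plane p q c).1 - ((a : ℝ), (b : ℝ))) := mem_link
  rw [h0]
  have h1 : ∀ a b : ℤ, IsPeriod p q c.2 ((plane p q c).1 - ((a : ℝ), (b : ℝ))) ↔ ∃ i : ℤ,
      ((c.2 : ℝ) ≠ -1 → ∃ m : ℤ, c.1.1 - a = 2 * i + 2 * p * m) ∧
      ((c.2 : ℝ) ≠ 1 → ∃ m : ℤ, c.1.2 - (q * a - p * b) = 2 * q * i + 2 * p * m) :=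
    fun a b => by
      have h := isPeriod_plane_sub hp hpq (c := (((a : ℝ), q * a - p * b), c.2)) (d := c)
      have : (plane p q (((a : ℝ), q * a - p * b), c.2)).1 = ((a : ℝ), (b : ℝ)) := by
        simp only [plane]
        refine Prod.ext rfl ?_
        simp only
        field_simp
        ring
      rwa [this] at h
  simp only [h1]
  constructor
  · rintro ⟨a, b, i, h2, h3⟩
    refine ⟨a + 2 * i, fun ht => ?_, fun ht => ?_⟩
    · obtain ⟨m, hm⟩ := h2 ht
      exact ⟨2 * m, by push_cast; linarith⟩
    · obtain ⟨m, hm⟩ := h3 ht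
      exact ⟨2 * m - b, by push_cast; linarith⟩
  · rintro ⟨k, h2, h3⟩
    obtain ⟨m, hm⟩ : ∃ m : ℤ, (c.2 : ℝ) ≠ -1 → c.1.1 = k + p * m := by
      by_cases ht : (c.2 : ℝ) = -1
      · exact ⟨0, fun h => absurd ht h⟩
      · exact (h2 ht).imp fun m hm _ => hm
    obtain ⟨n, hn⟩ : ∃ m : ℤ, (c.2 : ℝ) ≠ 1 → c.1.2 = q * k + p * m := by
      by_cases ht : (c.2 : ℝ) = 1
      · exact ⟨0, fun h => absurd ht h⟩
      · exact (h3 ht).imp fun m hm _ => hm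
    refine ⟨k + p * m, q * m - n, 0, fun ht => ⟨0, ?_⟩, fun ht => ⟨0, ?_⟩⟩
    · simp only [hm ht]
      push_cast
      ring
    · simp only [hn ht]
      push_cast
      ring

/-- The points over the link are the fixed points of the reflections. -/
theorem toSphere_mem_link_iff {P : UCover p q} : toSphere hp hpq P ∈ link p q ↔
    ∃ i : ZMod p.natAbs, DihedralGroup.sr i • P = P := by
  obtain ⟨c, rfl⟩ := umk_surjective P
  rw [toSphere_umk_mem_link, ZMod.intCast_surjective.exists, (Equiv.neg ℤ).surjective.exists]
  simp only [sr_smul_eq_iff, true_and, Equiv.neg_apply]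
  refine exists_congr fun k => and_congr (imp_congr Iff.rfl (exists_congr fun m => ?_))
    (imp_congr Iff.rfl (exists_congr fun m => ?_)) <;>
  push_cast <;> constructor <;> intro h <;> linarith

/-- The part of the universal covering which lies over the complement of the link. -/
abbrev RegCover (hp : 0 < p) (hpq : IsCoprime p q) : Type :=
  ↥(toSphere hp hpq ⁻¹' (link p q)ᶜ)

/-- The projection of the regular part of the universal covering to the complement of the link. -/
noncomputable def regProj : RegCover hp hpq → ↥(link p q)ᶜ :=
  Set.restrictPreimage (link p q)ᶜ (toSphere hp hpq)

@[simp] theorem regProj_coe (P : RegCover hp hpq) :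
    (regProj hp hpq P : Sphere p q) = toSphere hp hpq P := rfl

instance : MulAction (DihedralGroup p.natAbs) (RegCover hp hpq) where
  smul g P := ⟨g • P.1, by
    have h := P.2
    rw [Set.mem_preimage] at h ⊢
    rwa [toSphere_smul]⟩
  one_smul P := Subtype.ext (one_smul _ P.1)
  mul_smul g h P := Subtype.ext (mul_smul g h P.1)

@[simp] theorem coe_smul (g : DihedralGroup p.natAbs) (P : RegCover hp hpq) :
    ((g • P : RegCover hp hpq) : UCover p q) = g • (P : UCover p q) := rfl

instance : ContinuousConstSMul (DihedralGroup p.natAbs) (RegCover hp hpq) where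
  continuous_const_smul g :=
    ((continuous_const_smul g).comp continuous_subtype_val).subtype_mk _

include hp in
theorem neZero_natAbs : NeZero p.natAbs := ⟨Int.natAbs_ne_zero.2 hp.ne'⟩

/-- The action of the dihedral group is free off the points over the link. -/
theorem isQuotientCoveringMap_regProj :
    IsQuotientCoveringMap (regProj hp hpq) (DihedralGroup p.natAbs) := by
  have := neZero_natAbs hp
  have := t2Space_ucover (q := q) hp
  have hq : IsQuotientMap (regProj hp hpq) :=
    (isQuotientMap_toSphere hp hpq).restrictPreimage_isOpen (isClosed_link hpq).isOpen_compl
  refine hq.isQuotientCoveringMap_of_finite (fun {P Q} => ?_) (fun g P h => ?_)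
  · rw [Subtype.ext_iff, regProj_coe, regProj_coe, eq_comm, toSphere_eq_iff]
    exact exists_congr fun g => (Subtype.ext_iff (a1 := g • Q) (a2 := P)).symm
  · have h' : g • (P : UCover p q) = P := congrArg Subtype.val h
    rcases g with i | i
    · rw [eq_zero_of_r_smul_eq hpq h', DihedralGroup.r_zero]
    · exact absurd ((toSphere_mem_link_iff hp hpq).2 ⟨i, h'⟩) P.2

/-- The inclusion of the rotations in the dihedral group. -/
def rotation (n : ℕ) : Multiplicative (ZMod n) →* DihedralGroup n where
  toFun i := .r i.toAdd
  map_one' := DihedralGroup.r_zero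
  map_mul' i j := by simp

instance : MulAction (Multiplicative (ZMod p.natAbs)) (UCover p q) :=
  MulAction.compHom _ (rotation p.natAbs)

instance : ContinuousConstSMul (Multiplicative (ZMod p.natAbs)) (UCover p q) where
  continuous_const_smul g :=
    continuous_const_smul (T := UCover p q) (DihedralGroup.r g.toAdd : DihedralGroup p.natAbs)

theorem isQuotientCoveringMap_toDouble :
    IsQuotientCoveringMap (toDouble hp hpq) (Multiplicative (ZMod p.natAbs)) := by
  have := neZero_natAbs hp
  have := t2Space_ucover (q := q) hp
  have : Finite (Multiplicative (ZMod p.natAbs)) := inferInstanceAs (Finite (ZMod p.natAbs))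
  refine (isQuotientMap_toDouble hp hpq).isQuotientCoveringMap_of_finite
    (fun {P Q} => ?_) (fun g P h => ?_)
  · rw [eq_comm, toDouble_eq_iff]
    rfl
  · exact congrArg Multiplicative.ofAdd (eq_zero_of_r_smul_eq hpq (i := g.toAdd) h)

end TwoBridge

/-! ### Paths in the universal covering -/

namespace TwoBridge

open Topology
open scoped unitInterval

variable {p q : ℤ}

/-- The symmetry of the universal covering which exchanges the two families of circles. -/
def swap : UCover p q → UCover p q :=
  Quotient.lift (fun c => umk p q ((c.1.2, c.1.1), ⟨-(c.2 : ℝ), by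
    have h1 := c.2.2.1
    have h2 := c.2.2.2
    constructor <;> linarith⟩)) <| by
    rintro ⟨⟨a, b⟩, t⟩ ⟨⟨a', b'⟩, t'⟩ ⟨h1, h2, h3⟩
    simp only at h1 h2 h3
    subst h1
    refine umk_eq_umk.2 ⟨rfl, fun ht => h3 fun h => ht (by simp [h]), fun ht => h2 fun h => ht (by
      simp [h])⟩

theorem continuous_swap : Continuous (swap : UCover p q → UCover p q) :=
  (continuous_umk.comp (by fun_prop)).quotient_lift _

theorem swap_swap (P : UCover p q) : swap (swap P) = P := by
  obtain ⟨c, rfl⟩ := umk_surjective P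
  change umk p q _ = umk p q _
  congr 1
  ext <;> simp

theorem level_swap (P : UCover p q) : (level (swap P) : ℝ) = -level P := by
  obtain ⟨c, rfl⟩ := umk_surjective P
  rfl

/-- Moving the level `t` towards `1`, which is reached at time `s = 1` if `t ≥ 0`. -/
noncomputable def pushLevel (s : I) (t : Set.Icc (-1 : ℝ) 1) : Set.Icc (-1 : ℝ) 1 :=
  ⟨min 1 (t + s * (1 + t)), by
    have h1 := t.2.1
    have h2 : 0 ≤ (s : ℝ) * (1 + t) := mul_nonneg s.2.1 (by linarith)
    exact le_min (by norm_num) (by linarith), min_le_left _ _⟩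

theorem pushLevel_zero (t : Set.Icc (-1 : ℝ) 1) : pushLevel 0 t = t :=
  Subtype.ext (by simpa [pushLevel] using t.2.2)

theorem pushLevel_one {t : Set.Icc (-1 : ℝ) 1} (ht : 0 < (t : ℝ)) :
    (pushLevel 1 t : ℝ) = 1 := by
  simp only [pushLevel, Set.Icc.coe_one, one_mul]
  exact min_eq_left (by linarith)

theorem le_pushLevel (s : I) (t : Set.Icc (-1 : ℝ) 1) : (t : ℝ) ≤ pushLevel s t := by
  have h1 := t.2.1
  have h2 : 0 ≤ (s : ℝ) * (1 + t) := mul_nonneg s.2.1 (by linarith)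
  exact le_min t.2.2 (by linarith)

theorem pushLevel_of_eq_one (s : I) {t : Set.Icc (-1 : ℝ) 1} (ht : (t : ℝ) = 1) :
    pushLevel s t = t :=
  Subtype.ext (le_antisymm (by rw [ht]; exact (pushLevel s t).2.2) (le_pushLevel s t))

theorem pushLevel_of_eq_neg_one (s : I) {t : Set.Icc (-1 : ℝ) 1} (ht : (t : ℝ) = -1) :
    pushLevel s t = t :=
  Subtype.ext (by simp [pushLevel, ht])

theorem continuous_pushLevel : Continuous fun c : I × Set.Icc (-1 : ℝ) 1 => pushLevel c.1 c.2 := by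
  unfold pushLevel
  fun_prop

/-- Moving a point of the universal covering towards the level `1`. -/
noncomputable def push (s : I) : UCover p q → UCover p q :=
  Quotient.lift (fun c : Pt => umk p q (c.1, pushLevel s c.2)) <| by
    rintro ⟨⟨a, b⟩, t⟩ ⟨⟨a', b'⟩, t'⟩ ⟨h1, h2, h3⟩
    simp only at h1 h2 h3
    subst h1
    refine umk_eq_umk.2 ⟨rfl, fun ht => h2 fun h => ht ?_, fun ht => h3 fun h => ht ?_⟩
    · simp only [pushLevel_of_eq_neg_one s h, h]
    · simp only [pushLevel_of_eq_one s h, h]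

theorem push_umk (s : I) (c : Pt) : push s (umk p q c) = umk p q (c.1, pushLevel s c.2) := rfl

theorem push_zero (P : UCover p q) : push 0 P = P := by
  obtain ⟨c, rfl⟩ := umk_surjective P
  rw [push_umk, pushLevel_zero]

theorem continuous_push : Continuous fun c : I × UCover p q => push c.1 c.2 := by
  refine isQuotientMap_umk.continuous_lift_prod_right (f := umk p q) ?_
  change Continuous fun c : I × Pt => umk p q (c.2.1, pushLevel c.1 c.2.2)
  refine continuous_umk.comp (Continuous.prodMk (by fun_prop) ?_)
  exact continuous_pushLevel.comp (f := fun c : I × Pt => (c.1, c.2.2)) (by fun_prop)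

/-- The angular coordinate `α`, off the level `-1`. -/
noncomputable def angle : UCover p q → AddCircle (2 * p : ℝ) :=
  open Classical in
  Quotient.lift (fun c : Pt => if (c.2 : ℝ) = -1 then 0 else (c.1.1 : AddCircle (2 * p : ℝ))) <| by
    rintro ⟨⟨a, b⟩, t⟩ ⟨⟨a', b'⟩, t'⟩ ⟨h1, h2, h3⟩
    simp only at h1 h2 h3
    subst h1
    by_cases ht : (t : ℝ) = -1
    · simp [ht]
    · simp only [if_neg ht]
      obtain ⟨m, hm⟩ := h2 ht
      rw [eq_comm, ← sub_eq_zero, ← AddCircle.coe_sub, AddCircle.coe_eq_zero_iff]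
      exact ⟨m, by rw [hm, zsmul_eq_mul, mul_comm]⟩

theorem angle_umk {c : Pt} (h : (c.2 : ℝ) ≠ -1) :
    angle (umk p q c) = (c.1.1 : AddCircle (2 * p : ℝ)) := if_neg h

theorem angle_umk_eq {c : Pt} (h : (c.2 : ℝ) ≠ -1) {x : ℝ}
    (hx : (x : AddCircle (2 * p : ℝ)) = angle (umk p q c)) : ∃ m : ℤ, x - c.1.1 = 2 * p * m := by
  rw [angle_umk h, ← sub_eq_zero, ← AddCircle.coe_sub, AddCircle.coe_eq_zero_iff] at hx
  obtain ⟨m, hm⟩ := hx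
  exact ⟨m, by rw [← hm, zsmul_eq_mul, mul_comm]⟩

theorem continuousOn_angle :
    ContinuousOn (angle : UCover p q → _) {P | (level P : ℝ) ≠ -1} := by
  have ho : IsOpen {P : UCover p q | (level P : ℝ) ≠ -1} :=
    (isClosed_eq (continuous_subtype_val.comp continuous_level) continuous_const).isOpen_compl
  refine (isQuotientMap_umk.continuousOn_isOpen_iff (f := umk p q) ho).2 ?_
  refine ContinuousOn.congr (f := fun c : Pt => (c.1.1 : AddCircle (2 * p : ℝ))) ?_ ?_
  · exact ((AddCircle.continuous_mk' _).comp (by fun_prop)).continuousOn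
  · intro c hc
    exact angle_umk hc

/-- Along a path off the level `-1`, there is a continuous choice of the coordinate `α`. -/
theorem exists_angle_lift (γ : C(I, UCover p q)) (h : ∀ u, (level (γ u) : ℝ) ≠ -1) :
    ∃ x : C(I, ℝ), ∀ u, (x u : AddCircle (2 * p : ℝ)) = angle (γ u) := by
  have hc : Continuous fun u => angle (γ u) :=
    continuousOn_angle.comp_continuous γ.continuous h
  obtain ⟨x0, hx0⟩ := QuotientAddGroup.mk_surjective (angle (γ 0))
  have cov : IsCoveringMap ((↑) : ℝ → AddCircle (2 * p : ℝ)) := AddCircle.isCoveringMap_coe _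
  obtain ⟨x, hx, -⟩ := cov.exists_path_lifts ⟨_, hc⟩ x0 hx0.symm
  exact ⟨x, fun u => congrFun hx u⟩

section Coboundary

variable {K : Set (UCover p q)} {Γ : Type*} [Group Γ] (T : PathHom ↥Kᶜ Γ) (k : ↥Kᶜ → Γ)

/-- The functor `T` agrees with the coboundary of `k` on the paths which lift to
`ℝ² × [-1, 1]`. -/
def IsCoboundaryOnLifts : Prop :=
  ∀ {a b : ↥Kᶜ} (γ : Path a b) (f : C(I, Pt)), (∀ u, umk p q (f u) = γ u) →
    T.toFun γ = (k a)⁻¹ * k b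

variable {T k}

theorem IsCoboundaryOnLifts.eq_of_mid (hT : IsCoboundaryOnLifts T k) {a b : ↥Kᶜ} (γ : Path a b)
    (h1 : ∀ u, (level (γ u).1 : ℝ) ≠ 1) (h2 : ∀ u, (level (γ u).1 : ℝ) ≠ -1) :
    T.toFun γ = (k a)⁻¹ * k b := by
  let g : C(I, UCover p q) := ⟨fun u => (γ u).1, by fun_prop⟩
  obtain ⟨x, hx⟩ := exists_angle_lift g h2
  obtain ⟨y, hy⟩ := exists_angle_lift ((⟨swap, continuous_swap⟩ : C(_, _)).comp g) (fun u h => by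
    have h' : (level (swap (γ u).1) : ℝ) = -1 := h
    rw [level_swap] at h'
    exact h1 u (by linarith))
  refine hT γ ⟨fun u => ((x u, y u), level (g u)),
    (by fun_prop : Continuous fun u => (x u, y u)).prodMk
      (continuous_level.comp g.continuous)⟩ fun u => ?_
  have hxu : (x u : AddCircle (2 * p : ℝ)) = angle (γ u).1 := hx u
  have hyu : (y u : AddCircle (2 * p : ℝ)) = angle (swap (γ u).1) := hy u
  have h1u := h1 u
  have h2u := h2 u
  change umk p q ((x u, y u), level (γ u).1) = (γ u).1
  generalize (γ u).1 = P at *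
  obtain ⟨⟨⟨α, β⟩, t⟩, rfl⟩ := umk_surjective P
  obtain ⟨m, hm⟩ := angle_umk_eq h2u hxu
  obtain ⟨n, hn⟩ := angle_umk_eq (c := ((β, α), ⟨-(t : ℝ), _⟩)) (fun h => h1u (by
    have h' : -(t : ℝ) = -1 := h
    simp only [level_umk]
    linarith)) hyu
  rw [eq_comm, umk_eq_umk]
  exact ⟨rfl, fun _ => ⟨m, hm⟩, fun _ => ⟨n, hn⟩⟩

/-- A path near the level `1` is deformed into this level, where it is determined by the
coordinate `α`. -/
theorem IsCoboundaryOnLifts.eq_of_top (hT : IsCoboundaryOnLifts T k)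
    (hK : ∀ (s : I) (P : UCover p q), 0 < (level P : ℝ) → push s P ∈ K → push 1 P ∈ K)
    {a b : ↥Kᶜ} (γ : Path a b) (h1 : ∀ u, 0 < (level (γ u).1 : ℝ))
    (h2 : ∀ u, push 1 (γ u).1 ∉ K) : T.toFun γ = (k a)⁻¹ * k b := by
  have hF : ∀ s u, push s (γ u).1 ∈ Kᶜ := fun s u h => h2 u (hK s _ (h1 u) h)
  have hFc : Continuous fun z : I × I => push z.1 (γ z.2).1 :=
    continuous_push.comp (f := fun z : I × I => (z.1, (γ z.2).1)) (by fun_prop)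
  let F : C(I × I, ↥Kᶜ) := ⟨fun z => ⟨push z.1 (γ z.2).1, hF _ _⟩, hFc.subtype_mk _⟩
  let l : Path (F (0, 0)) (F (1, 0)) := ⟨⟨fun s => F (s, 0), by fun_prop⟩, rfl, rfl⟩
  let r : Path (F (0, 1)) (F (1, 1)) := ⟨⟨fun s => F (s, 1), by fun_prop⟩, rfl, rfl⟩
  let u : Path (F (0, 0)) (F (0, 1)) := ⟨⟨fun s => F (0, s), by fun_prop⟩, rfl, rfl⟩
  let v : Path (F (1, 0)) (F (1, 1)) := ⟨⟨fun s => F (1, s), by fun_prop⟩, rfl, rfl⟩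
  have e := T.square F l r u v (fun _ => rfl) (fun _ => rfl) (fun _ => rfl) (fun _ => rfl)
  have ha : F (0, 0) = a := Subtype.ext (by
    change push 0 (γ 0).1 = a
    rw [push_zero, γ.source])
  have hb : F (0, 1) = b := Subtype.ext (by
    change push 0 (γ 1).1 = b
    rw [push_zero, γ.target])
  have hu : T.toFun u = T.toFun γ := T.congr fun s => Subtype.ext (push_zero _)
  have track : ∀ w : I, ∃ f : C(I, Pt), ∀ s, umk p q (f s) = push s (γ w).1 := by
    intro w
    obtain ⟨c, hc⟩ := umk_surjective (γ w).1
    refine ⟨⟨fun s => (c.1, pushLevel s c.2), continuous_const.prodMk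
      (continuous_pushLevel.comp (f := fun s : I => (s, c.2)) (by fun_prop))⟩, fun s => ?_⟩
    rw [← hc, push_umk]
    rfl
  obtain ⟨fl, hfl⟩ := track 0
  obtain ⟨fr, hfr⟩ := track 1
  have hv : T.toFun v = (k (F (1, 0)))⁻¹ * k (F (1, 1)) := by
    obtain ⟨x, hx⟩ := exists_angle_lift (⟨fun u => (γ u).1, by fun_prop⟩ : C(I, UCover p q))
      (fun w h => by
        have h' : (level (γ w).1 : ℝ) = -1 := h
        linarith [h1 w])
    refine hT v ⟨fun w => ((x w, 0), ⟨1, by norm_num⟩), by fun_prop⟩ fun w => ?_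
    have hxw : (x w : AddCircle (2 * p : ℝ)) = angle (γ w).1 := hx w
    have h1w := h1 w
    change umk p q ((x w, 0), ⟨1, _⟩) = push 1 (γ w).1
    generalize (γ w).1 = P at *
    obtain ⟨⟨⟨α, β⟩, t⟩, rfl⟩ := umk_surjective P
    rw [level_umk] at h1w
    simp only at h1w
    obtain ⟨m, hm⟩ := angle_umk_eq (by simp only; linarith) hxw
    rw [push_umk, eq_comm, umk_eq_umk]
    refine ⟨Subtype.ext (pushLevel_one h1w), fun _ => ⟨m, hm⟩, fun h => absurd ?_ h⟩
    exact pushLevel_one h1w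
  rw [hT l fl hfl, hT r fr hfr, hv, hu, ha, hb] at e
  rw [← mul_inv_eq_iff_eq_mul] at e
  rw [← e]
  group

/-- The same near the level `-1`. -/
theorem IsCoboundaryOnLifts.eq_of_bottom (hT : IsCoboundaryOnLifts T k)
    (hK : ∀ (s : I) (P : UCover p q), 0 < (level P : ℝ) → swap (push s P) ∈ K →
      swap (push 1 P) ∈ K)
    {a b : ↥Kᶜ} (γ : Path a b) (h1 : ∀ u, (level (γ u).1 : ℝ) < 0)
    (h2 : ∀ u, swap (push 1 (swap (γ u).1)) ∉ K) : T.toFun γ = (k a)⁻¹ * k b := by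
  let sw : C(↥(swap ⁻¹' K)ᶜ, ↥Kᶜ) :=
    ⟨fun P => ⟨swap P.1, P.2⟩,
      (continuous_swap.comp continuous_subtype_val).subtype_mk fun P => P.2⟩
  have hsw : ∀ P : ↥Kᶜ, swap P.1 ∈ (swap ⁻¹' K)ᶜ := by
    intro P
    rw [Set.mem_compl_iff, Set.mem_preimage, swap_swap]
    exact P.2
  let sw' : C(↥Kᶜ, ↥(swap ⁻¹' K)ᶜ) := ⟨fun P => ⟨swap P.1, hsw P⟩,
    (continuous_swap.comp continuous_subtype_val).subtype_mk hsw⟩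
  have hs : ∀ P, sw (sw' P) = P := fun P => Subtype.ext (swap_swap P.1)
  have h : IsCoboundaryOnLifts (T.comap sw) (k ∘ sw) := by
    intro a b γ f hf
    refine hT (γ.map sw.continuous) ⟨fun u => (((f u).1.2, (f u).1.1), ⟨-((f u).2 : ℝ), by
      have h1 := (f u).2.2.1
      have h2 := (f u).2.2.2
      constructor <;> linarith⟩), by fun_prop⟩ fun u => ?_
    change _ = swap (γ u).1
    rw [← hf u]
    rfl
  have e := h.eq_of_top hK (γ.map sw'.continuous) (fun u => by
    change 0 < (level (swap (γ u).1) : ℝ)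
    rw [level_swap]
    linarith [h1 u]) h2
  rw [PathHom.comap_apply, T.congr (γ' := γ) (fun u => hs (γ u))] at e
  simpa only [Function.comp_apply, hs] using e

theorem IsCoboundaryOnLifts.eq (hT : IsCoboundaryOnLifts T k) (hKc : IsClosed K)
    (hK : ∀ (s : I) (P : UCover p q), 0 < (level P : ℝ) → push s P ∈ K → push 1 P ∈ K)
    (hK' : ∀ (s : I) (P : UCover p q), 0 < (level P : ℝ) → swap (push s P) ∈ K →
      swap (push 1 P) ∈ K)
    {a b : ↥Kᶜ} (γ : Path a b) : T.toFun γ = (k a)⁻¹ * k b := by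
  refine PathHom.eq_of_locally_eq (T' := PathHom.coboundary k) (fun P => ?_) γ
  have hl : Continuous fun P : ↥Kᶜ => (level P.1 : ℝ) :=
    continuous_subtype_val.comp (continuous_level.comp continuous_subtype_val)
  have hp1 : Continuous (push 1 : UCover p q → _) :=
    continuous_push.comp (f := fun P => (1, P)) (by fun_prop)
  have push_self : ∀ Q : UCover p q, (level Q : ℝ) = 1 → push 1 Q = Q := by
    intro Q hQ
    obtain ⟨c, rfl⟩ := umk_surjective Q
    rw [push_umk, pushLevel_of_eq_one _ (t := c.2) hQ]
  by_cases h1 : (level P.1 : ℝ) = 1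
  · refine ⟨{Q | 0 < (level Q.1 : ℝ)} ∩ {Q | push 1 Q.1 ∈ Kᶜ}, IsOpen.mem_nhds
      ((isOpen_lt continuous_const hl).inter
        (hKc.isOpen_compl.preimage (hp1.comp continuous_subtype_val))) ⟨?_, ?_⟩,
      fun γ hγ => hT.eq_of_top hK γ (fun u => (hγ u).1) (fun u => (hγ u).2)⟩
    · rw [Set.mem_ofPred_eq, h1]
      norm_num
    · rw [Set.mem_ofPred_eq, push_self _ h1]
      exact P.2
  by_cases h2 : (level P.1 : ℝ) = -1
  · refine ⟨{Q | (level Q.1 : ℝ) < 0} ∩ {Q | swap (push 1 (swap Q.1)) ∈ Kᶜ}, IsOpen.mem_nhds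
      ((isOpen_lt hl continuous_const).inter
        (hKc.isOpen_compl.preimage (continuous_swap.comp (hp1.comp (continuous_swap.comp
          continuous_subtype_val))))) ⟨?_, ?_⟩,
      fun γ hγ => hT.eq_of_bottom hK' γ (fun u => (hγ u).1) (fun u => (hγ u).2)⟩
    · rw [Set.mem_ofPred_eq, h2]
      norm_num
    · rw [Set.mem_ofPred_eq, push_self, swap_swap]
      · exact P.2
      · rw [level_swap, h2, neg_neg]
  · refine ⟨{Q | (level Q.1 : ℝ) ≠ 1} ∩ {Q | (level Q.1 : ℝ) ≠ -1}, IsOpen.mem_nhds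
      ((isClosed_eq hl continuous_const).isOpen_compl.inter
        (isClosed_eq hl continuous_const).isOpen_compl) ⟨h1, h2⟩,
      fun γ hγ => hT.eq_of_mid γ (fun u => (hγ u).1) (fun u => (hγ u).2)⟩

end Coboundary

end TwoBridge

/-! ### Functors which are trivial on the loops that lift to `ℝ² × [-1, 1]` -/

namespace TwoBridge

open Topology
open scoped unitInterval

variable {p q : ℤ}

/-- The conditions on a removed set `K` under which a functor on the fundamental groupoid of the
complement can be computed in `ℝ² × [-1, 1]`: near the levels `± 1`, the complement is pushed to
these levels inside itself, and the coordinate circles over `1 / 2` avoid `K`. -/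
structure IsPushable (K : Set (UCover p q)) : Prop where
  isClosed : IsClosed K
  push_top : ∀ (s : I) (P : UCover p q), 0 < (level P : ℝ) → push s P ∈ K → push 1 P ∈ K
  push_bottom : ∀ (s : I) (P : UCover p q), 0 < (level P : ℝ) → swap (push s P) ∈ K →
    swap (push 1 P) ∈ K
  notMem_top : ∀ (β : ℝ) (t : Set.Icc (-1 : ℝ) 1), (t : ℝ) = 1 → umk p q ((1 / 2, β), t) ∉ K
  notMem_bottom : ∀ (α : ℝ) (t : Set.Icc (-1 : ℝ) 1), (t : ℝ) = -1 → umk p q ((α, 1 / 2), t) ∉ K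

section

variable (K : Set (UCover p q))

/-- The part of `ℝ² × [-1, 1]` over the complement of `K`. -/
abbrev RegPt : Type := ↥(umk p q ⁻¹' Kᶜ)

/-- The projection of `RegPt K`. -/
def regUmk : C(RegPt K, ↥Kᶜ) :=
  ⟨Set.restrictPreimage Kᶜ (umk p q), continuous_umk.restrictPreimage⟩

variable {K} {Γ : Type*} [Group Γ] {T : PathHom ↥Kᶜ Γ} [PathConnectedSpace (RegPt K)]

/-- The value of `T` on a chosen path from `a` to `b`; it is only used for functors for which the
choice does not matter. -/
noncomputable def pathValue (T : PathHom ↥Kᶜ Γ) (a b : RegPt K) : Γ :=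
  (T.comap (regUmk K)).toFun (PathConnectedSpace.somePath a b)

variable (hT : ∀ {a b : RegPt K} (γ γ' : Path a b),
  (T.comap (regUmk K)).toFun γ = (T.comap (regUmk K)).toFun γ')
include hT

theorem pathValue_mul (a b c : RegPt K) :
    pathValue T a b * pathValue T b c = pathValue T a c := by
  unfold pathValue
  rw [← PathHom.map_trans]
  exact hT _ _

theorem pathValue_self (a : RegPt K) : pathValue T a a = 1 := by
  simpa using pathValue_mul hT a a a

/-- The value is trivial if the end points are joined by a path in a fibre. -/
theorem pathValue_eq_one {a b : RegPt K} (f : C(I, Pt)) (h0 : f 0 = a) (h1 : f 1 = b)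
    (h : ∀ u, umk p q (f u) = umk p q a) : pathValue T a b = 1 := by
  have hm : ∀ u, f u ∈ umk p q ⁻¹' Kᶜ := fun u => by
    rw [Set.mem_preimage, h u]
    exact a.2
  let γ : Path a b := ⟨⟨fun u => ⟨f u, hm u⟩, by fun_prop⟩, Subtype.ext h0, Subtype.ext h1⟩
  rw [pathValue, hT _ γ, PathHom.comap_apply]
  exact T.map_const (c := regUmk K a) fun u => Subtype.ext (h u)

omit [PathConnectedSpace (RegPt K)] hT in
theorem umk_add_period (c : Pt) (m n : ℤ) :
    umk p q ((c.1.1 + 2 * p * m, c.1.2 + 2 * p * n), c.2) = umk p q c := by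
  rw [eq_comm, umk_eq_umk]
  exact ⟨rfl, fun _ => ⟨m, by simp⟩, fun _ => ⟨n, by simp⟩⟩

/-- The translation by a period. -/
def regTranslate (m n : ℤ) (a : RegPt K) : RegPt K :=
  ⟨((a.1.1.1 + 2 * p * m, a.1.1.2 + 2 * p * n), a.1.2), by
    rw [Set.mem_preimage, umk_add_period]
    exact a.2⟩

theorem pathValue_translate (m n : ℤ) (a b : RegPt K) :
    pathValue T (regTranslate m n a) (regTranslate m n b) = pathValue T a b := by
  have hc : Continuous (regTranslate m n : RegPt K → RegPt K) :=
    Continuous.subtype_mk (by fun_prop) _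
  rw [pathValue, hT _ ((PathConnectedSpace.somePath a b).map hc), pathValue]
  exact T.congr fun u => Subtype.ext (umk_add_period _ m n)

/-- The deck translations of `ℝ² × [-1, 1]` have no effect, if this is so at one point. -/
theorem pathValue_translate_self (m n : ℤ) (a b : RegPt K)
    (h : pathValue T b (regTranslate m n b) = 1) : pathValue T a (regTranslate m n a) = 1 := by
  rw [← pathValue_mul hT a b, ← pathValue_mul hT b (regTranslate m n b), h, one_mul,
    pathValue_translate hT, pathValue_mul hT, pathValue_self hT]

theorem pathValue_translate_snd (hK : IsPushable K) (n : ℤ) (a : RegPt K) :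
    pathValue T a (regTranslate 0 n a) = 1 := by
  refine pathValue_translate_self hT 0 n a
    ⟨((1 / 2, 0), ⟨1, by norm_num⟩), hK.notMem_top 0 _ rfl⟩ ?_
  refine pathValue_eq_one hT ⟨fun u => ((1 / 2, (u : ℝ) * (2 * p * n)), ⟨1, by norm_num⟩),
    by fun_prop⟩ (by simp) (by simp [regTranslate]) fun u => ?_
  exact umk_eq_umk.2 ⟨rfl, fun _ => ⟨0, by simp⟩, fun h => absurd rfl h⟩

theorem pathValue_translate_fst (hK : IsPushable K) (m : ℤ) (a : RegPt K) :
    pathValue T a (regTranslate m 0 a) = 1 := by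
  refine pathValue_translate_self hT m 0 a
    ⟨((0, 1 / 2), ⟨-1, by norm_num⟩), hK.notMem_bottom 0 _ rfl⟩ ?_
  refine pathValue_eq_one hT ⟨fun u => (((u : ℝ) * (2 * p * m), 1 / 2), ⟨-1, by norm_num⟩),
    by fun_prop⟩ (by simp) (by simp [regTranslate]) fun u => ?_
  exact umk_eq_umk.2 ⟨rfl, fun h => absurd rfl h, fun _ => ⟨0, by simp⟩⟩

/-- A path-independent functor does not distinguish points with the same projection. -/
theorem pathValue_eq_one_of_umk_eq (hK : IsPushable K) {a b : RegPt K}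
    (h : umk p q a = umk p q b) : pathValue T a b = 1 := by
  obtain ⟨h1, h2, h3⟩ := umk_eq_umk.1 h
  by_cases ht : (a.1.2 : ℝ) = 1
  · obtain ⟨m, hm⟩ := h2 (by rw [ht]; norm_num)
    rw [← pathValue_mul hT a (regTranslate m 0 a), pathValue_translate_fst hT hK, one_mul]
    refine pathValue_eq_one hT ⟨fun u => ((b.1.1.1,
      (1 - (u : ℝ)) * a.1.1.2 + u * b.1.1.2), a.1.2), by fun_prop⟩ ?_ ?_ fun u => ?_
    · exact Prod.ext (Prod.ext (by simp [regTranslate]; linarith) (by simp [regTranslate])) rfl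
    · exact Prod.ext (Prod.ext rfl (by simp)) h1
    · exact umk_eq_umk.2 ⟨rfl, fun _ => ⟨0, by simp [regTranslate]; linarith⟩,
        fun h => absurd ht h⟩
  by_cases ht' : (a.1.2 : ℝ) = -1
  · obtain ⟨n, hn⟩ := h3 ht
    rw [← pathValue_mul hT a (regTranslate 0 n a), pathValue_translate_snd hT hK, one_mul]
    refine pathValue_eq_one hT ⟨fun u => (((1 - (u : ℝ)) * a.1.1.1 + u * b.1.1.1,
      b.1.1.2), a.1.2), by fun_prop⟩ ?_ ?_ fun u => ?_
    · exact Prod.ext (Prod.ext (by simp [regTranslate]) (by simp [regTranslate]; linarith)) rfl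
    · exact Prod.ext (Prod.ext (by simp) rfl) h1
    · exact umk_eq_umk.2 ⟨rfl, fun h => absurd ht' h,
        fun _ => ⟨0, by simp [regTranslate]; linarith⟩⟩
  · obtain ⟨m, hm⟩ := h2 ht'
    obtain ⟨n, hn⟩ := h3 ht
    have hb : b = regTranslate 0 n (regTranslate m 0 a) := Subtype.ext
      (Prod.ext (Prod.ext (by simp [regTranslate]; linarith) (by simp [regTranslate]; linarith))
        h1.symm)
    rw [← pathValue_mul hT a (regTranslate m 0 a), pathValue_translate_fst hT hK, one_mul, hb,
      pathValue_translate_snd hT hK]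

/-- A functor which is path-independent in `ℝ² × [-1, 1]` is trivial on all loops. -/
theorem toFun_eq_one_of_loop (hK : IsPushable K) {a : ↥Kᶜ} (γ : Path a a) : T.toFun γ = 1 := by
  have hs : ∀ P : ↥Kᶜ, ∃ c : RegPt K, umk p q c = P := fun P => by
    obtain ⟨c, hc⟩ := umk_surjective P.1
    exact ⟨⟨c, by rw [Set.mem_preimage, hc]; exact P.2⟩, hc⟩
  choose lift hlift using hs
  let a₀ := lift a
  have key : IsCoboundaryOnLifts T fun P => pathValue T a₀ (lift P) := by
    intro b c γ f hf
    have hm : ∀ u, f u ∈ umk p q ⁻¹' Kᶜ := fun u => by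
      rw [Set.mem_preimage, hf]
      exact (γ u).2
    let b' : RegPt K := ⟨f 0, hm 0⟩
    let c' : RegPt K := ⟨f 1, hm 1⟩
    let γ' : Path b' c' := ⟨⟨fun u => ⟨f u, hm u⟩, by fun_prop⟩, rfl, rfl⟩
    have h : T.toFun γ = (T.comap (regUmk K)).toFun γ' := T.congr fun u => Subtype.ext (hf u).symm
    have h' : (T.comap (regUmk K)).toFun γ' = pathValue T b' c' := hT _ _
    have h0 : ∀ (P : ↥Kᶜ) (d : RegPt K), umk p q d = P →
        pathValue T a₀ (lift P) = pathValue T a₀ d := fun P d hd => by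
      rw [← pathValue_mul hT a₀ (lift P) d,
        pathValue_eq_one_of_umk_eq hT hK ((hlift P).trans hd.symm), mul_one]
    have hb := h0 b b' ((hf 0).trans (congrArg Subtype.val γ.source))
    have hc := h0 c c' ((hf 1).trans (congrArg Subtype.val γ.target))
    simp only [h, h', hb, hc]
    rw [eq_inv_mul_iff_mul_eq, pathValue_mul hT]
  rw [key.eq hK.isClosed hK.push_top hK.push_bottom, inv_mul_cancel]

end

end TwoBridge

/-! ### Paths in the punctured plane -/

namespace TwoBridge

open Topology
open scoped unitInterval

/-- The plane without the points of `ℤ²`. -/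
def puncturedPlane : Set (ℝ × ℝ) := {x | ¬∃ a b : ℤ, x = ((a : ℝ), (b : ℝ))}

theorem ne_intCast_of_mem_Ioo {k : ℤ} {x : ℝ} (hx : x ∈ Set.Ioo (k : ℝ) (k + 1)) (a : ℤ) :
    x ≠ a := by
  rintro rfl
  have h1 : k < a := by exact_mod_cast hx.1
  have h2 : a < k + 1 := by exact_mod_cast hx.2
  lia

/-- A vertical strip between lattice points. -/
def vStrip (k : ℤ) : Set (ℝ × ℝ) := Set.Ioo (k : ℝ) (k + 1) ×ˢ Set.univ

/-- A horizontal strip between lattice points. -/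
def hStrip (k : ℤ) : Set (ℝ × ℝ) := Set.univ ×ˢ Set.Ioo (k : ℝ) (k + 1)

theorem convex_vStrip (k : ℤ) : Convex ℝ (vStrip k) := (convex_Ioo _ _).prod convex_univ

theorem convex_hStrip (k : ℤ) : Convex ℝ (hStrip k) := convex_univ.prod (convex_Ioo _ _)

theorem vStrip_subset (k : ℤ) : vStrip k ⊆ puncturedPlane := by
  rintro x hx ⟨a, b, rfl⟩
  exact ne_intCast_of_mem_Ioo hx.1 a rfl

theorem hStrip_subset (k : ℤ) : hStrip k ⊆ puncturedPlane := by
  rintro x hx ⟨a, b, rfl⟩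
  exact ne_intCast_of_mem_Ioo hx.2 b rfl

theorem mem_Ioo_floor {x : ℝ} (h : ∀ a : ℤ, x ≠ a) : x ∈ Set.Ioo (⌊x⌋ : ℝ) (⌊x⌋ + 1) :=
  ⟨lt_of_le_of_ne (Int.floor_le x) (h _).symm, Int.lt_floor_add_one x⟩

theorem mem_strip {x : ℝ × ℝ} (hx : x ∈ puncturedPlane) : x ∈ vStrip ⌊x.1⌋ ∨ x ∈ hStrip ⌊x.2⌋ := by
  by_cases h : ∃ a : ℤ, x.1 = a
  · obtain ⟨a, ha⟩ := h
    exact Or.inr ⟨trivial, mem_Ioo_floor fun b hb => hx ⟨a, b, Prod.ext ha hb⟩⟩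
  · push Not at h
    exact Or.inl ⟨mem_Ioo_floor h, trivial⟩

section

variable {Γ : Type*} [Group Γ] (S : PathHom ↥puncturedPlane Γ)

open Classical in
/-- The value of a functor on the segment from `x` to `y`; a dummy value if the segment meets the
lattice. -/
noncomputable def segValue (x y : ℝ × ℝ) : Γ :=
  if h : ∀ t : I, AffineMap.lineMap x y (t : ℝ) ∈ puncturedPlane then
    S.toFun (a := ⟨_, h 0⟩) (b := ⟨_, h 1⟩)
      ⟨⟨fun t => ⟨AffineMap.lineMap x y (t : ℝ), h t⟩,
        (AffineMap.lineMap_continuous.comp continuous_subtype_val).subtype_mk _⟩, rfl, rfl⟩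
  else 1

theorem lineMap_mem_of_convex {C : Set (ℝ × ℝ)} (hC : Convex ℝ C) {x y : ℝ × ℝ} (hx : x ∈ C)
    (hy : y ∈ C) (t : I) : AffineMap.lineMap x y (t : ℝ) ∈ C :=
  hC.lineMap_mem hx hy t.2

/-- In a convex set which avoids the lattice, the value of a functor on a path only depends on the
end points. -/
theorem toFun_eq_segValue {C : Set (ℝ × ℝ)} (hC : Convex ℝ C) (hCR : C ⊆ puncturedPlane)
    {a b : ↥puncturedPlane} (γ : Path a b) (hγ : ∀ t, (γ t : ℝ × ℝ) ∈ C) :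
    S.toFun γ = segValue S a b := by
  have ha : (a : ℝ × ℝ) ∈ C := by simpa using hγ 0
  have hb : (b : ℝ × ℝ) ∈ C := by simpa using hγ 1
  have hl := lineMap_mem_of_convex hC ha hb
  have : ContractibleSpace C := hC.contractibleSpace ⟨_, ha⟩
  let i : C(C, ↥puncturedPlane) := ⟨Set.inclusion hCR, continuous_inclusion hCR⟩
  let γ₁ : Path (X := C) ⟨a, ha⟩ ⟨b, hb⟩ :=
    ⟨⟨fun t => ⟨γ t, hγ t⟩, by fun_prop⟩, by simp, by simp⟩
  let γ₂ : Path (X := C) ⟨a, ha⟩ ⟨b, hb⟩ :=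
    ⟨⟨fun t => ⟨AffineMap.lineMap (a : ℝ × ℝ) (b : ℝ × ℝ) (t : ℝ), hl t⟩,
      (AffineMap.lineMap_continuous.comp continuous_subtype_val).subtype_mk _⟩, by simp, by simp⟩
  have h := (S.comap i).eq_of_simplyConnected γ₁ γ₂
  rw [PathHom.comap_apply, PathHom.comap_apply] at h
  rw [segValue, dif_pos fun t => hCR (hl t)]
  exact (S.congr fun t => rfl).trans (h.trans (S.congr fun t => rfl))

theorem segValue_mul {C : Set (ℝ × ℝ)} (hC : Convex ℝ C) (hCR : C ⊆ puncturedPlane)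
    {x y z : ℝ × ℝ} (hx : x ∈ C) (hy : y ∈ C) (hz : z ∈ C) :
    segValue S x y * segValue S y z = segValue S x z := by
  have key : ∀ {x y : ℝ × ℝ} (hx : x ∈ C) (hy : y ∈ C),
      ∃ γ : Path (X := ↥puncturedPlane) ⟨x, hCR hx⟩ ⟨y, hCR hy⟩, ∀ t, (γ t : ℝ × ℝ) ∈ C := by
    intro x y hx hy
    have hl := lineMap_mem_of_convex hC hx hy
    exact ⟨⟨⟨fun t => ⟨AffineMap.lineMap x y (t : ℝ), hCR (hl t)⟩,
      (AffineMap.lineMap_continuous.comp continuous_subtype_val).subtype_mk _⟩,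
      by simp, by simp⟩, hl⟩
  obtain ⟨γ, hγ⟩ := key hx hy
  obtain ⟨γ', hγ'⟩ := key hy hz
  have h : ∀ t, (γ.trans γ' t : ℝ × ℝ) ∈ C := fun t => by
    rw [Path.trans_apply]
    split_ifs
    exacts [hγ _, hγ' _]
  rw [← toFun_eq_segValue S hC hCR γ hγ, ← toFun_eq_segValue S hC hCR γ' hγ',
    ← toFun_eq_segValue S hC hCR (γ.trans γ') h, S.map_trans]

theorem segValue_self {x : ℝ × ℝ} (hx : x ∈ puncturedPlane) : segValue S x x = 1 := by
  simpa using segValue_mul S (convex_singleton x) (Set.singleton_subset_iff.2 hx) rfl rfl rfl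

/-- The centres of the unit squares between lattice points. -/
noncomputable def centre (k j : ℤ) : ℝ × ℝ := ((k : ℝ) + 1 / 2, (j : ℝ) + 1 / 2)

theorem add_half_mem_Ioo (k : ℤ) : (k : ℝ) + 1 / 2 ∈ Set.Ioo (k : ℝ) (k + 1) := by
  constructor <;> linarith

theorem mk_mem_vStrip (k : ℤ) (y : ℝ) : ((k : ℝ) + 1 / 2, y) ∈ vStrip k :=
  ⟨add_half_mem_Ioo k, trivial⟩

theorem centre_mem_vStrip (k j : ℤ) : centre k j ∈ vStrip k := mk_mem_vStrip k _

theorem centre_mem_hStrip (k j : ℤ) : centre k j ∈ hStrip j := ⟨trivial, add_half_mem_Ioo j⟩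

theorem segValue_vStrip {k : ℤ} {x y z : ℝ × ℝ} (hx : x ∈ vStrip k) (hy : y ∈ vStrip k)
    (hz : z ∈ vStrip k) : segValue S x y * segValue S y z = segValue S x z :=
  segValue_mul S (convex_vStrip k) (vStrip_subset k) hx hy hz

theorem segValue_hStrip {k : ℤ} {x y z : ℝ × ℝ} (hx : x ∈ hStrip k) (hy : y ∈ hStrip k)
    (hz : z ∈ hStrip k) : segValue S x y * segValue S y z = segValue S x z :=
  segValue_mul S (convex_hStrip k) (hStrip_subset k) hx hy hz

/-- The boundary of the unit square around each lattice point has trivial value. -/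
def IsTrivialOnSquares : Prop := ∀ k j : ℤ,
  segValue S (centre k (j + 1)) (centre k j) * segValue S (centre k j) (centre (k + 1) j) =
    segValue S (centre k (j + 1)) (centre (k + 1) (j + 1)) *
      segValue S (centre (k + 1) (j + 1)) (centre (k + 1) j)

/-- The value on the path from the centre of a square to `(1/2, 1/2)`, first vertical, then
horizontal. -/
noncomputable def centreValue (k j : ℤ) : Γ :=
  segValue S (centre k j) (centre k 0) * segValue S (centre k 0) (centre 0 0)

variable {S} (hS : IsTrivialOnSquares S)
include hS

theorem centreValue_succ (k j : ℤ) :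
    segValue S (centre k j) (centre (k + 1) j) * centreValue S (k + 1) j = centreValue S k j := by
  have key : ∀ k j : ℤ, segValue S (centre k j) (centre k 0) *
      segValue S (centre k 0) (centre (k + 1) 0) = segValue S (centre k j) (centre (k + 1) j) *
        segValue S (centre (k + 1) j) (centre (k + 1) 0) := by
    intro k j
    -- stacking one more unit square on a column
    have step : ∀ j : ℤ, segValue S (centre k (j + 1)) (centre k 0) =
        segValue S (centre k (j + 1)) (centre k j) * segValue S (centre k j) (centre k 0) :=
      fun j => (segValue_vStrip S (centre_mem_vStrip _ _) (centre_mem_vStrip _ _)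
        (centre_mem_vStrip _ _)).symm
    have step' : ∀ j : ℤ, segValue S (centre (k + 1) (j + 1)) (centre (k + 1) 0) =
        segValue S (centre (k + 1) (j + 1)) (centre (k + 1) j) *
          segValue S (centre (k + 1) j) (centre (k + 1) 0) :=
      fun j => (segValue_vStrip S (centre_mem_vStrip _ _) (centre_mem_vStrip _ _)
        (centre_mem_vStrip _ _)).symm
    induction j with
    | zero =>
      rw [segValue_self S (vStrip_subset k (centre_mem_vStrip _ _)),
        segValue_self S (vStrip_subset (k + 1) (centre_mem_vStrip _ _)), one_mul, mul_one]
    | succ j ih =>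
      rw [step, step', mul_assoc, ih, ← mul_assoc, hS, mul_assoc]
    | pred j ih =>
      have h1 := step (-j - 1)
      have h2 := step' (-j - 1)
      have h3 := hS k (-j - 1)
      rw [sub_add_cancel] at h1 h2 h3
      rw [h1, h2, ← mul_assoc, ← h3, mul_assoc, mul_assoc, mul_right_inj] at ih
      exact ih
  rw [centreValue, centreValue, ← mul_assoc, ← key, mul_assoc, segValue_hStrip S
    (centre_mem_hStrip _ _) (centre_mem_hStrip _ _) (centre_mem_hStrip _ _)]

theorem segValue_mul_centreValue (k j : ℤ) :
    segValue S (centre k j) (centre 0 j) * centreValue S 0 j = centreValue S k j := by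
  have h : ∀ k l m : ℤ, segValue S (centre k j) (centre l j) * segValue S (centre l j) (centre m j)
      = segValue S (centre k j) (centre m j) := fun k l m => segValue_hStrip S
    (centre_mem_hStrip _ _) (centre_mem_hStrip _ _) (centre_mem_hStrip _ _)
  induction k with
  | zero => rw [segValue_self S (vStrip_subset 0 (centre_mem_vStrip _ _)), one_mul]
  | succ k ih =>
    rw [← mul_right_inj (segValue S (centre k j) (centre (k + 1) j)), centreValue_succ hS, ← ih,
      ← mul_assoc, h]
  | pred k ih =>
    have h1 := centreValue_succ hS (-k - 1) j
    rw [sub_add_cancel] at h1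
    rw [← h1, ← ih, ← mul_assoc, h]

/-- A functor which is trivial on the unit squares around the lattice points is
path-independent. -/
theorem toFun_eq_of_isTrivialOnSquares {a b : ↥puncturedPlane} (γ γ' : Path a b) :
    S.toFun γ = S.toFun γ' := by
  let κ : ↥puncturedPlane → Γ := fun x =>
    (segValue S x ((⌊x.1.1⌋ : ℝ) + 1 / 2, x.1.2) *
      segValue S ((⌊x.1.1⌋ : ℝ) + 1 / 2, x.1.2) (centre ⌊x.1.1⌋ 0) *
      segValue S (centre ⌊x.1.1⌋ 0) (centre 0 0))⁻¹
  have hv : ∀ (k : ℤ) (x : ↥puncturedPlane), (x : ℝ × ℝ) ∈ vStrip k → κ x =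
      (segValue S x (centre k 0) * segValue S (centre k 0) (centre 0 0))⁻¹ := by
    intro k x hx
    have hk : ⌊x.1.1⌋ = k := Int.floor_eq_iff.2 ⟨hx.1.1.le, hx.1.2⟩
    simp only [κ, hk]
    rw [segValue_vStrip S hx (mk_mem_vStrip _ _) (centre_mem_vStrip _ _)]
  have hh : ∀ (j : ℤ) (x : ↥puncturedPlane), (x : ℝ × ℝ) ∈ hStrip j → κ x =
      (segValue S x (centre 0 j) * centreValue S 0 j)⁻¹ := by
    intro j x hx
    have hx' : ((⌊x.1.1⌋ : ℝ) + 1 / 2, x.1.2) ∈ hStrip j := ⟨trivial, hx.2⟩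
    simp only [κ]
    rw [← segValue_vStrip S (mk_mem_vStrip _ _) (centre_mem_vStrip _ j) (centre_mem_vStrip _ 0),
      ← mul_assoc, segValue_hStrip S hx hx' (centre_mem_hStrip _ _), mul_assoc,
      ← segValue_hStrip S hx (centre_mem_hStrip ⌊x.1.1⌋ j) (centre_mem_hStrip 0 j), mul_assoc,
      segValue_mul_centreValue hS]
    rfl
  have key : ∀ γ : Path a b, S.toFun γ = (PathHom.coboundary κ).toFun γ := by
    refine PathHom.eq_of_locally_eq fun x => ?_
    rcases mem_strip x.2 with hx | hx
    · refine ⟨Subtype.val ⁻¹' vStrip ⌊x.1.1⌋, (((isOpen_Ioo.prod isOpen_univ).preimage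
        continuous_subtype_val).mem_nhds hx), fun {a b} γ hγ => ?_⟩
      have ha : (a : ℝ × ℝ) ∈ vStrip ⌊x.1.1⌋ := by simpa using hγ 0
      have hb : (b : ℝ × ℝ) ∈ vStrip ⌊x.1.1⌋ := by simpa using hγ 1
      change _ = (κ a)⁻¹ * κ b
      rw [toFun_eq_segValue S (convex_vStrip _) (vStrip_subset _) γ hγ, hv _ a ha, hv _ b hb,
        ← segValue_vStrip S ha hb (centre_mem_vStrip _ 0)]
      group
    · refine ⟨Subtype.val ⁻¹' hStrip ⌊x.1.2⌋, (((isOpen_univ.prod isOpen_Ioo).preimage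
        continuous_subtype_val).mem_nhds hx), fun {a b} γ hγ => ?_⟩
      have ha : (a : ℝ × ℝ) ∈ hStrip ⌊x.1.2⌋ := by simpa using hγ 0
      have hb : (b : ℝ × ℝ) ∈ hStrip ⌊x.1.2⌋ := by simpa using hγ 1
      change _ = (κ a)⁻¹ * κ b
      rw [toFun_eq_segValue S (convex_hStrip _) (hStrip_subset _) γ hγ, hh _ a ha, hh _ b hb,
        ← segValue_hStrip S ha hb (centre_mem_hStrip 0 _)]
      group
  rw [key, key]
  rfl

end

end TwoBridge

/-! ### Tubular charts around the strings -/

namespace TwoBridge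

open Topology
open scoped unitInterval

variable {p q : ℤ}

/-- Off the levels `± 1`, the projection to the sphere is open. -/
theorem isOpen_mk_image {W : Set Pt} (hW : IsOpen W)
    (h : ∀ c ∈ W, (c.2 : ℝ) ≠ 1 ∧ (c.2 : ℝ) ≠ -1) : IsOpen (mk p q '' W) := by
  have hmk : IsQuotientMap (mk p q) := isQuotientMap_quotient_mk'
  rw [← hmk.isOpen_preimage]
  have e : mk p q ⁻¹' (mk p q '' W) = ⋃ n : ℤ × ℤ,
      (fun c : Pt => (((2 * (n.1 : ℝ), 2 * (n.2 : ℝ)) + c.1, c.2) : Pt)) ⁻¹' W ∪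
      (fun c : Pt => (((2 * (n.1 : ℝ), 2 * (n.2 : ℝ)) - c.1, c.2) : Pt)) ⁻¹' W := by
    ext ⟨x, t⟩
    simp only [Set.mem_preimage, Set.mem_image, Set.mem_iUnion, Set.mem_union]
    constructor
    · rintro ⟨⟨y, t'⟩, hy, e⟩
      obtain ⟨h1, h2⟩ := h _ hy
      obtain ⟨rfl, h3⟩ := mk_eq_mk.1 e
      simp only [isPeriod_of_ne h1 h2] at h3
      rcases h3 with ⟨a, b, h3⟩ | ⟨a, b, h3⟩
      · refine ⟨(-a, -b), Or.inl ?_⟩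
        convert hy using 2
        rw [sub_eq_iff_eq_add.1 h3]
        ext <;> simp
      · refine ⟨(a, b), Or.inr ?_⟩
        rwa [← h3, add_sub_cancel_left]
    · rintro ⟨⟨a, b⟩, hy | hy⟩
      · obtain ⟨h1, h2⟩ := h _ hy
        refine ⟨_, hy, mk_eq_mk.2 ⟨rfl, Or.inl ?_⟩⟩
        rw [isPeriod_of_ne h1 h2]
        exact ⟨-a, -b, by ext <;> simp⟩
      · obtain ⟨h1, h2⟩ := h _ hy
        refine ⟨_, hy, mk_eq_mk.2 ⟨rfl, Or.inr ?_⟩⟩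
        rw [isPeriod_of_ne h1 h2]
        exact ⟨a, b, by ext <;> simp⟩
  rw [e]
  refine isOpen_iUnion fun n => (hW.preimage ?_).union (hW.preimage ?_) <;> fun_prop

section Disc

variable {E : Type*} [NormedAddCommGroup E] [NormedSpace ℝ E]

/-- The homeomorphism of a normed space with its unit ball, as a map of the space to itself. -/
noncomputable def disc (w : E) : E := Homeomorph.unitBall w

theorem isOpenEmbedding_disc : IsOpenEmbedding (disc : E → E) :=
  Metric.isOpen_ball.isOpenEmbedding_subtypeVal.comp Homeomorph.unitBall.isOpenEmbedding

theorem norm_disc_lt (w : E) : ‖disc w‖ < 1 := by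
  exact mem_ball_zero_iff.1 (Homeomorph.unitBall w).2

theorem disc_eq (w : E) : disc w = (√(1 + ‖w‖ ^ 2))⁻¹ • w := rfl

theorem disc_neg (w : E) : disc (-w) = -disc w := by simp [disc_eq]

theorem disc_zero : disc (0 : E) = 0 := by simp [disc_eq]

end Disc

/-- The point of the disc of radius `1` about the lattice point `(k, j)` with parameter `w`;
the rotation by `3 * π / 4` puts `w = 1` at `(k - 1 / 2, j + 1 / 2)`. -/
noncomputable def discPoint (k j : ℤ) (w : ℂ) : ℝ × ℝ :=
  ((k : ℝ) + (Complex.exp ((3 * Real.pi / 4 : ℝ) * Complex.I) * disc w).re,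
    (j : ℝ) + (Complex.exp ((3 * Real.pi / 4 : ℝ) * Complex.I) * disc w).im)

/-- The point with parameter `(w, s)` of the cylinder around the string over `(k, j)`. -/
noncomputable def cylinderPoint (k j : ℤ) (c : ℂ × ℝ) : Pt :=
  (discPoint k j c.1, ⟨disc c.2, by
    have h := abs_lt.1 (norm_disc_lt c.2)
    exact ⟨h.1.le, h.2.le⟩⟩)

theorem cylinderPoint_level_ne (k j : ℤ) (c : ℂ × ℝ) :
    ((cylinderPoint k j c).2 : ℝ) ≠ 1 ∧ ((cylinderPoint k j c).2 : ℝ) ≠ -1 := by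
  have h : -1 < disc c.2 ∧ disc c.2 < 1 := abs_lt.1 (norm_disc_lt c.2)
  exact ⟨h.2.ne, h.1.ne'⟩

theorem isOpenMap_cylinderPoint (k j : ℤ) : IsOpenMap (cylinderPoint k j) := by
  have h1 : IsOpenMap (discPoint k j) := by
    let e : ℂ ≃ₜ ℝ × ℝ := (((Homeomorph.mulLeft₀ _ (Complex.exp_ne_zero
      ((3 * Real.pi / 4 : ℝ) * Complex.I))).trans
      Complex.equivRealProdCLM.toHomeomorph).trans (Homeomorph.addLeft ((k : ℝ), (j : ℝ))))
    exact e.isOpenMap.comp isOpenEmbedding_disc.isOpenMap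
  have h2 : IsOpenMap fun s : ℝ => (cylinderPoint k j (0, s)).2 := by
    intro V hV
    have : (fun s : ℝ => (cylinderPoint k j (0, s)).2) '' V =
        Subtype.val ⁻¹' (disc '' V) := by
      ext t
      simp [cylinderPoint, Subtype.ext_iff]
    rw [this]
    exact (isOpenEmbedding_disc.isOpenMap _ hV).preimage continuous_subtype_val
  exact h1.prodMap h2

theorem continuous_cylinderPoint (k j : ℤ) : Continuous (cylinderPoint k j) := by
  have h1 : Continuous (disc : ℂ → ℂ) := isOpenEmbedding_disc.continuous
  have h2 : Continuous (disc : ℝ → ℝ) := isOpenEmbedding_disc.continuous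
  unfold cylinderPoint discPoint
  fun_prop

theorem int_eq_zero_of_abs_lt {a : ℤ} {x : ℝ} (h : x = 2 * a) (hx : |x| < 2) : a = 0 := by
  rw [h, abs_lt] at hx
  have h1 : (-1 : ℝ) < a := by linarith
  have h2 : (a : ℝ) < 1 := by linarith
  have h1' : -1 < a := by exact_mod_cast h1
  have h2' : a < 1 := by exact_mod_cast h2
  lia

/-- Two points of a disc of radius `1` about the origin differ by a vector of `2ℤ²` only if they
are equal. -/
theorem eq_of_sub_eq_two_mul {z w : ℂ} (hz : ‖z‖ < 1) (hw : ‖w‖ < 1) {a b : ℤ}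
    (ha : z.re - w.re = 2 * a) (hb : z.im - w.im = 2 * b) : z = w := by
  have h : ‖z - w‖ < 2 := (norm_sub_le z w).trans_lt (by linarith)
  have h1 := int_eq_zero_of_abs_lt ha
    ((by simpa using Complex.abs_re_le_norm (z - w) : |z.re - w.re| ≤ ‖z - w‖).trans_lt h)
  have h2 := int_eq_zero_of_abs_lt hb
    ((by simpa using Complex.abs_im_le_norm (z - w) : |z.im - w.im| ≤ ‖z - w‖).trans_lt h)
  apply Complex.ext
  · rw [h1] at ha
    simpa [sub_eq_zero] using ha
  · rw [h2] at hb
    simpa [sub_eq_zero] using hb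

theorem norm_exp_mul_disc_lt (w : ℂ) :
    ‖Complex.exp ((3 * Real.pi / 4 : ℝ) * Complex.I) * disc w‖ < 1 := by
  rw [norm_mul, Complex.norm_exp_ofReal_mul_I, one_mul]
  exact norm_disc_lt w

theorem mk_cylinderPoint_eq_iff (k j : ℤ) {w w' : ℂ} {s s' : ℝ} :
    mk p q (cylinderPoint k j (w, s)) = mk p q (cylinderPoint k j (w', s')) ↔
      w ^ 2 = w' ^ 2 ∧ s = s' := by
  obtain ⟨h1, h2⟩ := cylinderPoint_level_ne k j (w, s)
  rw [mk_eq_mk, isPeriod_of_ne h1 h2, isPeriod_of_ne h1 h2, sq_eq_sq_iff_eq_or_eq_neg, and_comm]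
  have hs : (cylinderPoint k j (w, s)).2 = (cylinderPoint k j (w', s')).2 ↔ s = s' :=
    Subtype.ext_iff.trans isOpenEmbedding_disc.injective.eq_iff
  rw [hs]
  refine and_congr (or_congr ⟨?_, ?_⟩ ⟨?_, ?_⟩) Iff.rfl
  · rintro ⟨a, b, h⟩
    have ha := congrArg Prod.fst h
    have hb := congrArg Prod.snd h
    simp only [cylinderPoint, discPoint, Prod.fst_sub, Prod.snd_sub, add_sub_add_left_eq_sub]
      at ha hb
    have e := eq_of_sub_eq_two_mul (norm_exp_mul_disc_lt w') (norm_exp_mul_disc_lt w) ha hb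
    exact (isOpenEmbedding_disc.injective (mul_left_cancel₀ (Complex.exp_ne_zero _) e)).symm
  · rintro rfl
    exact ⟨0, 0, by ext <;> simp [cylinderPoint]⟩
  · rintro ⟨a, b, h⟩
    have ha := congrArg Prod.fst h
    have hb := congrArg Prod.snd h
    simp only [cylinderPoint, discPoint, Prod.fst_add, Prod.snd_add] at ha hb
    have hw := norm_exp_mul_disc_lt w
    have e := eq_of_sub_eq_two_mul (a := a - k) (b := b - j) (norm_exp_mul_disc_lt w')
      (w := -(Complex.exp ((3 * Real.pi / 4 : ℝ) * Complex.I) * disc w)) (by rwa [norm_neg])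
      (by rw [Complex.neg_re, Int.cast_sub]; linarith)
      (by rw [Complex.neg_im, Int.cast_sub]; linarith)
    rw [← mul_neg, ← disc_neg] at e
    rw [isOpenEmbedding_disc.injective (mul_left_cancel₀ (Complex.exp_ne_zero _) e), neg_neg]
  · rintro rfl
    refine ⟨k, j, ?_⟩
    ext <;> simp only [cylinderPoint, discPoint, Prod.fst_add, Prod.snd_add, disc_neg, mul_neg,
      Complex.neg_re, Complex.neg_im] <;> ring

theorem mk_cylinderPoint_mem_link (k j : ℤ) {w : ℂ} {s : ℝ} :
    mk p q (cylinderPoint k j (w, s)) ∈ link p q ↔ w = 0 := by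
  obtain ⟨h1, h2⟩ := cylinderPoint_level_ne k j (w, s)
  have : cylinderPoint k j (w, s) = (discPoint k j w, (cylinderPoint k j (w, s)).2) := rfl
  rw [this, mem_link_of_ne h1 h2]
  constructor
  · rintro ⟨a, b, h⟩
    have ha := congrArg Prod.fst h
    have hb := congrArg Prod.snd h
    simp only [discPoint] at ha hb
    have hw := norm_exp_mul_disc_lt w
    -- the difference of the point and its antipode is a vector of `2ℤ²`
    have e := eq_of_sub_eq_two_mul (a := a - k) (b := b - j) hw
      (w := -(Complex.exp ((3 * Real.pi / 4 : ℝ) * Complex.I) * disc w)) (by rwa [norm_neg])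
      (by rw [Complex.neg_re, Int.cast_sub]; linarith)
      (by rw [Complex.neg_im, Int.cast_sub]; linarith)
    rw [self_eq_neg, mul_eq_zero, or_iff_right (Complex.exp_ne_zero _), ← disc_zero] at e
    exact isOpenEmbedding_disc.injective e
  · rintro rfl
    exact ⟨k, j, by simp [discPoint, disc_zero]⟩

/-- The tubular chart around the string over `(k, j)`. The disc in the sphere is the quotient of
the disc in the plane by the rotation by `π`, whence the square root. -/
noncomputable def stringChart (p q k j : ℤ) : TubularChart (link p q) where
  toFun c := mk p q (cylinderPoint k j (c.1 ^ (1 / 2 : ℂ), c.2))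
  isOpenEmbedding := by
    have hsqrt : ∀ z : ℂ, (z ^ (1 / 2 : ℂ)) ^ 2 = z := fun z => by
      rw [← Complex.cpow_nat_mul]
      simp
    have hquot : IsOpenQuotientMap (Prod.map (· ^ 2) id : ℂ × ℝ → ℂ × ℝ) :=
      (Complex.isOpenQuotientMap_pow 2).prodMap .id
    have e : (fun c : ℂ × ℝ => mk p q (cylinderPoint k j (c.1 ^ (1 / 2 : ℂ), c.2))) ∘
        (Prod.map (· ^ 2) id : ℂ × ℝ → ℂ × ℝ) = mk p q ∘ cylinderPoint k j := by
      funext ⟨w, s⟩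
      exact (mk_cylinderPoint_eq_iff k j).2 ⟨hsqrt _, rfl⟩
    refine .of_continuous_injective_isOpenMap ?_ ?_ ?_
    · rw [hquot.isQuotientMap.continuous_iff, e]
      exact continuous_mk.comp (continuous_cylinderPoint k j)
    · rintro ⟨z, s⟩ ⟨z', s'⟩ h
      obtain ⟨h1, h2⟩ := (mk_cylinderPoint_eq_iff k j).1 h
      rw [hsqrt, hsqrt] at h1
      exact Prod.ext h1 h2
    · intro V hV
      rw [← Set.image_preimage_eq V hquot.surjective, ← Set.image_comp, e, Set.image_comp]
      refine isOpen_mk_image (isOpenMap_cylinderPoint k j _ (hV.preimage hquot.continuous)) ?_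
      rintro _ ⟨c, -, rfl⟩
      exact cylinderPoint_level_ne k j c
  mem_iff z s := by
    rw [mk_cylinderPoint_mem_link]
    simp [Complex.cpow_eq_zero_iff]

theorem stringChart_sq (k j : ℤ) (w : ℂ) (s : ℝ) :
    (stringChart p q k j).toFun (w ^ 2, s) = mk p q (cylinderPoint k j (w, s)) := by
  refine (mk_cylinderPoint_eq_iff k j).2 ⟨?_, rfl⟩
  rw [← Complex.cpow_nat_mul]
  simp

end TwoBridge

/-! ### Functors which are trivial on the squares of the meridians -/

namespace TwoBridge

open Topology
open scoped unitInterval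

variable {p q : ℤ} {Γ : Type*} [Group Γ]

/-- The middle level, where the two tangles meet. -/
def zeroLevel : Set.Icc (-1 : ℝ) 1 := ⟨0, by norm_num⟩

/-- The inclusion of the punctured plane, modulo `J`, as the Conway sphere without the link. -/
def conway (p q : ℤ) : C(↥puncturedPlane, ↥(link p q)ᶜ) where
  toFun x := ⟨mk p q (x, zeroLevel), fun h => x.2 <|
    (mem_link_of_ne (by norm_num [zeroLevel]) (by norm_num [zeroLevel])).1 h⟩
  continuous_toFun := (continuous_mk.comp (by fun_prop)).subtype_mk _

/-- The rotation by `π` about a lattice point induces the identity of the Conway sphere. -/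
theorem segValue_reflect (T : PathHom ↥(link p q)ᶜ Γ) (k j : ℤ) {x y x' y' : ℝ × ℝ}
    (h : ∀ t : I, AffineMap.lineMap x y (t : ℝ) ∈ puncturedPlane)
    (hx : x + x' = (2 * (k : ℝ), 2 * (j : ℝ))) (hy : y + y' = (2 * (k : ℝ), 2 * (j : ℝ))) :
    segValue (T.comap (conway p q)) x y = segValue (T.comap (conway p q)) x' y' := by
  have e : ∀ t : I, AffineMap.lineMap x y (t : ℝ) + AffineMap.lineMap x' y' (t : ℝ) =
      (2 * (k : ℝ), 2 * (j : ℝ)) := fun t => by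
    rw [← hx]
    have : y + y' = x + x' := hy.trans hx.symm
    simp only [AffineMap.lineMap_apply, vsub_eq_sub, vadd_eq_add]
    rw [show y' = x + x' - y by rw [← this]; abel]
    module
  have h' : ∀ t : I, AffineMap.lineMap x' y' (t : ℝ) ∈ puncturedPlane := by
    rintro t ⟨a, b, hab⟩
    refine h t ⟨2 * k - a, 2 * j - b, ?_⟩
    rw [eq_sub_of_add_eq (e t), hab]
    ext <;> simp
  rw [segValue, segValue, dif_pos h, dif_pos h', PathHom.comap_apply, PathHom.comap_apply]
  refine T.congr fun t => Subtype.ext (mk_eq_mk.2 ⟨rfl, Or.inr ?_⟩)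
  exact isPeriod_even _ _ _ k j (congrArg Prod.fst ((add_comm _ _).trans (e t)))
    (congrArg Prod.snd ((add_comm _ _).trans (e t)))

/-- The half circle about `(k, j)` which starts at angle `3 * π / 4`. -/
theorem discPoint_exp (k j : ℤ) (t : ℝ) :
    discPoint k j (Complex.exp ((Real.pi * t : ℝ) * Complex.I)) =
      ((k : ℝ) + Real.cos (3 * Real.pi / 4 + Real.pi * t) / √2,
        (j : ℝ) + Real.sin (3 * Real.pi / 4 + Real.pi * t) / √2) := by
  have e : Complex.exp ((3 * Real.pi / 4 : ℝ) * Complex.I) *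
      disc (Complex.exp ((Real.pi * t : ℝ) * Complex.I)) =
      ((√2)⁻¹ : ℝ) • Complex.exp ((3 * Real.pi / 4 + Real.pi * t : ℝ) * Complex.I) := by
    rw [disc_eq, Complex.norm_exp_ofReal_mul_I, mul_smul_comm, ← Complex.exp_add]
    congr 2
    · norm_num
    · push_cast
      ring_nf
  rw [discPoint, e, Complex.smul_re, Complex.smul_im, Complex.exp_ofReal_mul_I_re,
    Complex.exp_ofReal_mul_I_im, smul_eq_mul, smul_eq_mul, inv_mul_eq_div,
    inv_mul_eq_div]

theorem div_sqrt_two_mem_Ioo {x : ℝ} (h : x < 0) (h' : -1 ≤ x) (k : ℤ) :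
    ((k + 1 : ℤ) : ℝ) + x / √2 ∈ Set.Ioo (k : ℝ) (k + 1) := by
  have h2 : 1 < √2 := Real.lt_sqrt_of_sq_lt (by norm_num)
  have h3 : x / √2 < 0 := div_neg_of_neg_of_pos h (by linarith)
  have h4 : -1 < x / √2 := by
    rw [lt_div_iff₀ (by linarith)]
    linarith
  push_cast
  constructor <;> linarith

theorem sqrt_two_div_two_div : √2 / 2 / √2 = 1 / 2 := by
  have : √2 ≠ 0 := by positivity
  field_simp

theorem discPoint_start (k j : ℤ) :
    discPoint (k + 1) (j + 1) (Complex.exp ((Real.pi * (0 : ℝ) : ℝ) * Complex.I)) =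
      centre k (j + 1) := by
  have e : 3 * Real.pi / 4 + Real.pi * 0 = Real.pi - Real.pi / 4 := by ring
  rw [discPoint_exp, e, Real.cos_pi_sub, Real.sin_pi_sub, Real.cos_pi_div_four,
    Real.sin_pi_div_four, neg_div, sqrt_two_div_two_div, centre]
  ext <;> push_cast <;> ring

theorem discPoint_middle (k j : ℤ) :
    discPoint (k + 1) (j + 1) (Complex.exp ((Real.pi * (1 / 2 : ℝ) : ℝ) * Complex.I)) =
      centre k j := by
  have e : 3 * Real.pi / 4 + Real.pi * (1 / 2) = Real.pi / 4 + Real.pi := by ring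
  rw [discPoint_exp, e, Real.cos_add_pi, Real.sin_add_pi, Real.cos_pi_div_four,
    Real.sin_pi_div_four, neg_div, sqrt_two_div_two_div, centre]
  ext <;> push_cast <;> ring

theorem discPoint_end (k j : ℤ) :
    discPoint (k + 1) (j + 1) (Complex.exp ((Real.pi * (1 : ℝ) : ℝ) * Complex.I)) =
      centre (k + 1) j := by
  have e : 3 * Real.pi / 4 + Real.pi * 1 = 2 * Real.pi - Real.pi / 4 := by ring
  rw [discPoint_exp, e, Real.cos_two_pi_sub, Real.sin_two_pi_sub, Real.cos_pi_div_four,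
    Real.sin_pi_div_four, neg_div, sqrt_two_div_two_div, centre]
  ext <;> push_cast <;> ring

theorem discPoint_mem_vStrip (k j : ℤ) {t : ℝ} (h0 : 0 ≤ t) (h1 : t ≤ 1 / 2) :
    discPoint (k + 1) j (Complex.exp ((Real.pi * t : ℝ) * Complex.I)) ∈ vStrip k := by
  rw [discPoint_exp]
  have hpi := Real.pi_pos
  have h2 : 0 ≤ Real.pi * t := by positivity
  have h3 : Real.pi * t ≤ Real.pi * (1 / 2) := by gcongr
  exact ⟨div_sqrt_two_mem_Ioo (Real.cos_neg_of_pi_div_two_lt_of_lt (by linarith) (by linarith))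
    (Real.neg_one_le_cos _) k, trivial⟩

theorem discPoint_mem_hStrip (k j : ℤ) {t : ℝ} (h0 : 1 / 2 ≤ t) (h1 : t ≤ 1) :
    discPoint k (j + 1) (Complex.exp ((Real.pi * t : ℝ) * Complex.I)) ∈ hStrip j := by
  rw [discPoint_exp]
  have hpi := Real.pi_pos
  have h2 : Real.pi * (1 / 2) ≤ Real.pi * t := by gcongr
  have h3 : Real.pi * t ≤ Real.pi := by nlinarith
  refine ⟨trivial, div_sqrt_two_mem_Ioo ?_ (Real.neg_one_le_sin _) j⟩
  rw [← sub_add_cancel (3 * Real.pi / 4 + Real.pi * t) Real.pi, Real.sin_add_pi, neg_lt_zero]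
  exact Real.sin_pos_of_pos_of_lt_pi (by linarith) (by linarith)

/-- The meridional loop of a string goes along two sides of the unit square around it. -/
theorem toFun_stringChart_loop (T : PathHom ↥(link p q)ᶜ Γ) (k j : ℤ) :
    T.toFun (stringChart p q (k + 1) (j + 1)).loop =
      segValue (T.comap (conway p q)) (centre k (j + 1)) (centre k j) *
        segValue (T.comap (conway p q)) (centre k j) (centre (k + 1) j) := by
  let f : ℝ → ℝ × ℝ := fun t =>
    discPoint (k + 1) (j + 1) (Complex.exp ((Real.pi * t : ℝ) * Complex.I))
  have hf : Continuous f := by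
    have : Continuous (disc : ℂ → ℂ) := isOpenEmbedding_disc.continuous
    simp only [f, discPoint]
    fun_prop
  have h1 : ∀ t : I, f ((t : ℝ) / 2) ∈ vStrip k := fun t =>
    discPoint_mem_vStrip k _ (by linarith [t.2.1]) (by linarith [t.2.2])
  have h2 : ∀ t : I, f ((1 + (t : ℝ)) / 2) ∈ hStrip j := fun t =>
    discPoint_mem_hStrip _ j (by linarith [t.2.1]) (by linarith [t.2.2])
  let a : ↥puncturedPlane := ⟨centre k (j + 1), vStrip_subset k (centre_mem_vStrip _ _)⟩
  let b : ↥puncturedPlane := ⟨centre k j, vStrip_subset k (centre_mem_vStrip _ _)⟩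
  let c : ↥puncturedPlane := ⟨centre (k + 1) j, hStrip_subset j (centre_mem_hStrip _ _)⟩
  have hs : f 0 = centre k (j + 1) := discPoint_start k j
  have hm : f (1 / 2) = centre k j := discPoint_middle k j
  have he : f 1 = centre (k + 1) j := discPoint_end k j
  let γ : Path a b := ⟨⟨fun t => ⟨f ((t : ℝ) / 2), vStrip_subset k (h1 t)⟩, by fun_prop⟩,
    Subtype.ext (Eq.trans (congrArg f (by simp)) hs),
    Subtype.ext (Eq.trans (congrArg f (by simp)) hm)⟩
  let γ' : Path b c := ⟨⟨fun t => ⟨f ((1 + (t : ℝ)) / 2), hStrip_subset j (h2 t)⟩, by fun_prop⟩,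
    Subtype.ext (Eq.trans (congrArg f (by simp)) hm),
    Subtype.ext (Eq.trans (congrArg f (by norm_num)) he)⟩
  have e1 := toFun_eq_segValue (T.comap (conway p q)) (convex_vStrip k) (vStrip_subset k) γ h1
  have e2 := toFun_eq_segValue (T.comap (conway p q)) (convex_hStrip j) (hStrip_subset j) γ' h2
  rw [← e1, ← e2, ← PathHom.map_trans, PathHom.comap_apply]
  refine T.congr fun t => Subtype.ext ?_
  have hl : ((stringChart p q (k + 1) (j + 1)).loop t : Sphere p q) = mk p q (f t, zeroLevel) := by
    change (stringChart p q (k + 1) (j + 1)).toFun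
      (Complex.exp (2 * Real.pi * Complex.I * ((t : ℝ) : ℂ)), 0) = _
    have : Complex.exp (2 * Real.pi * Complex.I * ((t : ℝ) : ℂ)) =
        Complex.exp ((Real.pi * t : ℝ) * Complex.I) ^ 2 := by
      rw [← Complex.exp_nat_mul]
      congr 1
      push_cast
      ring
    rw [this, stringChart_sq]
    congr 1
    exact Prod.ext rfl (Subtype.ext disc_zero)
  rw [hl]
  change _ = mk p q (((γ.trans γ') t).1, zeroLevel)
  congr 2
  rw [Path.trans_apply]
  split_ifs with ht
  · change f t = f ((2 * (t : ℝ)) / 2)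
    congr 1
    ring
  · change f t = f ((1 + (2 * (t : ℝ) - 1)) / 2)
    congr 1
    ring

/-- A functor which takes the meridional loops to involutions is trivial on the unit squares of
the Conway sphere: the square is a meridional loop, run twice. -/
theorem isTrivialOnSquares (T : PathHom ↥(link p q)ᶜ Γ)
    (hT : ∀ φ : TubularChart (link p q), T.toFun φ.loop * T.toFun φ.loop = 1) :
    IsTrivialOnSquares (T.comap (conway p q)) := by
  intro k j
  have h := hT (stringChart p q (k + 1) (j + 1))
  rw [toFun_stringChart_loop] at h
  have hv : ∀ x ∈ vStrip k, ∀ y ∈ vStrip k, ∀ t : I,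
      AffineMap.lineMap x y (t : ℝ) ∈ puncturedPlane :=
    fun x hx y hy t => vStrip_subset k (lineMap_mem_of_convex (convex_vStrip k) hx hy t)
  have hh : ∀ x ∈ hStrip j, ∀ y ∈ hStrip j, ∀ t : I,
      AffineMap.lineMap x y (t : ℝ) ∈ puncturedPlane :=
    fun x hx y hy t => hStrip_subset j (lineMap_mem_of_convex (convex_hStrip j) hx hy t)
  have e1 := segValue_reflect T (k + 1) (j + 1) (x := centre (k + 1) j) (y := centre k j)
    (x' := centre k (j + 1)) (y' := centre (k + 1) (j + 1))
    (hh _ (centre_mem_hStrip _ _) _ (centre_mem_hStrip _ _))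
    (by ext <;> simp [centre] <;> ring) (by ext <;> simp [centre] <;> ring)
  have e2 := segValue_reflect T (k + 1) (j + 1) (x := centre k j) (y := centre k (j + 1))
    (x' := centre (k + 1) (j + 1)) (y' := centre (k + 1) j)
    (hv _ (centre_mem_vStrip _ _) _ (centre_mem_vStrip _ _))
    (by ext <;> simp [centre] <;> ring) (by ext <;> simp [centre] <;> ring)
  have e3 := segValue_hStrip (T.comap (conway p q)) (centre_mem_hStrip k j)
    (centre_mem_hStrip (k + 1) j) (centre_mem_hStrip k j)
  have e4 := segValue_vStrip (T.comap (conway p q)) (centre_mem_vStrip k j)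
    (centre_mem_vStrip k (j + 1)) (centre_mem_vStrip k j)
  rw [segValue_self _ (hStrip_subset j (centre_mem_hStrip _ _))] at e3 e4
  rw [← e1, ← e2, ← inv_eq_of_mul_eq_one_right e3, ← inv_eq_of_mul_eq_one_left e4, ← mul_inv_rev]
  exact eq_inv_of_mul_eq_one_left h

end TwoBridge

/-! ### The fundamental groups of the two bases -/

namespace TwoBridge

open Topology
open scoped unitInterval

variable {p q : ℤ} (hp : 0 < p) (hpq : IsCoprime p q)

/-- The set of the points of the universal covering over the link. -/
def branchSet : Set (UCover p q) := toSphere hp hpq ⁻¹' link p q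

theorem umk_mem_branchSet {c : Pt} : umk p q c ∈ branchSet hp hpq ↔
    ∃ k : ℤ, ((c.2 : ℝ) ≠ -1 → ∃ m : ℤ, c.1.1 = k + p * m) ∧
      ((c.2 : ℝ) ≠ 1 → ∃ m : ℤ, c.1.2 = q * k + p * m) :=
  toSphere_umk_mem_link hp hpq

theorem isPushable_empty : IsPushable (∅ : Set (UCover p q)) where
  isClosed := isClosed_empty
  push_top _ _ _ h := h.elim
  push_bottom _ _ _ h := h.elim
  notMem_top _ _ _ h := h
  notMem_bottom _ _ _ h := h

theorem isPushable_branchSet : IsPushable (branchSet hp hpq) where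
  isClosed := (isClosed_link hpq).preimage (continuous_toSphere hp hpq)
  push_top s P hP h := by
    obtain ⟨c, rfl⟩ := umk_surjective P
    rw [level_umk] at hP
    rw [push_umk, umk_mem_branchSet] at h ⊢
    obtain ⟨k, h, -⟩ := h
    have hl := le_pushLevel s c.2
    exact ⟨k, fun _ => h (by simp only; linarith), fun h' => absurd (pushLevel_one hP) h'⟩
  push_bottom s P hP h := by
    obtain ⟨⟨⟨a, b⟩, t⟩, rfl⟩ := umk_surjective P
    rw [level_umk] at hP
    have e : ∀ s : I, swap (push s (umk p q ((a, b), t))) =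
      umk p q ((b, a), ⟨-(pushLevel s t : ℝ), _⟩) := fun s => rfl
    rw [e, umk_mem_branchSet] at h ⊢
    obtain ⟨k, -, h⟩ := h
    have hl := le_pushLevel s t
    have h1 := pushLevel_one hP
    simp only at hP h ⊢
    exact ⟨k, fun h' => absurd (by rw [h1]) h', fun _ => h (by linarith)⟩
  notMem_top β t ht h := by
    rw [umk_mem_branchSet] at h
    obtain ⟨k, h, -⟩ := h
    obtain ⟨m, hm⟩ := h (by simp only [ht]; norm_num)
    exact half_ne_int (k + p * m) (by push_cast; exact hm.symm)
  notMem_bottom α t ht h := by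
    rw [umk_mem_branchSet] at h
    obtain ⟨k, -, h⟩ := h
    obtain ⟨m, hm⟩ := h (by simp only [ht]; norm_num)
    exact half_ne_int (q * k + p * m) (by push_cast; exact hm.symm)

/-! ### The middle level is a deformation retract -/

/-- Moving the level towards the middle. -/
def pull (s : I) (t : Set.Icc (-1 : ℝ) 1) : Set.Icc (-1 : ℝ) 1 :=
  ⟨(1 - s) * t, by
    have h1 := s.2.1
    have h2 := s.2.2
    have h3 := t.2.1
    have h4 := t.2.2
    constructor <;> nlinarith⟩

theorem pull_zero (t : Set.Icc (-1 : ℝ) 1) : pull 0 t = t := Subtype.ext (by simp [pull])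

theorem pull_one (t : Set.Icc (-1 : ℝ) 1) : pull 1 t = zeroLevel :=
  Subtype.ext (by simp [pull, zeroLevel])

theorem continuous_pull : Continuous fun c : I × Set.Icc (-1 : ℝ) 1 => pull c.1 c.2 := by
  unfold pull
  fun_prop

theorem mk_mem_link_of_pull {s : I} {x : ℝ × ℝ} {t : Set.Icc (-1 : ℝ) 1}
    (h : mk p q (x, pull s t) ∈ link p q) : mk p q (x, t) ∈ link p q := by
  by_cases hs : (s : ℝ) = 0
  · rwa [show s = 0 from Subtype.ext hs, pull_zero] at h
  · have hs' : 0 < (s : ℝ) := lt_of_le_of_ne s.2.1 (Ne.symm hs)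
    have h2 := s.2.2
    have h3 := t.2.1
    have h4 := t.2.2
    obtain ⟨a, b, rfl⟩ := (mem_link_of_ne (by simp only [pull]; nlinarith)
      (by simp only [pull]; nlinarith)).1 h
    exact ⟨a, b, t, rfl⟩

theorem mk_pull_notMem_link (s : I) (c : RegPt (branchSet hp hpq)) :
    mk p q ((plane p q c).1, pull s c.1.2) ∉ link p q :=
  fun h => c.2 (mk_mem_link_of_pull h)

/-- The deformation of the regular part of `ℝ² × [-1, 1]` to the middle level, projected to the
sphere. -/
noncomputable def pullMap : C(I × RegPt (branchSet hp hpq), ↥(link p q)ᶜ) where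
  toFun c := ⟨mk p q ((plane p q c.2).1, pull c.1 c.2.1.2), mk_pull_notMem_link hp hpq _ _⟩
  continuous_toFun := by
    refine (continuous_mk.comp (Continuous.prodMk ?_ ?_)).subtype_mk _
    · exact (continuous_fst.comp (continuous_plane p q)).comp
        (continuous_subtype_val.comp continuous_snd)
    · exact continuous_pull.comp
        (f := fun c : I × RegPt (branchSet hp hpq) => (c.1, c.2.1.2)) (by fun_prop)

/-- The projection of the regular part of `ℝ² × [-1, 1]` to the punctured plane. -/
noncomputable def planeMap : C(RegPt (branchSet hp hpq), ↥puncturedPlane) where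
  toFun c := ⟨(plane p q c).1, fun ⟨a, b, h⟩ => c.2 ⟨a, b, c.1.2, by
    rw [toSphere_umk, ← h]
    rfl⟩⟩
  continuous_toFun := ((continuous_fst.comp (continuous_plane p q)).comp
    continuous_subtype_val).subtype_mk _

/-- The inclusion of the punctured plane as the middle level. -/
noncomputable def middleMap : C(↥puncturedPlane, RegPt (branchSet hp hpq)) where
  toFun x := ⟨coord p q (x, zeroLevel), fun h => (conway p q x).2 (by
    have h' : toSphere hp hpq (umk p q (coord p q (x, zeroLevel))) ∈ link p q := h
    rwa [toSphere_umk_coord] at h')⟩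
  continuous_toFun := ((continuous_coord p q).comp (by fun_prop)).subtype_mk _

/-- The projection of the regular part of the universal covering, as a bundled map. -/
noncomputable def regProjMap : C(↥(branchSet hp hpq)ᶜ, ↥(link p q)ᶜ) :=
  ⟨regProj hp hpq, (isQuotientCoveringMap_regProj hp hpq).continuous⟩

theorem comap_regProj_eq {Γ : Type*} [Group Γ] (T : PathHom ↥(link p q)ᶜ Γ)
    (hT : ∀ φ : TubularChart (link p q), T.toFun φ.loop * T.toFun φ.loop = 1)
    {a b : RegPt (branchSet hp hpq)} (γ γ' : Path a b) :
    ((T.comap (regProjMap hp hpq)).comap (regUmk _)).toFun γ =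
      ((T.comap (regProjMap hp hpq)).comap (regUmk _)).toFun γ' := by
  let l : ∀ c : RegPt (branchSet hp hpq), Path (pullMap hp hpq (0, c)) (pullMap hp hpq (1, c)) :=
    fun c => ⟨⟨fun s => pullMap hp hpq (s, c), by fun_prop⟩, rfl, rfl⟩
  have key : ∀ γ : Path a b, ((T.comap (regProjMap hp hpq)).comap (regUmk _)).toFun γ =
      T.toFun (l a) * (T.comap (conway p q)).toFun (γ.map (planeMap hp hpq).continuous) *
        (T.toFun (l b))⁻¹ := by
    intro γ
    let F : C(I × I, ↥(link p q)ᶜ) := ⟨fun z => pullMap hp hpq (z.1, γ z.2), by fun_prop⟩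
    let u : Path (F (0, 0)) (F (0, 1)) := ⟨⟨fun s => F (0, s), by fun_prop⟩, rfl, rfl⟩
    let v : Path (F (1, 0)) (F (1, 1)) := ⟨⟨fun s => F (1, s), by fun_prop⟩, rfl, rfl⟩
    let la : Path (F (0, 0)) (F (1, 0)) := ⟨⟨fun s => F (s, 0), by fun_prop⟩, rfl, rfl⟩
    let lb : Path (F (0, 1)) (F (1, 1)) := ⟨⟨fun s => F (s, 1), by fun_prop⟩, rfl, rfl⟩
    have e := T.square F la lb u v (fun _ => rfl) (fun _ => rfl) (fun _ => rfl) (fun _ => rfl)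
    have ea : T.toFun la = T.toFun (l a) := T.congr fun s => by
      change pullMap hp hpq (s, γ 0) = pullMap hp hpq (s, a)
      rw [γ.source]
    have eb : T.toFun lb = T.toFun (l b) := T.congr fun s => by
      change pullMap hp hpq (s, γ 1) = pullMap hp hpq (s, b)
      rw [γ.target]
    have eu : T.toFun u = ((T.comap (regProjMap hp hpq)).comap (regUmk _)).toFun γ :=
      T.congr fun s => Subtype.ext (by
        change mk p q ((plane p q (γ s)).1, pull 0 (γ s).1.2) = mk p q (plane p q (γ s))
        rw [pull_zero]
        rfl)
    have ev : T.toFun v = (T.comap (conway p q)).toFun (γ.map (planeMap hp hpq).continuous) :=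
      T.congr fun s => Subtype.ext (by
        change mk p q ((plane p q (γ s)).1, pull 1 (γ s).1.2) =
          mk p q ((plane p q (γ s)).1, zeroLevel)
        rw [pull_one])
    rw [ea, eb, eu, ev] at e
    rw [e, mul_inv_cancel_right]
  rw [key, key, toFun_eq_of_isTrivialOnSquares (isTrivialOnSquares T hT)
    (γ.map (planeMap hp hpq).continuous) (γ'.map (planeMap hp hpq).continuous)]

/-! ### Connectedness -/

theorem pathConnectedSpace_puncturedPlane : PathConnectedSpace ↥puncturedPlane := by
  rw [← isPathConnected_iff_pathConnectedSpace]
  have h : puncturedPlane = (Set.range fun n : ℤ × ℤ => ((n.1 : ℝ), (n.2 : ℝ)))ᶜ := by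
    ext x
    simp [puncturedPlane, eq_comm]
  rw [h]
  refine (Set.countable_range _).isPathConnected_compl_of_one_lt_rank ?_
  rw [rank_prod', Module.rank_self]
  exact_mod_cast (by norm_num : (1 : ℕ) < 1 + 1)

theorem pathConnectedSpace_regPt : PathConnectedSpace (RegPt (branchSet hp hpq)) := by
  have := pathConnectedSpace_puncturedPlane
  have key : ∀ c : RegPt (branchSet hp hpq), Joined c (middleMap hp hpq (planeMap hp hpq c)) := by
    intro c
    have hm : ∀ s : I, umk p q (c.1.1, pull s c.1.2) ∈ (branchSet hp hpq)ᶜ :=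
      fun s h => mk_pull_notMem_link hp hpq s c h
    refine ⟨⟨⟨fun s => ⟨(c.1.1, pull s c.1.2), hm s⟩, ?_⟩, ?_, ?_⟩⟩
    · exact Continuous.subtype_mk (continuous_const.prodMk
        (continuous_pull.comp (f := fun s : I => (s, c.1.2)) (by fun_prop))) _
    · exact Subtype.ext (Prod.ext rfl (pull_zero _))
    · refine Subtype.ext (Prod.ext ?_ (pull_one _))
      have h : c.1.1 = (coord p q (plane p q c.1)).1 := by rw [coord_plane hp]
      exact h
  refine ⟨(PathConnectedSpace.nonempty (X := ↥puncturedPlane)).map (middleMap hp hpq),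
    fun c d => (key c).trans (Joined.trans ?_ (key d).symm)⟩
  exact ⟨(PathConnectedSpace.somePath (planeMap hp hpq c) (planeMap hp hpq d)).map
    (middleMap hp hpq).continuous⟩

theorem contractibleSpace_regPt_empty : ContractibleSpace (RegPt (∅ : Set (UCover p q))) := by
  have hc : Convex ℝ ((Set.univ : Set (ℝ × ℝ)) ×ˢ Set.Icc (-1 : ℝ) 1) :=
    convex_univ.prod (convex_Icc _ _)
  have : ContractibleSpace ↥((Set.univ : Set (ℝ × ℝ)) ×ˢ Set.Icc (-1 : ℝ) 1) :=
    hc.contractibleSpace ⟨(0, 0), trivial, by norm_num⟩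
  let e : RegPt (∅ : Set (UCover p q)) ≃ₜ ↥((Set.univ : Set (ℝ × ℝ)) ×ˢ Set.Icc (-1 : ℝ) 1) :=
    { toFun := fun c => ⟨(c.1.1, c.1.2), trivial, c.1.2.2⟩
      invFun := fun c => ⟨(c.1.1, ⟨c.1.2, c.2.2⟩), fun h => h⟩
      left_inv := fun c => rfl
      right_inv := fun c => rfl
      continuous_toFun := by fun_prop
      continuous_invFun := by fun_prop }
  exact e.contractibleSpace

theorem pathConnectedSpace_regCover : PathConnectedSpace (RegCover hp hpq) := by
  have := pathConnectedSpace_regPt hp hpq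
  refine Function.Surjective.pathConnectedSpace (f := regUmk (branchSet hp hpq)) ?_
    (regUmk _).continuous
  rintro ⟨P, hP⟩
  obtain ⟨c, rfl⟩ := umk_surjective P
  exact ⟨⟨c, hP⟩, rfl⟩

theorem pathConnectedSpace_ucover : PathConnectedSpace (UCover p q) := by
  have := contractibleSpace_regPt_empty (p := p) (q := q)
  refine Function.Surjective.pathConnectedSpace
    (f := fun c : RegPt (∅ : Set (UCover p q)) => umk p q c) ?_ ?_
  · intro P
    obtain ⟨c, rfl⟩ := umk_surjective P
    exact ⟨⟨c, fun h => h⟩, rfl⟩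
  · exact continuous_umk.comp continuous_subtype_val

include hp hpq in
theorem pathConnectedSpace_compl_link : PathConnectedSpace ↥(link p q)ᶜ := by
  have := pathConnectedSpace_regCover hp hpq
  exact (isQuotientCoveringMap_regProj hp hpq).surjective.pathConnectedSpace
    (isQuotientCoveringMap_regProj hp hpq).continuous

include hp hpq in
theorem pathConnectedSpace_doubleCover : PathConnectedSpace (DoubleCover p q) := by
  have := pathConnectedSpace_ucover (p := p) (q := q)
  exact (isQuotientMap_toDouble hp hpq).surjective.pathConnectedSpace
    (continuous_toDouble hp hpq)

/-- A functor which takes the meridional loops to involutions is trivial on the loops which lift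
to the universal covering. -/
theorem toFun_regProj_loop {Γ : Type*} [Group Γ] (T : PathHom ↥(link p q)ᶜ Γ)
    (hT : ∀ φ : TubularChart (link p q), T.toFun φ.loop * T.toFun φ.loop = 1)
    {P : RegCover hp hpq} (γ : Path P P) :
    T.toFun (γ.map (isQuotientCoveringMap_regProj hp hpq).continuous) = 1 := by
  have := pathConnectedSpace_regPt hp hpq
  exact toFun_eq_one_of_loop (T := T.comap (regProjMap hp hpq))
    (comap_regProj_eq hp hpq T hT) (isPushable_branchSet hp hpq) (a := P) γ

/-- The universal covering is simply connected, as seen by functors to groups. -/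
theorem toFun_ucover_loop {Γ : Type*} [Group Γ] (T : PathHom (UCover p q) Γ)
    {P : UCover p q} (γ : Path P P) : T.toFun γ = 1 := by
  have := contractibleSpace_regPt_empty (p := p) (q := q)
  let i : C(↥(∅ : Set (UCover p q))ᶜ, UCover p q) := ⟨Subtype.val, continuous_subtype_val⟩
  let γ' : Path (X := ↥(∅ : Set (UCover p q))ᶜ) ⟨P, fun h => h⟩ ⟨P, fun h => h⟩ :=
    ⟨⟨fun t => ⟨γ t, fun h => h⟩, by fun_prop⟩, by simp, by simp⟩
  have h := toFun_eq_one_of_loop (T := T.comap i) (fun γ γ' => PathHom.eq_of_simplyConnected _ γ γ')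
    isPushable_empty γ'
  rw [PathHom.comap_apply] at h
  rw [← h]
  exact T.congr fun t => rfl

end TwoBridge

/-! ### Lifting the punctured tubular charts -/

section Chart

open Topology
open scoped unitInterval

namespace TubularChart

variable {X : Type*} [TopologicalSpace X] {K : Set X} (φ : TubularChart K)

/-- A tubular chart without its axis, in logarithmic coordinates. -/
noncomputable def expMap : C(ℂ × ℝ, ↥Kᶜ) where
  toFun c := ⟨φ.toFun (Complex.exp c.1, c.2), fun h => Complex.exp_ne_zero _ ((φ.mem_iff _ _).1 h)⟩
  continuous_toFun := (φ.isOpenEmbedding.continuous.comp (by fun_prop)).subtype_mk _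

theorem expMap_coe (c : ℂ × ℝ) : (φ.expMap c : X) = φ.toFun (Complex.exp c.1, c.2) := rfl

/-- The inverse of a tubular chart, off the axis, in polar coordinates. -/
theorem exists_expMap_eq {x : ↥Kᶜ} (hx : (x : X) ∈ Set.range φ.toFun) :
    ∃ c, φ.expMap c = x := by
  obtain ⟨⟨z, s⟩, h⟩ := hx
  have hz : z ≠ 0 := fun h' => x.2 (by
    rw [← h]
    exact (φ.mem_iff z s).2 h')
  refine ⟨(Complex.log z, s), Subtype.ext ?_⟩
  rw [expMap_coe]
  simp only [Complex.exp_log hz]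
  exact h

/-- Paths in a tubular chart off the axis lift to logarithmic coordinates. -/
theorem exists_path_lift (γ : C(I, ↥Kᶜ)) (hγ : ∀ u, (γ u : X) ∈ Set.range φ.toFun) {c₀ : ℂ × ℝ}
    (h0 : φ.expMap c₀ = γ 0) : ∃ f : C(I, ℂ × ℝ), f 0 = c₀ ∧ ∀ u, φ.expMap (f u) = γ u := by
  let e := φ.isOpenEmbedding.isEmbedding.toHomeomorph
  let g : C(I, ℂ × ℝ) := ⟨fun u => e.symm ⟨γ u, hγ u⟩, by fun_prop⟩
  have hg : ∀ u, φ.toFun (g u) = γ u := fun u =>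
    congrArg Subtype.val (e.apply_symm_apply ⟨(γ u : X), hγ u⟩)
  have hz : ∀ u, (g u).1 ≠ 0 := fun u h => (γ u).2 (by
    have h1 : φ.toFun ((g u).1, (g u).2) ∈ K := (φ.mem_iff _ _).2 h
    rwa [Prod.mk.eta, hg u] at h1)
  have h0' : (Complex.exp c₀.1, c₀.2) = g 0 := φ.isOpenEmbedding.injective
    ((congrArg Subtype.val h0).trans (hg 0).symm)
  obtain ⟨w, hw, hw0⟩ := Complex.isCoveringMap_exp.exists_path_lifts
    (⟨fun u => ⟨(g u).1, hz u⟩, by fun_prop⟩ : C(I, {z : ℂ // z ≠ 0})) c₀.1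
    (Subtype.ext (congrArg Prod.fst h0').symm)
  refine ⟨⟨fun u => (w u, (g u).2), by fun_prop⟩, ?_, fun u => Subtype.ext ?_⟩
  · exact Prod.ext hw0 (congrArg Prod.snd h0').symm
  · rw [← hg u]
    have h : Complex.exp (w u) = (g u).1 := congrArg Subtype.val (congrFun hw u)
    exact congrArg φ.toFun (Prod.ext h rfl)

/-- The meridional loop in logarithmic coordinates. -/
theorem loop_eq_expMap {w : ℂ} (hw : φ.expMap (w, 0) = φ.base) (t : I) :
    φ.loop t = φ.expMap (w + 2 * Real.pi * Complex.I * (t : ℝ), 0) := by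
  have h1 : φ.toFun (Complex.exp w, 0) = φ.toFun (1, 0) := congrArg Subtype.val hw
  have h2 : Complex.exp w = 1 := congrArg Prod.fst (φ.isOpenEmbedding.injective h1)
  apply Subtype.ext
  rw [expMap_coe, Complex.exp_add, h2, one_mul]
  rfl

theorem expMap_zero : φ.expMap (0, 0) = φ.base := by
  apply Subtype.ext
  rw [expMap_coe]
  simp [base]

theorem expMap_add (w : ℂ) (s : ℝ) :
    φ.expMap (w + 2 * Real.pi * Complex.I, s) = φ.expMap (w, s) := by
  apply Subtype.ext
  rw [expMap_coe, expMap_coe, Complex.exp_add, Complex.exp_two_pi_mul_I, mul_one]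

end TubularChart

end Chart

namespace TwoBridge

open Topology
open scoped unitInterval

variable {p q : ℤ} (hp : 0 < p) (hpq : IsCoprime p q)

/-- A lift of a punctured tubular chart to the regular covering, in logarithmic coordinates, with
the deck transformation `g` which describes the monodromy around the axis. -/
structure ChartLift (φ : TubularChart (link p q)) where
  toMap : C(ℂ × ℝ, RegCover hp hpq)
  g : DihedralGroup p.natAbs
  regProj_eq : ∀ c, regProj hp hpq (toMap c) = φ.expMap c
  apply_add : ∀ w s, toMap (w + 2 * Real.pi * Complex.I, s) = g • toMap (w, s)

/-- Two lifts of a map which agree at a point are equal. -/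
theorem regProj_lift_unique {A : Type*} [TopologicalSpace A] [PreconnectedSpace A]
    {f g : A → RegCover hp hpq} (hf : Continuous f) (hg : Continuous g)
    (h : ∀ a, regProj hp hpq (f a) = regProj hp hpq (g a)) (a : A) (ha : f a = g a) : f = g :=
  (isQuotientCoveringMap_regProj hp hpq).isCoveringMap.eq_of_comp_eq hf hg (funext h) a ha

theorem exists_chartLift (φ : TubularChart (link p q)) {e : RegCover hp hpq} {c₀ : ℂ × ℝ}
    (h : regProj hp hpq e = φ.expMap c₀) : ∃ Ψ : ChartLift hp hpq φ, Ψ.toMap c₀ = e := by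
  have cov := isQuotientCoveringMap_regProj hp hpq
  obtain ⟨F, ⟨h0, hF⟩, -⟩ := cov.isCoveringMap.existsUnique_continuousMap_lifts φ.expMap c₀ e h
  have hF' : ∀ c, regProj hp hpq (F c) = φ.expMap c := fun c => congrFun hF c
  obtain ⟨g, hg⟩ : F (0 + 2 * Real.pi * Complex.I, 0) ∈
      MulAction.orbit (DihedralGroup p.natAbs) (F (0, 0)) := by
    rw [← cov.apply_eq_iff_mem_orbit, hF', hF', φ.expMap_add]
  have hu : (fun c : ℂ × ℝ => F (c.1 + 2 * Real.pi * Complex.I, c.2)) = fun c => g • F c := by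
    refine regProj_lift_unique hp hpq (by fun_prop) (F.continuous.const_smul g) (fun c => ?_)
      (0, 0) hg.symm
    rw [cov.map_smul, hF', hF', φ.expMap_add]
  exact ⟨⟨F, g, hF', fun w s => congrFun hu (w, s)⟩, h0⟩

variable {hp hpq}

namespace ChartLift

variable {φ : TubularChart (link p q)} (Ψ : ChartLift hp hpq φ)

/-- Another lift of the same chart. -/
noncomputable def smul (k : DihedralGroup p.natAbs) : ChartLift hp hpq φ where
  toMap := ⟨fun c => k • Ψ.toMap c, Ψ.toMap.continuous.const_smul k⟩
  g := k * Ψ.g * k⁻¹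
  regProj_eq c := by
    rw [ContinuousMap.coe_mk, (isQuotientCoveringMap_regProj hp hpq).map_smul, Ψ.regProj_eq]
  apply_add w s := by
    simp only [ContinuousMap.coe_mk, Ψ.apply_add, smul_smul, inv_mul_cancel_right]

/-- Without monodromy, the lift only depends on the exponential of the coordinate. -/
theorem eq_of_exp_eq (hg : Ψ.g = 1) {w w' : ℂ} (h : Complex.exp w = Complex.exp w') (s : ℝ) :
    Ψ.toMap (w, s) = Ψ.toMap (w', s) := by
  have hper : Function.Periodic (fun w => Ψ.toMap (w, s)) (2 * Real.pi * Complex.I) := fun w => by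
    change Ψ.toMap _ = Ψ.toMap _
    rw [Ψ.apply_add, hg, one_smul]
  obtain ⟨n, rfl⟩ := Complex.exp_eq_exp_iff_exists_int.1 h
  exact hper.int_mul n w'

end ChartLift

theorem isOpenMap_toSphere : IsOpenMap (toSphere hp hpq) := by
  intro U hU
  rw [← (isQuotientMap_toSphere hp hpq).isOpen_preimage]
  have h : toSphere hp hpq ⁻¹' (toSphere hp hpq '' U) =
      ⋃ g : DihedralGroup p.natAbs, (fun P => g • P) ⁻¹' U := by
    ext P
    simp only [Set.mem_preimage, Set.mem_image, Set.mem_iUnion]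
    constructor
    · rintro ⟨Q, hQ, h⟩
      obtain ⟨g, rfl⟩ := (toSphere_eq_iff hp hpq).1 h.symm
      exact ⟨g, hQ⟩
    · rintro ⟨g, hg⟩
      exact ⟨_, hg, toSphere_smul hp hpq g P⟩
  rw [h]
  exact isOpen_iUnion fun g => hU.preimage (continuous_const_smul g)

/-- The monodromy around the axis of a chart fixes each point over the axis which is approached by
the lift of the chart. -/
theorem exists_isOpen_smul_eq (φ : TubularChart (link p q)) {Q : UCover p q} {s₀ : ℝ}
    (hQ : toSphere hp hpq Q = φ.toFun (0, s₀)) : ∃ B : Set (UCover p q), IsOpen B ∧ Q ∈ B ∧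
      ∀ (Ψ : ChartLift hp hpq φ) (w : ℂ) (s : ℝ), (Ψ.toMap (w, s) : UCover p q) ∈ B →
        Ψ.g • Q = Q := by
  have := neZero_natAbs hp
  have := t2Space_ucover (q := q) hp
  obtain ⟨U, hU, hQU, hg⟩ := exists_isOpen_smul_eq_of_nonempty (G := DihedralGroup p.natAbs) Q
  have hO : φ.toFun ⁻¹' (toSphere hp hpq '' U) ∈ 𝓝 ((0 : ℂ), s₀) :=
    ((isOpenMap_toSphere U hU).preimage φ.isOpenEmbedding.continuous).mem_nhds ⟨Q, hQU, hQ⟩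
  rw [nhds_prod_eq, Filter.mem_prod_iff] at hO
  obtain ⟨V, hV, W, hW, hVW⟩ := hO
  obtain ⟨ε, hε, hεV⟩ := Metric.mem_nhds_iff.1 hV
  have hB : IsOpen (φ.toFun '' (Metric.ball 0 ε ×ˢ interior W)) :=
    φ.isOpenEmbedding.isOpenMap _ (Metric.isOpen_ball.prod isOpen_interior)
  refine ⟨U ∩ toSphere hp hpq ⁻¹' (φ.toFun '' (Metric.ball 0 ε ×ˢ interior W)),
    hU.inter (hB.preimage (continuous_toSphere hp hpq)), ⟨hQU, _,
      ⟨Metric.mem_ball_self hε, mem_interior_iff_mem_nhds.2 hW⟩, hQ.symm⟩, ?_⟩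
  rintro Ψ w s ⟨hwU, ⟨z, s'⟩, ⟨hz, hs'⟩, hzs⟩
  have hlift : ∀ w' : ℂ, toSphere hp hpq (Ψ.toMap (w', s)) = φ.toFun (Complex.exp w', s) :=
    fun w' => congrArg Subtype.val (Ψ.regProj_eq (w', s))
  rw [hlift w] at hzs
  obtain ⟨rfl, rfl⟩ := Prod.mk.inj (φ.isOpenEmbedding.injective hzs)
  -- the circle through the given point stays near the orbit of `Q`
  let C : Set (UCover p q) :=
    (fun θ : ℝ => (Ψ.toMap (w + θ * Complex.I, s') : UCover p q)) '' Set.univ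
  have hC : IsPreconnected C := isPreconnected_univ.image _ (by fun_prop)
  let A : Set (DihedralGroup p.natAbs) → Set (UCover p q) := fun S =>
    ⋃ k ∈ S, (fun P => k⁻¹ • P) ⁻¹' U
  have hA : ∀ S, IsOpen (A S) := fun S =>
    isOpen_biUnion fun k _ => hU.preimage (continuous_const_smul k⁻¹)
  let S : Set (DihedralGroup p.natAbs) := {k | k • Q = Q}
  have same : ∀ (k l : DihedralGroup p.natAbs) (P : UCover p q), k⁻¹ • P ∈ U → l⁻¹ • P ∈ U →
      l ∈ S → k ∈ S := by
    intro k l P hk hl hlS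
    have h := hg (k⁻¹ * l) ⟨k⁻¹ • P, ⟨l⁻¹ • P, hl, by simp [mul_smul]⟩, hk⟩
    rw [mul_smul, (hlS : l • Q = Q), inv_smul_eq_iff] at h
    exact h.symm
  have hdisj : Disjoint (A S) (A Sᶜ) := by
    rw [Set.disjoint_left]
    intro P h1 h2
    simp only [A, Set.mem_iUnion, Set.mem_preimage, exists_prop] at h1 h2
    obtain ⟨l, hl, hlP⟩ := h1
    obtain ⟨k, hk, hkP⟩ := h2
    exact hk (same k l P hkP hlP hl)
  have hcover : C ⊆ A S ∪ A Sᶜ := by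
    rintro _ ⟨θ, -, rfl⟩
    have h1 : φ.toFun (Complex.exp (w + θ * Complex.I), s') ∈ toSphere hp hpq '' U := by
      refine hVW ⟨hεV ?_, interior_subset hs'⟩
      rw [mem_ball_zero_iff] at hz ⊢
      rwa [Complex.exp_add, norm_mul, Complex.norm_exp_ofReal_mul_I, mul_one]
    obtain ⟨P, hP, h1⟩ := h1
    rw [← hlift] at h1
    obtain ⟨k, hk⟩ := (toSphere_eq_iff hp hpq).1 h1
    simp only [A, Set.mem_union, Set.mem_iUnion, Set.mem_preimage, exists_prop]
    have : k⁻¹ • (Ψ.toMap (w + θ * Complex.I, s') : UCover p q) ∈ U := by rwa [← hk, inv_smul_smul]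
    by_cases hkS : k ∈ S
    · exact Or.inl ⟨k, hkS, this⟩
    · exact Or.inr ⟨k, hkS, this⟩
  have hsub := hC.subset_left_of_subset_union (hA S) (hA Sᶜ) hdisj hcover
    ⟨_, ⟨0, trivial, rfl⟩, by
      simp only [A, Set.mem_iUnion, Set.mem_preimage, exists_prop]
      exact ⟨1, one_smul _ Q, by simpa using hwU⟩⟩
  have hend := hsub ⟨2 * Real.pi, trivial, rfl⟩
  simp only [A, Set.mem_iUnion, Set.mem_preimage, exists_prop] at hend
  obtain ⟨l, hl, hlP⟩ := hend
  refine same Ψ.g l _ ?_ hlP hl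
  have h := Ψ.apply_add w s'
  push_cast
  rw [h, coe_smul, inv_smul_smul]
  exact hwU

end TwoBridge

/-! ### The monodromy around the link -/

namespace TwoBridge

open Topology
open scoped unitInterval

variable {p q : ℤ} {hp : 0 < p} {hpq : IsCoprime p q}

/-- The link has only finitely many points at the levels `± 1`. -/
theorem finite_link_end_levels (hp : 0 < p) (hpq : IsCoprime p q) :
    {P ∈ link p q | ∃ (x : ℝ × ℝ) (t : Set.Icc (-1 : ℝ) 1), P = mk p q (x, t) ∧
      ((t : ℝ) = 1 ∨ (t : ℝ) = -1)}.Finite := by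
  have hp' : (p : ℝ) ≠ 0 := by exact_mod_cast hp.ne'
  let f : Bool × Bool → Sphere p q := fun b => cond b.1
    (mk p q ((cond b.2 1 0, 0), ⟨1, by norm_num⟩))
    (mk p q ((0, cond b.2 (-1 / p) 0), ⟨-1, by norm_num⟩))
  refine (Set.finite_range f).subset ?_
  rintro _ ⟨hP, ⟨x, y⟩, t, rfl, ht | ht⟩
  · obtain rfl : t = ⟨1, by norm_num⟩ := Subtype.ext ht
    obtain ⟨a, ha⟩ := (mem_link_one rfl).1 hP
    simp only at ha
    rcases Int.even_or_odd a with ⟨b, rfl⟩ | ⟨b, rfl⟩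
    · refine ⟨(true, false), mk_eq_mk.2 ⟨rfl, Or.inl (isPeriod_one.2 ⟨b, ?_⟩)⟩⟩
      simp [ha]
      ring
    · refine ⟨(true, true), mk_eq_mk.2 ⟨rfl, Or.inl (isPeriod_one.2 ⟨b, ?_⟩)⟩⟩
      simp [ha]
  · obtain rfl : t = ⟨-1, by norm_num⟩ := Subtype.ext ht
    obtain ⟨a, ha⟩ := (mem_link_neg_one hpq rfl).1 hP
    simp only at ha
    rcases Int.even_or_odd a with ⟨b, rfl⟩ | ⟨b, rfl⟩
    · refine ⟨(false, false), mk_eq_mk.2 ⟨rfl, Or.inl ((isPeriod_neg_one hpq).2 ⟨b, ?_⟩)⟩⟩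
      simp [ha]
      ring
    · refine ⟨(false, true), mk_eq_mk.2 ⟨rfl, Or.inl ((isPeriod_neg_one hpq).2 ⟨b, ?_⟩)⟩⟩
      have e : (p : ℝ) * (y - -1 / p) = p * y + 1 := by field_simp; ring
      simp only [cond_true, Prod.fst_sub, Prod.snd_sub, sub_zero, e]
      push_cast at ha
      linarith

/-- Every tubular chart contains a point of a string off the levels `± 1`. -/
theorem exists_mid_level (hp : 0 < p) (hpq : IsCoprime p q) (φ : TubularChart (link p q)) :
    ∃ (s : ℝ) (k j : ℤ) (t : Set.Icc (-1 : ℝ) 1), (t : ℝ) ≠ 1 ∧ (t : ℝ) ≠ -1 ∧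
      φ.toFun (0, s) = mk p q (((k : ℝ), (j : ℝ)), t) := by
  by_contra! h
  have hinj : Function.Injective fun s : ℝ => φ.toFun (0, s) := fun s s' e =>
    congrArg Prod.snd (φ.isOpenEmbedding.injective e)
  refine Set.infinite_univ (α := ℝ) (Set.Finite.of_injOn (f := fun s => φ.toFun (0, s))
    (fun s _ => ?_) hinj.injOn (finite_link_end_levels hp hpq))
  have hs : φ.toFun (0, s) ∈ link p q := (φ.mem_iff 0 s).2 rfl
  refine ⟨hs, ?_⟩
  obtain ⟨a, b, t, e⟩ := hs
  refine ⟨_, t, e, ?_⟩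
  by_contra! h'
  exact h s a b t h'.1 h'.2 e

/-- The monodromy around the axis of a chart is not trivial: a small half circle around a string is
closed in the sphere, but not in the universal covering. -/
theorem chartLift_g_ne_one {φ : TubularChart (link p q)} (Ψ : ChartLift hp hpq φ) : Ψ.g ≠ 1 := by
  intro hg
  obtain ⟨s₁, k, j, t, h1, h2, hφ⟩ := exists_mid_level hp hpq φ
  let x : ℝ → ℝ → Pt := fun ρ θ => (((k : ℝ) + ρ * Real.cos θ, (j : ℝ) + ρ * Real.sin θ), t)
  have hx : Continuous fun c : ℝ × ℝ => x c.1 c.2 := by fun_prop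
  -- small half circles lie in the chart
  obtain ⟨ρ, hρ0, hρ1, hρ⟩ : ∃ ρ : ℝ, 0 < ρ ∧ ρ < 1 ∧
      ∀ θ : I, mk p q (x ρ (Real.pi * θ)) ∈ Set.range φ.toFun := by
    have hopen : IsOpen {c : ℝ × I | mk p q (x c.1 (Real.pi * c.2)) ∈ Set.range φ.toFun} :=
      φ.isOpenEmbedding.isOpen_range.preimage (continuous_mk.comp
        (hx.comp (f := fun c : ℝ × I => (c.1, Real.pi * c.2)) (by fun_prop)))
    have hzero : ∀ θ : I, ((0 : ℝ), θ) ∈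
        {c : ℝ × I | mk p q (x c.1 (Real.pi * c.2)) ∈ Set.range φ.toFun} := fun θ =>
      ⟨(0, s₁), by rw [hφ]; simp [x]⟩
    obtain ⟨u, v, hu, -, h0u, hv, huv⟩ := generalized_tube_lemma
      (isCompact_singleton (x := (0 : ℝ))) (isCompact_univ (X := I)) hopen (by
        rintro ⟨r, θ⟩ ⟨rfl, -⟩
        exact hzero θ)
    obtain ⟨ε, hε, hεu⟩ := Metric.isOpen_iff.1 hu 0 (h0u rfl)
    refine ⟨min (ε / 2) (1 / 2), by positivity, by
      have := min_le_right (ε / 2) (1 / 2); linarith, fun θ => ?_⟩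
    refine huv (a := (_, θ)) ⟨hεu ?_, hv trivial⟩
    rw [mem_ball_zero_iff, Real.norm_of_nonneg (by positivity)]
    have := min_le_left (ε / 2) (1 / 2)
    linarith
  have hreg : ∀ θ : ℝ, mk p q (x ρ θ) ∉ link p q := by
    intro θ h
    obtain ⟨a, b, hab⟩ := (mem_link_of_ne h1 h2).1 h
    have ha : ρ * Real.cos θ = (a - k : ℤ) := by
      have := congrArg Prod.fst hab
      simp only at this
      push_cast
      linarith
    have hb : ρ * Real.sin θ = (b - j : ℤ) := by
      have := congrArg Prod.snd hab
      simp only at this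
      push_cast
      linarith
    have hsum : ((a - k : ℤ) : ℝ) ^ 2 + ((b - j : ℤ) : ℝ) ^ 2 = ρ ^ 2 := by
      rw [← ha, ← hb, mul_pow, mul_pow, ← mul_add, Real.cos_sq_add_sin_sq, mul_one]
    have hlt : (a - k) ^ 2 + (b - j) ^ 2 < 1 := by
      have : ρ ^ 2 < 1 := by nlinarith
      exact_mod_cast hsum ▸ this
    have hgt : 0 < (a - k) ^ 2 + (b - j) ^ 2 := by
      have : 0 < ρ ^ 2 := by positivity
      exact_mod_cast hsum ▸ this
    lia
  have hP : ∀ θ : ℝ, umk p q (coord p q (x ρ θ)) ∈ toSphere hp hpq ⁻¹' (link p q)ᶜ := fun θ => by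
    rw [Set.mem_preimage, toSphere_umk_coord]
    exact hreg θ
  let P : C(I, RegCover hp hpq) := ⟨fun θ => ⟨_, hP (Real.pi * θ)⟩,
    (continuous_umk.comp ((continuous_coord p q).comp
      (hx.comp (f := fun θ : I => (ρ, Real.pi * θ)) (by fun_prop)))).subtype_mk _⟩
  have hPx : ∀ θ : I, (regProj hp hpq (P θ) : Sphere p q) = mk p q (x ρ (Real.pi * θ)) :=
    fun θ => toSphere_umk_coord hp hpq _
  have hclosed : regProj hp hpq (P 0) = regProj hp hpq (P 1) := by
    refine Subtype.ext ?_
    rw [hPx, hPx, mk_eq_mk]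
    refine ⟨rfl, Or.inr (isPeriod_even _ _ _ k j ?_ ?_)⟩ <;> simp [x] <;> ring
  have hne : P 0 ≠ P 1 := by
    intro h
    obtain ⟨-, h, -⟩ := umk_eq_umk.1 (congrArg Subtype.val h)
    obtain ⟨m, hm⟩ := h h2
    simp only [x, coord, Set.Icc.coe_zero, Set.Icc.coe_one, mul_zero, mul_one, Real.cos_zero,
      Real.cos_pi] at hm
    have hm' : ρ = ((-p * m : ℤ) : ℝ) := by
      push_cast
      linarith
    have h3 : (0 : ℤ) < -p * m := by exact_mod_cast hm' ▸ hρ0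
    have h4 : -p * m < 1 := by exact_mod_cast hm' ▸ hρ1
    lia
  obtain ⟨c₀, hc₀⟩ := φ.exists_expMap_eq (x := regProj hp hpq (P 0)) (by rw [hPx]; exact hρ 0)
  obtain ⟨l, hl⟩ : P 0 ∈ MulAction.orbit (DihedralGroup p.natAbs) (Ψ.toMap c₀) := by
    rw [← (isQuotientCoveringMap_regProj hp hpq).apply_eq_iff_mem_orbit, Ψ.regProj_eq, hc₀]
  obtain ⟨f, hf0, hf⟩ := φ.exists_path_lift
    (⟨fun θ => regProj hp hpq (P θ), (isQuotientCoveringMap_regProj hp hpq).continuous.comp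
      P.continuous⟩ : C(I, ↥(link p q)ᶜ)) (fun θ => by
        rw [ContinuousMap.coe_mk, hPx]; exact hρ θ) hc₀
  have hlift : (fun θ => (Ψ.smul l).toMap (f θ)) = P := by
    refine regProj_lift_unique hp hpq (by fun_prop) P.continuous (fun θ => ?_) 0 ?_
    · rw [(Ψ.smul l).regProj_eq, hf]
      rfl
    · rw [hf0]
      exact hl
  refine hne ?_
  rw [← hlift]
  have hend : φ.expMap (f 0) = φ.expMap (f 1) := (hf 0).trans (hclosed.trans (hf 1).symm)
  obtain ⟨he, hs⟩ := Prod.mk.inj (φ.isOpenEmbedding.injective (congrArg Subtype.val hend))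
  have h := (Ψ.smul l).eq_of_exp_eq (by simp [ChartLift.smul, hg]) he (f 0).2
  change (Ψ.smul l).toMap (f 0) = (Ψ.smul l).toMap (f 1)
  rw [← Prod.mk.eta (p := f 0), h, hs]

/-- The monodromy around the link is by reflections. -/
theorem chartLift_exists_g_eq_sr {φ : TubularChart (link p q)} (Ψ : ChartLift hp hpq φ) :
    ∃ i, Ψ.g = DihedralGroup.sr i := by
  obtain ⟨Q, hQ⟩ := (isQuotientMap_toSphere hp hpq).surjective (φ.toFun (0, 0))
  obtain ⟨B, hB, hQB, h⟩ := exists_isOpen_smul_eq (hp := hp) (hpq := hpq) φ hQ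
  -- a point of the chart near the axis
  obtain ⟨w, hw⟩ : ∃ w : ℂ, φ.toFun (Complex.exp w, 0) ∈ toSphere hp hpq '' B := by
    have hO : φ.toFun ⁻¹' (toSphere hp hpq '' B) ∈ 𝓝 ((0 : ℂ), (0 : ℝ)) :=
      ((isOpenMap_toSphere B hB).preimage φ.isOpenEmbedding.continuous).mem_nhds ⟨Q, hQB, hQ⟩
    have hc : Filter.Tendsto (fun r : ℝ => ((Complex.exp r : ℂ), (0 : ℝ))) Filter.atBot
        (𝓝 ((0 : ℂ), (0 : ℝ))) := by
      refine Filter.Tendsto.prodMk_nhds ?_ tendsto_const_nhds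
      have := (Complex.continuous_ofReal.tendsto 0).comp Real.tendsto_exp_atBot
      simpa [Function.comp_def] using this
    obtain ⟨r, hr⟩ := (hc.eventually hO).exists
    exact ⟨r, hr⟩
  obtain ⟨P, hP, hPw⟩ := hw
  have hΨ : toSphere hp hpq (Ψ.toMap (w, 0)) = φ.toFun (Complex.exp w, 0) :=
    congrArg Subtype.val (Ψ.regProj_eq (w, 0))
  obtain ⟨k, hk⟩ := (toSphere_eq_iff hp hpq).1 (hΨ.trans hPw.symm)
  have hfix : (Ψ.smul k).g • Q = Q := h (Ψ.smul k) w 0 (by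
    change k • (Ψ.toMap (w, 0) : UCover p q) ∈ B
    rwa [hk])
  have hfix' : Ψ.g • k⁻¹ • Q = k⁻¹ • Q := by
    rw [ChartLift.smul, mul_smul, mul_smul] at hfix
    exact eq_inv_smul_iff.2 hfix
  have hne := chartLift_g_ne_one Ψ
  rcases hg : Ψ.g with i | i
  · rw [hg] at hfix' hne
    rw [eq_zero_of_r_smul_eq hpq hfix', DihedralGroup.r_zero] at hne
    exact absurd rfl hne
  · exact ⟨i, rfl⟩

end TwoBridge

/-! ### The monodromy of meridians and of meridian pairs -/

section Conjugation

open Topology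

variable {G E X : Type*} [Group G] [MulAction G E] [TopologicalSpace E] [TopologicalSpace X]
  {f : E → X}

theorem Path.lift_trans {a b c : E} {x y z : X} {Γ : Path a b} {Γ' : Path b c} {γ : Path x y}
    {γ' : Path y z} (h : ∀ t, f (Γ t) = γ t) (h' : ∀ t, f (Γ' t) = γ' t) (t : unitInterval) :
    f (Γ.trans Γ' t) = γ.trans γ' t := by
  rw [Path.trans_apply, Path.trans_apply]
  split_ifs
  exacts [h _, h' _]

namespace IsQuotientCoveringMap

/-- A lift of a loop `l` at the end of a path `α` yields a lift of the loop `α * l * α⁻¹`. -/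
theorem exists_lift_conj (hf : IsQuotientCoveringMap f G) {x y : X} {α : Path x y} {l : Path y y}
    {a b : E} {g : G} (A : Path a b) (L : Path b (g • b)) (hA : ∀ t, f (A t) = α t)
    (hL : ∀ t, f (L t) = l t) :
    ∃ Γ : Path a (g • a), ∀ t, f (Γ t) = ((α.trans l).trans α.symm) t := by
  have := hf.toContinuousConstSMul
  refine ⟨(A.trans L).trans (A.symm.map (continuous_const_smul g)),
    Path.lift_trans (Path.lift_trans hA hL) fun t => ?_⟩
  change f (g • A.symm t) = _
  rw [hf.map_smul]
  exact hA _

end IsQuotientCoveringMap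

theorem fundamentalGroupMulEquivOfPath_eq_loopClass {x y : X} (β : Path x y)
    {m : FundamentalGroup X x} {l : Path y y}
    (h : FundamentalGroup.fundamentalGroupMulEquivOfPath β m = loopClass l) :
    m = loopClass ((β.trans l).trans β.symm) := by
  rw [← MulEquiv.eq_symm_apply] at h
  refine h.trans (Eq.trans (b := loopClass (β.trans (l.trans β.symm))) rfl ?_)
  exact congrArg FundamentalGroup.fromPath
    (Quotient.sound ⟨(Path.Homotopy.transAssoc β l β.symm).symm⟩)

end Conjugation

namespace TwoBridge

open Topology
open scoped unitInterval

variable {p q : ℤ} {hp : 0 < p} {hpq : IsCoprime p q}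

/-- The lift of the meridional loop of a chart. -/
theorem ChartLift.exists_lift_loop {φ : TubularChart (link p q)} (Ψ : ChartLift hp hpq φ) {w : ℂ}
    (hw : φ.expMap (w, 0) = φ.base) :
    ∃ L : Path (Ψ.toMap (w, 0)) (Ψ.g • Ψ.toMap (w, 0)), ∀ t, regProj hp hpq (L t) = φ.loop t := by
  refine ⟨⟨⟨fun t => Ψ.toMap (w + 2 * Real.pi * Complex.I * (t : ℝ), 0), by fun_prop⟩,
    by simp, ?_⟩, fun t => ?_⟩
  · rw [← Ψ.apply_add]
    simp
  · rw [φ.loop_eq_expMap hw]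
    exact Ψ.regProj_eq _

variable (hp hpq) in
/-- The monodromy homomorphism of the regular covering, based at the point `e`. Composition in
`FundamentalGroup` is written from right to left, whence the opposite group. -/
noncomputable def monodromy (e : RegCover hp hpq) {x : ↥(link p q)ᶜ}
    (he : regProj hp hpq e = x) : FundamentalGroup ↥(link p q)ᶜ x →* (DihedralGroup p.natAbs)ᵐᵒᵖ :=
  (isQuotientCoveringMap_regProj hp hpq).fundamentalGroupToMulOpposite ⟨e, he⟩

theorem monodromy_loopClass {e : RegCover hp hpq} {x : ↥(link p q)ᶜ}
    (he : regProj hp hpq e = x) (l : Path x x) {g : DihedralGroup p.natAbs} (L : Path e (g • e))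
    (hL : ∀ t, regProj hp hpq (L t) = l t) :
    monodromy hp hpq e he (loopClass l) = MulOpposite.op g :=
  (isQuotientCoveringMap_regProj hp hpq).fundamentalGroupToMulOpposite_loopClass he l g L hL

/-- Meridians act on the covering as reflections. -/
theorem monodromy_of_isMeridian {e : RegCover hp hpq} {x : ↥(link p q)ᶜ}
    (he : regProj hp hpq e = x) {m : FundamentalGroup ↥(link p q)ᶜ x}
    (hm : IsMeridian (link p q) x m) :
    ∃ i, monodromy hp hpq e he m = MulOpposite.op (DihedralGroup.sr i) := by
  have cov := isQuotientCoveringMap_regProj hp hpq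
  obtain ⟨φ, α, rfl⟩ := hm
  obtain ⟨e', A, he', hA⟩ := cov.isCoveringMap.exists_path_lift α he
  obtain ⟨Ψ, rfl⟩ := exists_chartLift hp hpq φ (e := e') (c₀ := (0, 0))
    (he'.trans φ.expMap_zero.symm)
  obtain ⟨L, hL⟩ := Ψ.exists_lift_loop φ.expMap_zero
  obtain ⟨Γ, hΓ⟩ := cov.exists_lift_conj A L hA hL
  obtain ⟨i, hi⟩ := chartLift_exists_g_eq_sr Ψ
  exact ⟨i, by rw [← hi]; exact monodromy_loopClass he _ Γ hΓ⟩

/-- A meridian along an arc acts on the covering as a reflection which fixes the starting point of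
the lift of the arc. -/
theorem exists_lift_of_isMeridianAlong {c : ℝ → Sphere p q} (C : C(I, UCover p q))
    (hC : ∀ u : I, toSphere hp hpq (C u) = c u) (h0 : c 0 ∈ link p q)
    (hreg : ∀ u : I, 0 < (u : ℝ) → C u ∈ toSphere hp hpq ⁻¹' (link p q)ᶜ) {b : ↥(link p q)ᶜ}
    {m : FundamentalGroup ↥(link p q)ᶜ b} (hm : IsMeridianAlong (link p q) c b m)
    {e : RegCover hp hpq} (he : (e : UCover p q) = C 1) :
    ∃ (g : DihedralGroup p.natAbs) (l : Path b b) (L : Path e (g • e)), (∃ i, g = .sr i) ∧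
      g • C 0 = C 0 ∧ m = loopClass l ∧ ∀ t, regProj hp hpq (L t) = l t := by
  have cov := isQuotientCoveringMap_regProj hp hpq
  obtain ⟨hb, φ, s, hs0, hs1, hφ, z, α, δ, hα, hδ, rfl⟩ := hm
  -- the lift of the arc from `1` to `s`
  have hsI : ∀ u : I, s ≤ 1 - (u : ℝ) * (1 - s) ∧ 1 - (u : ℝ) * (1 - s) ≤ 1 := fun u =>
    ⟨by nlinarith [u.2.2], by nlinarith [u.2.1]⟩
  let back : C(I, I) := ⟨fun u => ⟨1 - (u : ℝ) * (1 - s), by linarith [(hsI u).1], (hsI u).2⟩,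
    by fun_prop⟩
  let e' : RegCover hp hpq := ⟨C ⟨s, hs0.le, hs1⟩, hreg _ hs0⟩
  let A : Path e e' := ⟨⟨fun u => ⟨C (back u), hreg _ (hs0.trans_le (hsI u).1)⟩, by fun_prop⟩,
    Subtype.ext (by
      change C (back 0) = e
      rw [he]
      congr 1
      exact Subtype.ext (by simp [back])),
    Subtype.ext (congrArg C (Subtype.ext (by simp [back])))⟩
  have hA : ∀ u, regProj hp hpq (A u) = α u := fun u =>
    Subtype.ext ((hC (back u)).trans (hα u).symm)
  have hz : (z : Sphere p q) = c s := by simpa using hα 1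
  have hz' : regProj hp hpq e' = z := Subtype.ext ((hC _).trans hz.symm)
  obtain ⟨c₀, hc₀⟩ := φ.exists_expMap_eq (x := z) (by rw [hz]; exact hφ s hs0.le le_rfl)
  obtain ⟨Ψ, hΨ⟩ := exists_chartLift hp hpq φ (hz'.trans hc₀.symm)
  -- the lift of the path inside the chart
  obtain ⟨f, hf0, hf⟩ := φ.exists_path_lift (δ : C(I, ↥(link p q)ᶜ)) hδ (c₀ := c₀) (by simp [hc₀])
  have hf1 : φ.expMap (f 1) = φ.base := by simpa using hf 1
  have hf2 : f 1 = ((f 1).1, 0) :=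
    Prod.ext rfl (Prod.mk.inj (φ.isOpenEmbedding.injective (congrArg Subtype.val hf1))).2
  rw [hf2] at hf1
  let Δ : Path e' (Ψ.toMap ((f 1).1, 0)) := ⟨⟨fun u => Ψ.toMap (f u), by fun_prop⟩,
    by simp only [hf0, hΨ], by simp only [← hf2]⟩
  have hΔ : ∀ u, regProj hp hpq (Δ u) = δ u := fun u => (Ψ.regProj_eq (f u)).trans (hf u)
  obtain ⟨L, hL⟩ := Ψ.exists_lift_loop hf1
  obtain ⟨Γ, hΓ⟩ := cov.exists_lift_conj (A.trans Δ) L (Path.lift_trans hA hΔ) hL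
  refine ⟨Ψ.g, _, Γ, chartLift_exists_g_eq_sr Ψ, ?_, rfl, hΓ⟩
  -- following the arc further, one comes close to its starting point inside the chart
  obtain ⟨⟨z₀, s₀⟩, h₀⟩ := hφ 0 le_rfl hs0.le
  obtain rfl : z₀ = 0 := (φ.mem_iff z₀ s₀).1 (h₀ ▸ h0)
  obtain ⟨B, hB, hCB, hfix⟩ := exists_isOpen_smul_eq (hp := hp) (hpq := hpq) φ (Q := C 0) (s₀ := s₀)
    ((hC 0).trans (by rw [h₀]; simp))
  obtain ⟨r, hr0, hrs, hr⟩ : ∃ r : I, 0 < (r : ℝ) ∧ (r : ℝ) ≤ s ∧ C r ∈ B := by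
    obtain ⟨ε, hε, hεB⟩ := Metric.isOpen_iff.1 (hB.preimage C.continuous) 0 hCB
    have h1 := min_le_left (ε / 2) s
    have h2 := min_le_right (ε / 2) s
    have h3 : 0 < min (ε / 2) s := lt_min (by linarith) hs0
    refine ⟨⟨min (ε / 2) s, h3.le, h2.trans hs1⟩, h3, h2, hεB ?_⟩
    rw [Metric.mem_ball, Subtype.dist_eq, Real.dist_eq]
    simp only [Set.Icc.coe_zero, sub_zero]
    rw [abs_of_pos h3]
    linarith
  have hrI : ∀ u : I, (r : ℝ) ≤ s + u * (r - s) ∧ s + u * (r - s) ≤ s := fun u =>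
    ⟨by nlinarith [u.2.2], by nlinarith [u.2.1]⟩
  let fwd : C(I, I) := ⟨fun u => ⟨s + u * (r - s),
      by linarith [(hrI u).1], by linarith [(hrI u).2]⟩,
    by fun_prop⟩
  let N : C(I, RegCover hp hpq) :=
    ⟨fun u => ⟨C (fwd u), hreg _ (hr0.trans_le (hrI u).1)⟩, by fun_prop⟩
  have hN0 : N 0 = e' := Subtype.ext (congrArg C (Subtype.ext (by simp [fwd])))
  obtain ⟨f', hf'0, hf'⟩ := φ.exists_path_lift
    (⟨fun u => regProj hp hpq (N u), cov.continuous.comp N.continuous⟩ : C(I, ↥(link p q)ᶜ))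
    (fun u => by
      change toSphere hp hpq (C (fwd u)) ∈ _
      rw [hC]
      exact hφ _ (hr0.le.trans (hrI u).1) (hrI u).2) (c₀ := c₀) (by
        change φ.expMap c₀ = regProj hp hpq (N 0)
        rw [hN0, hz', hc₀])
  have hlift : (fun u => Ψ.toMap (f' u)) = N := by
    refine regProj_lift_unique hp hpq (by fun_prop) N.continuous (fun u => ?_) 0 ?_
    · rw [Ψ.regProj_eq, hf']
      rfl
    · rw [hf'0, hΨ, hN0]
  refine hfix Ψ (f' 1).1 (f' 1).2 ?_
  rw [Prod.mk.eta, show Ψ.toMap (f' 1) = N 1 from congrFun hlift 1]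
  have h1 : fwd 1 = r := Subtype.ext (by simp [fwd])
  change C (fwd 1) ∈ B
  rwa [h1]

/-- The members of a meridian pair act on the covering as conjugates of reflections which fix the
end points of the lifted tunnel. -/
theorem monodromy_of_isMeridianPair {τ : Tunnel (link p q)} (C : C(I, UCover p q))
    (hC : ∀ u, toSphere hp hpq (C u) = τ.path u) {e : RegCover hp hpq} {x : ↥(link p q)ᶜ}
    (he : regProj hp hpq e = x) {m₁ m₂ : FundamentalGroup ↥(link p q)ᶜ x}
    (hm : IsMeridianPair τ m₁ m₂) : ∃ (k : DihedralGroup p.natAbs) (i j : ZMod p.natAbs),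
      DihedralGroup.sr i • C 0 = C 0 ∧ DihedralGroup.sr j • C 1 = C 1 ∧
      monodromy hp hpq e he m₁ = MulOpposite.op (k * .sr i * k⁻¹) ∧
      monodromy hp hpq e he m₂ = MulOpposite.op (k * .sr j * k⁻¹) := by
  have cov := isQuotientCoveringMap_regProj hp hpq
  have := cov.toContinuousConstSMul
  obtain ⟨b, β, h1, h2⟩ := hm
  let half₁ : C(I, I) := ⟨fun u => ⟨(u : ℝ) / 2, by linarith [u.2.1], by linarith [u.2.2]⟩,
    by fun_prop⟩
  let half₂ : C(I, I) := ⟨fun u => ⟨1 - (u : ℝ) / 2, by linarith [u.2.2], by linarith [u.2.1]⟩,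
    by fun_prop⟩
  have hC1 : ∀ u, toSphere hp hpq (C.comp half₁ u) = τ.path.extend ((u : ℝ) / 2) := fun u => by
    rw [ContinuousMap.comp_apply, hC, ← Path.extend_apply]
    rfl
  have hC2 : ∀ u, toSphere hp hpq (C.comp half₂ u) = τ.path.extend (1 - (u : ℝ) / 2) := fun u => by
    rw [ContinuousMap.comp_apply, hC, ← Path.extend_apply]
    rfl
  have hreg : ∀ u : I, (u : ℝ) ≠ 0 → (u : ℝ) ≠ 1 → C u ∈ toSphere hp hpq ⁻¹' (link p q)ᶜ := by
    intro u h0 h1 h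
    rw [hC, τ.mem_iff] at h
    rcases h with rfl | rfl
    · exact h0 rfl
    · exact h1 rfl
  have hreg₁ : ∀ u : I, 0 < (u : ℝ) → C (half₁ u) ∈ toSphere hp hpq ⁻¹' (link p q)ᶜ :=
    fun u hu => hreg _
      (fun h => by have h' : (u : ℝ) / 2 = 0 := h; linarith)
      (fun h => by have h' : (u : ℝ) / 2 = 1 := h; linarith [u.2.2])
  have hreg₂ : ∀ u : I, 0 < (u : ℝ) → C (half₂ u) ∈ toSphere hp hpq ⁻¹' (link p q)ᶜ :=
    fun u hu => hreg _
      (fun h => by have h' : 1 - (u : ℝ) / 2 = 0 := h; linarith [u.2.2])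
      (fun h => by have h' : 1 - (u : ℝ) / 2 = 1 := h; linarith)
  let e₀ : RegCover hp hpq := ⟨C (half₁ 1), hreg₁ 1 (by simp)⟩
  have he₀ : half₁ 1 = half₂ 1 := Subtype.ext (by simp [half₁, half₂]; norm_num)
  obtain ⟨g₁, l₁, L₁, ⟨i, rfl⟩, hi, hl₁, hL₁⟩ := exists_lift_of_isMeridianAlong
    (C.comp half₁) hC1 (by simpa using (τ.mem_iff 0).2 (Or.inl rfl)) hreg₁ h1 (e := e₀) rfl
  obtain ⟨g₂, l₂, L₂, ⟨j, rfl⟩, hj, hl₂, hL₂⟩ := exists_lift_of_isMeridianAlong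
    (C.comp half₂) hC2 (by simpa using (τ.mem_iff 1).2 (Or.inr rfl)) hreg₂ h2 (e := e₀)
    (congrArg C he₀)
  have h01 : half₁ 0 = 0 := Subtype.ext (by simp [half₁])
  have h02 : half₂ 0 = 1 := Subtype.ext (by simp [half₂])
  rw [ContinuousMap.comp_apply, h01] at hi
  rw [ContinuousMap.comp_apply, h02] at hj
  obtain ⟨e', A, he', hA⟩ := cov.isCoveringMap.exists_path_lift β he
  have hb : regProj hp hpq e₀ = b := by
    rw [← l₁.source, ← hL₁ 0, L₁.source]
  obtain ⟨k, rfl⟩ := cov.apply_eq_iff_mem_orbit.1 (he'.trans hb.symm)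
  refine ⟨k, i, j, hi, hj, ?_, ?_⟩
  · obtain ⟨Γ, hΓ⟩ := cov.exists_lift_conj (g := k * .sr i * k⁻¹) A
      ((L₁.map (continuous_const_smul k)).cast rfl (by
        simp only [smul_smul, inv_mul_cancel_right])) hA (l := l₁) fun t => by
          change regProj hp hpq (k • L₁ t) = _
          rw [cov.map_smul, hL₁]
    rw [fundamentalGroupMulEquivOfPath_eq_loopClass β hl₁]
    exact monodromy_loopClass he _ Γ hΓ
  · obtain ⟨Γ, hΓ⟩ := cov.exists_lift_conj (g := k * .sr j * k⁻¹) A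
      ((L₂.map (continuous_const_smul k)).cast rfl (by
        simp only [smul_smul, inv_mul_cancel_right])) hA (l := l₂) fun t => by
          change regProj hp hpq (k • L₂ t) = _
          rw [cov.map_smul, hL₂]
    rw [fundamentalGroupMulEquivOfPath_eq_loopClass β hl₂]
    exact monodromy_loopClass he _ Γ hΓ

end TwoBridge

/-! ### The lifts of the tunnels -/

namespace TwoBridge

open Topology
open scoped unitInterval

variable {p q : ℤ} {hp : 0 < p} {hpq : IsCoprime p q}

/-- The reflection which fixes a point at level `1` is determined by the coordinate `α`. -/
theorem eq_of_sr_smul_eq_one {x : ℝ × ℝ} {t : Set.Icc (-1 : ℝ) 1} (ht : (t : ℝ) = 1) {a : ℤ}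
    (hx : x.1 = a) {i : ZMod p.natAbs}
    (h : DihedralGroup.sr i • umk p q (x, t) = umk p q (x, t)) : i = -a := by
  obtain ⟨i, rfl⟩ := ZMod.intCast_surjective i
  obtain ⟨-, h, -⟩ := (sr_smul_eq_iff i).1 h
  obtain ⟨m, hm⟩ := h (by simp only [ht]; norm_num)
  simp only [hx] at hm
  have hm' : i + a = p * m := by
    have : (i : ℝ) + a = p * m := by linarith
    exact_mod_cast this
  rw [eq_neg_iff_add_eq_zero]
  exact_mod_cast int_eq_zero_of_dvd ⟨m, hm'⟩

/-- The reflection which fixes a point at level `-1` is determined, up to a rotation of order at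
most two, by the coordinate `β`. -/
theorem eq_of_sr_smul_eq_neg_one (hpq : IsCoprime p q) {x : ℝ × ℝ} {t : Set.Icc (-1 : ℝ) 1}
    (ht : (t : ℝ) = -1) {a b : ℤ} (hx : 2 * x.2 = 2 * q * a + p * b) {i : ZMod p.natAbs}
    (h : DihedralGroup.sr i • umk p q (x, t) = umk p q (x, t)) :
    2 * (i + a) = 0 ∧ (Even b → i = -a) := by
  obtain ⟨i, rfl⟩ := ZMod.intCast_surjective i
  obtain ⟨-, -, h⟩ := (sr_smul_eq_iff i).1 h
  obtain ⟨m, hm⟩ := h (by simp only [ht]; norm_num)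
  simp only at hm
  have hm' : 2 * (q * (i + a)) = p * (2 * m - b) := by
    have : (2 : ℝ) * (q * (i + a)) = p * (2 * m - b) := by linarith
    exact_mod_cast this
  constructor
  · have hd : p ∣ 2 * (i + a) := hpq.dvd_of_dvd_mul_left ⟨2 * m - b, by rw [← hm']; ring⟩
    exact_mod_cast int_eq_zero_of_dvd hd
  · rintro ⟨c, rfl⟩
    have hd : p ∣ i + a := hpq.dvd_of_dvd_mul_left ⟨m - c, by linarith⟩
    rw [eq_neg_iff_add_eq_zero]
    exact_mod_cast int_eq_zero_of_dvd hd

/-- A lift of the long upper tunnel runs from the point `α = 0` of level `1` to the point `α = p`,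
and its ends are fixed by the same reflection. -/
theorem exists_lift_longUpperTunnel (hp : 0 < p) (hpq : IsCoprime p q) (hodd : Odd p) :
    ∃ C : C(I, UCover p q), (∀ u, toSphere hp hpq (C u) = (longUpperTunnel hpq hodd).path u) ∧
      ∀ i j : ZMod p.natAbs, DihedralGroup.sr i • C 0 = C 0 →
        DihedralGroup.sr j • C 1 = C 1 → i = j := by
  refine ⟨⟨fun u => if (u : ℝ) ≤ 1 / 2 then umk p q (coord p q ((0, 1 / 2), downUp u))
    else umk p q (coord p q ((p, q + 1 / 2), downUp u)), ?_⟩, fun u => ?_, fun i j hi hj => ?_⟩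
  · refine Continuous.if_le ?_ ?_ continuous_subtype_val continuous_const fun u hu => ?_
    · exact continuous_umk.comp ((continuous_coord p q).comp
        (continuous_const.prodMk continuous_downUp))
    · exact continuous_umk.comp ((continuous_coord p q).comp
        (continuous_const.prodMk continuous_downUp))
    · have ht : (downUp u : ℝ) = -1 := by simp [downUp, hu]; norm_num
      refine umk_eq_umk.2 ⟨rfl, fun h => absurd ht h, fun _ => ⟨0, ?_⟩⟩
      simp only [coord]
      push_cast
      ring
  · change toSphere hp hpq (if _ then _ else _) = longUpperFun p q u
    unfold longUpperFun
    split_ifs <;> rw [toSphere_umk_coord]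
  · have h0 : ((downUp 0 : Set.Icc (-1 : ℝ) 1) : ℝ) = 1 := by simp [downUp]; norm_num
    have h1 : ((downUp 1 : Set.Icc (-1 : ℝ) 1) : ℝ) = 1 := by simp [downUp]; norm_num
    have n1 : ¬(((1 : I) : ℝ) ≤ 1 / 2) := by norm_num
    have n0 : ((0 : I) : ℝ) ≤ 1 / 2 := by norm_num
    simp only [ContinuousMap.coe_mk, if_pos n0] at hi
    simp only [ContinuousMap.coe_mk, if_neg n1] at hj
    rw [eq_of_sr_smul_eq_one (a := 0) h0 (by simp) hi, eq_of_sr_smul_eq_one (a := p) h1 rfl hj,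
      int_eq_zero_of_dvd dvd_rfl, Int.cast_zero]

/-- A lift of the long lower tunnel runs from the point `β = 0` of level `-1` to the point `β = -p`,
and its ends are fixed by the same reflection. -/
theorem exists_lift_longLowerTunnel (hp : 0 < p) (hpq : IsCoprime p q) (hodd : Odd p) :
    ∃ C : C(I, UCover p q), (∀ u, toSphere hp hpq (C u) = (longLowerTunnel hpq hodd).path u) ∧
      ∀ i j : ZMod p.natAbs, DihedralGroup.sr i • C 0 = C 0 →
        DihedralGroup.sr j • C 1 = C 1 → i = j := by
  refine ⟨⟨fun u => if (u : ℝ) ≤ 1 / 2 then umk p q (coord p q ((p / 2, q / 2), upDown u))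
    else umk p q (coord p q ((p / 2, q / 2 + 1), upDown u)), ?_⟩, fun u => ?_, fun i j hi hj => ?_⟩
  · refine Continuous.if_le ?_ ?_ continuous_subtype_val continuous_const fun u hu => ?_
    · exact continuous_umk.comp ((continuous_coord p q).comp
        (continuous_const.prodMk continuous_upDown))
    · exact continuous_umk.comp ((continuous_coord p q).comp
        (continuous_const.prodMk continuous_upDown))
    · have ht : (upDown u : ℝ) = 1 := by simp [upDown, hu]; norm_num
      exact umk_eq_umk.2 ⟨rfl, fun _ => ⟨0, by simp [coord]⟩, fun h => absurd ht h⟩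
  · change toSphere hp hpq (if _ then _ else _) = longLowerFun p q u
    unfold longLowerFun
    split_ifs <;> rw [toSphere_umk_coord]
  · have h0 : ((upDown 0 : Set.Icc (-1 : ℝ) 1) : ℝ) = -1 := by simp [upDown]; norm_num
    have h1 : ((upDown 1 : Set.Icc (-1 : ℝ) 1) : ℝ) = -1 := by simp [upDown]; norm_num
    have n1 : ¬(((1 : I) : ℝ) ≤ 1 / 2) := by norm_num
    have n0 : ((0 : I) : ℝ) ≤ 1 / 2 := by norm_num
    simp only [ContinuousMap.coe_mk, if_pos n0] at hi
    simp only [ContinuousMap.coe_mk, if_neg n1] at hj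
    rw [(eq_of_sr_smul_eq_neg_one hpq (a := 0) (b := 0) h0 (by simp; ring) hi).2 Even.zero,
      (eq_of_sr_smul_eq_neg_one hpq (a := 0) (b := -2) h1 (by simp; ring) hj).2 ⟨-1, rfl⟩]

/-- A lift of an intermediate tunnel runs from level `1` to level `-1` over a point of the plane,
and its ends are fixed by reflections whose product is a rotation of order at most two. -/
theorem exists_lift_intermediateTunnel (hp : 0 < p) (hpq : IsCoprime p q) (heven : Even p) (k : ℤ) :
    ∃ C : C(I, UCover p q),
      (∀ u, toSphere hp hpq (C u) = (intermediateTunnel hpq heven k).path u) ∧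
      ∀ i j : ZMod p.natAbs, DihedralGroup.sr i • C 0 = C 0 → DihedralGroup.sr j • C 1 = C 1 →
        2 * (j - i) = 0 := by
  refine ⟨⟨fun u => umk p q (coord p q ((k, 1 / 2), down u)), continuous_umk.comp
    ((continuous_coord p q).comp (continuous_const.prodMk continuous_down))⟩,
    fun u => toSphere_umk_coord hp hpq _, fun i j hi hj => ?_⟩
  rw [eq_of_sr_smul_eq_one (a := k) (by simp [down]) rfl hi, sub_neg_eq_add]
  exact (eq_of_sr_smul_eq_neg_one hpq (a := k) (b := -1) (by simp [down]; norm_num)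
    (by push_cast; ring) hj).1

end TwoBridge

/-! ### The `π`-orbifold group and the homology of the double covering -/

namespace TwoBridge

open Topology
open scoped unitInterval

variable {p q : ℤ} {hp : 0 < p} {hpq : IsCoprime p q}

theorem normalClosure_le_ker {e : RegCover hp hpq} {x : ↥(link p q)ᶜ}
    (he : regProj hp hpq e = x) :
    Subgroup.normalClosure {g : FundamentalGroup ↥(link p q)ᶜ x |
      ∃ m, IsMeridian (link p q) x m ∧ g = m ^ 2} ≤ (monodromy hp hpq e he).ker := by
  refine Subgroup.normalClosure_le_normal ?_
  rintro _ ⟨m, hm, rfl⟩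
  obtain ⟨i, hi⟩ := monodromy_of_isMeridian he hm
  rw [SetLike.mem_coe, MonoidHom.mem_ker, map_pow, hi, ← MulOpposite.op_pow, sq,
    DihedralGroup.sr_mul_self, MulOpposite.op_one]

/-- The monodromy homomorphism of the `π`-orbifold group. -/
noncomputable def orbifoldMonodromy {e : RegCover hp hpq} {x : ↥(link p q)ᶜ}
    (he : regProj hp hpq e = x) :
    PiOrbifoldGroup (link p q) x →* (DihedralGroup p.natAbs)ᵐᵒᵖ :=
  QuotientGroup.lift _ (monodromy hp hpq e he) (normalClosure_le_ker he)

theorem orbifoldMonodromy_mk {e : RegCover hp hpq} {x : ↥(link p q)ᶜ}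
    (he : regProj hp hpq e = x) (m : FundamentalGroup ↥(link p q)ᶜ x) :
    orbifoldMonodromy he (QuotientGroup.mk m) = monodromy hp hpq e he m := rfl

theorem monodromy_surjective {e : RegCover hp hpq} {x : ↥(link p q)ᶜ}
    (he : regProj hp hpq e = x) : Function.Surjective (monodromy hp hpq e he) := by
  have := pathConnectedSpace_regCover hp hpq
  exact (isQuotientCoveringMap_regProj hp hpq).fundamentalGroupToMulOpposite_surjective ⟨e, he⟩

theorem exists_loopClass_eq {X : Type*} [TopologicalSpace X] {x : X} (m : FundamentalGroup X x) :
    ∃ l : Path x x, m = loopClass l := by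
  obtain ⟨l, hl⟩ := Quotient.exists_rep (FundamentalGroup.toPath m)
  exact ⟨l, hl.symm⟩

/-- The monodromy identifies the `π`-orbifold group of the two-bridge link with the dihedral group
of order `2p`. -/
theorem orbifoldMonodromy_bijective {e : RegCover hp hpq} {x : ↥(link p q)ᶜ}
    (he : regProj hp hpq e = x) : Function.Bijective (orbifoldMonodromy he) := by
  have cov := isQuotientCoveringMap_regProj hp hpq
  have := pathConnectedSpace_compl_link hp hpq
  refine ⟨(injective_iff_map_eq_one _).2 fun o ho => ?_, fun g => ?_⟩
  · obtain ⟨m, rfl⟩ := QuotientGroup.mk_surjective o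
    obtain ⟨l, rfl⟩ := exists_loopClass_eq m
    rw [orbifoldMonodromy_mk] at ho
    obtain ⟨L, hL⟩ := cov.exists_loop_lift he l ho
    let N := Subgroup.normalClosure {g : FundamentalGroup ↥(link p q)ᶜ x |
      ∃ m, IsMeridian (link p q) x m ∧ g = m ^ 2}
    let T := PathHom.ofHom (QuotientGroup.mk' N)
    refine PathHom.eq_one_of_ofHom_eq_one (QuotientGroup.mk' N) (?_ : T.toFun l = 1)
    have hT : ∀ φ : TubularChart (link p q), T.toFun φ.loop * T.toFun φ.loop = 1 := by
      intro φ
      have h : QuotientGroup.mk' N (loopClass (((PathConnectedSpace.somePath x φ.base).trans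
          φ.loop).trans (PathConnectedSpace.somePath x φ.base).symm) ^ 2) = 1 := by
        rw [QuotientGroup.mk'_apply, QuotientGroup.eq_one_iff]
        exact Subgroup.subset_normalClosure ⟨_, ⟨φ, _, rfl⟩, rfl⟩
      rw [map_pow, sq] at h
      exact congrArg MulOpposite.op h
    rw [← toFun_regProj_loop hp hpq T hT L]
    exact T.congr fun t => (hL t).symm
  · obtain ⟨m, hm⟩ := monodromy_surjective he g
    exact ⟨QuotientGroup.mk m, hm⟩

/-- The monodromy homomorphism of the covering of the double branched covering. -/
noncomputable def doubleMonodromy (hp : 0 < p) (hpq : IsCoprime p q) (e : UCover p q)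
    {y : DoubleCover p q} (he : toDouble hp hpq e = y) :
    FundamentalGroup (DoubleCover p q) y →* (Multiplicative (ZMod p.natAbs))ᵐᵒᵖ :=
  (isQuotientCoveringMap_toDouble hp hpq).fundamentalGroupToMulOpposite ⟨e, he⟩

theorem doubleMonodromy_bijective {e : UCover p q} {y : DoubleCover p q}
    (he : toDouble hp hpq e = y) : Function.Bijective (doubleMonodromy hp hpq e he) := by
  have cov := isQuotientCoveringMap_toDouble hp hpq
  have := pathConnectedSpace_doubleCover hp hpq
  have := pathConnectedSpace_ucover (p := p) (q := q)
  refine ⟨(injective_iff_map_eq_one _).2 fun m hm => ?_,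
    cov.fundamentalGroupToMulOpposite_surjective ⟨e, he⟩⟩
  obtain ⟨l, rfl⟩ := exists_loopClass_eq m
  obtain ⟨L, hL⟩ := cov.exists_loop_lift he l hm
  let T := PathHom.ofHom (MonoidHom.id (FundamentalGroup (DoubleCover p q) y))
  refine PathHom.eq_one_of_ofHom_eq_one (MonoidHom.id _) (?_ : T.toFun l = 1)
  rw [← toFun_ucover_loop (T.comap ⟨_, cov.continuous⟩) L]
  exact T.congr fun t => (hL t).symm

/-- The isomorphism of the first homology of the double branched covering with `ℤ / p`, written
multiplicatively. -/
noncomputable def homologyEquiv (hp : 0 < p) (hpq : IsCoprime p q) (e : UCover p q)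
    {y : DoubleCover p q} (he : toDouble hp hpq e = y) :
    Abelianization (FundamentalGroup (DoubleCover p q) y) ≃* Multiplicative (ZMod p.natAbs) :=
  MulEquiv.ofBijective
    (Abelianization.lift
      ((MulOpposite.opMulEquiv (M := Multiplicative (ZMod p.natAbs))).symm.toMonoidHom.comp
        (doubleMonodromy hp hpq e he))) <| by
    have hb := doubleMonodromy_bijective he
    refine ⟨(injective_iff_map_eq_one _).2 fun a ha => ?_, fun z => ?_⟩
    · obtain ⟨m, rfl⟩ := QuotientGroup.mk_surjective a
      have hm : m = 1 := hb.1 (by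
        rw [map_one]
        exact MulOpposite.unop_injective ha)
      rw [hm]
      rfl
    · obtain ⟨m, hm⟩ := hb.2 (MulOpposite.op z)
      refine ⟨Abelianization.of m, ?_⟩
      rw [Abelianization.lift_apply_of]
      change MulOpposite.unop (doubleMonodromy hp hpq e he m) = z
      rw [hm]
      rfl

theorem homologyEquiv_of {e : UCover p q} {y : DoubleCover p q} (he : toDouble hp hpq e = y)
    (m : FundamentalGroup (DoubleCover p q) y) : homologyEquiv hp hpq e he (Abelianization.of m) =
      (doubleMonodromy hp hpq e he m).unop := rfl

section Inclusion

variable {y : DoubleCover p q} {hy : proj p q y ∉ link p q} {e : UCover p q}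
  (he : toDouble hp hpq e = y)

theorem toSphere_notMem (hy : proj p q y ∉ link p q) (he : toDouble hp hpq e = y) :
    e ∈ toSphere hp hpq ⁻¹' (link p q)ᶜ := by
  subst he
  exact hy

/-- The base point of the regular covering over the one of the double branched covering. -/
def basePoint (hy : proj p q y ∉ link p q) (he : toDouble hp hpq e = y) : RegCover hp hpq :=
  ⟨e, toSphere_notMem hy he⟩

theorem regProj_basePoint (hy : proj p q y ∉ link p q) (he : toDouble hp hpq e = y) :
    regProj hp hpq (basePoint hy he) = ⟨proj p q y, hy⟩ :=
  Subtype.ext (congrArg (proj p q) he)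

/-- The isomorphism of the `π`-orbifold group with the opposite of the dihedral group, by the
monodromy. -/
noncomputable def orbifoldEquiv (hy : proj p q y ∉ link p q) (he : toDouble hp hpq e = y) :
    PiOrbifoldGroup (link p q) ⟨proj p q y, hy⟩ ≃* (DihedralGroup p.natAbs)ᵐᵒᵖ :=
  MulEquiv.ofBijective _ (orbifoldMonodromy_bijective (regProj_basePoint hy he))

/-- The inclusion of the homology of the double branched covering in the `π`-orbifold group: it
corresponds to the inclusion of the rotations in the dihedral group. -/
noncomputable def homologyInclusion (hy : proj p q y ∉ link p q) (he : toDouble hp hpq e = y) :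
    Abelianization (FundamentalGroup (DoubleCover p q) y) →*
      PiOrbifoldGroup (link p q) ⟨proj p q y, hy⟩ :=
  (orbifoldEquiv hy he).symm.toMonoidHom.comp <| (MonoidHom.op (rotation p.natAbs)).comp <|
    (MulOpposite.opMulEquiv (M := Multiplicative (ZMod p.natAbs))).toMonoidHom.comp
      (homologyEquiv hp hpq e he).toMonoidHom

theorem orbifoldEquiv_homologyInclusion (hy : proj p q y ∉ link p q)
    (he : toDouble hp hpq e = y) (a : Abelianization (FundamentalGroup (DoubleCover p q) y)) :
    orbifoldEquiv hy he (homologyInclusion hy he a) =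
      MulOpposite.op (DihedralGroup.r (homologyEquiv hp hpq e he a).toAdd) :=
  (orbifoldEquiv hy he).apply_symm_apply _

theorem exists_homologyInclusion_eq (hy : proj p q y ∉ link p q) (he : toDouble hp hpq e = y)
    {o : PiOrbifoldGroup (link p q) ⟨proj p q y, hy⟩} {i : ZMod p.natAbs}
    (h : orbifoldEquiv hy he o = MulOpposite.op (DihedralGroup.r i)) :
    ∃ a, homologyInclusion hy he a = o := by
  refine ⟨(homologyEquiv hp hpq e he).symm (Multiplicative.ofAdd i),
    (orbifoldEquiv hy he).injective ?_⟩
  rw [orbifoldEquiv_homologyInclusion, MulEquiv.apply_symm_apply, h]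
  rfl

theorem homologyInclusion_injective (hy : proj p q y ∉ link p q) (he : toDouble hp hpq e = y) :
    Function.Injective (homologyInclusion hy he) := by
  intro a b h
  have h' := congrArg (orbifoldEquiv hy he) h
  rw [orbifoldEquiv_homologyInclusion, orbifoldEquiv_homologyInclusion,
    MulOpposite.op_inj, DihedralGroup.r.injEq] at h'
  exact (homologyEquiv hp hpq e he).injective (Multiplicative.toAdd.injective h')

theorem isHOneInclusion_homologyInclusion (hy : proj p q y ∉ link p q)
    (he : toDouble hp hpq e = y) : IsHOneInclusion (link p q) (proj p q) y hy
      (MonoidHom.toAdditive (homologyInclusion hy he)) := by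
  have cov := isQuotientCoveringMap_toDouble hp hpq
  refine ⟨homologyInclusion_injective hy he, ?_, fun l l' hl => ?_⟩
  · rw [AddSubgroup.index_eq_two_iff]
    refine ⟨Additive.ofMul ((orbifoldEquiv hy he).symm (MulOpposite.op (DihedralGroup.sr 0))),
      fun b => ?_⟩
    have key : ∀ o : Additive (PiOrbifoldGroup (link p q) ⟨proj p q y, hy⟩),
        o ∈ (MonoidHom.toAdditive (homologyInclusion hy he)).range ↔
          ∃ i, orbifoldEquiv hy he o.toMul = MulOpposite.op (DihedralGroup.r i) := by
      intro o
      constructor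
      · rintro ⟨a, rfl⟩
        exact ⟨_, orbifoldEquiv_homologyInclusion hy he a.toMul⟩
      · rintro ⟨i, hi⟩
        obtain ⟨a, ha⟩ := exists_homologyInclusion_eq hy he hi
        exact ⟨Additive.ofMul a, ha⟩
    rw [key, key, toMul_add, toMul_ofMul, map_mul, MulEquiv.apply_symm_apply]
    obtain ⟨d, hd⟩ := MulOpposite.op_surjective (orbifoldEquiv hy he b.toMul)
    rw [← hd, ← MulOpposite.op_mul]
    simp only [MulOpposite.op_inj]
    rcases d with i | i
    · refine Or.inr ⟨⟨i, rfl⟩, ?_⟩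
      rintro ⟨j, hj⟩
      rw [DihedralGroup.sr_mul_r] at hj
      cases hj
    · refine Or.inl ⟨⟨_, DihedralGroup.sr_mul_sr _ _⟩, ?_⟩
      rintro ⟨j, hj⟩
      cases hj
  · obtain ⟨g, L, hL⟩ := cov.exists_lift_smul he l
    have hreg : ∀ t, L t ∈ toSphere hp hpq ⁻¹' (link p q)ᶜ := fun t => by
      have h : toSphere hp hpq (L t) = l' t := by
        rw [hl t, ← hL t]
        rfl
      rw [Set.mem_preimage, h]
      exact (l' t).2
    let L' : Path (basePoint hy he) (DihedralGroup.r g.toAdd • basePoint hy he) :=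
      ⟨⟨fun t => ⟨L t, hreg t⟩, by fun_prop⟩, Subtype.ext L.source, Subtype.ext L.target⟩
    have h' := monodromy_loopClass (regProj_basePoint hy he) l' L' fun t => Subtype.ext (by
      rw [hl t, ← hL t]
      rfl)
    refine congrArg Additive.ofMul ((orbifoldEquiv hy he).injective ?_)
    refine (orbifoldEquiv_homologyInclusion hy he (Abelianization.of (loopClass l))).trans ?_
    rw [homologyEquiv_of, doubleMonodromy,
      cov.fundamentalGroupToMulOpposite_loopClass he l g L hL]
    exact h'.symm

end Inclusion

end TwoBridge

/-! ### Meridian pairs in the `π`-orbifold group -/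

/-- Two commuting involutions generate at most four elements. -/
theorem Subgroup.card_le_four_of_closure_pair {G : Type*} [Group G] {a b : G} (ha : a * a = 1)
    (hb : b * b = 1) (hab : (a * b) * (a * b) = 1) (h : Subgroup.closure {a, b} = ⊤) :
    Nat.card G ≤ 4 := by
  classical
  have ha' : a⁻¹ = a := inv_eq_of_mul_eq_one_left ha
  have hb' : b⁻¹ = b := inv_eq_of_mul_eq_one_left hb
  have hba : b * a = a * b := by
    rw [← inv_eq_of_mul_eq_one_left hab, mul_inv_rev, ha', hb']
  have hax : ∀ x, a * (a * x) = x := fun x => by rw [← mul_assoc, ha, one_mul]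
  have hbax : ∀ x, b * (a * x) = a * (b * x) := fun x => by
    rw [← mul_assoc, hba, mul_assoc]
  have key : ∀ x : G, x ∈ ({1, a, b, a * b} : Finset G) := by
    intro x
    have hx : x ∈ Subgroup.closure {a, b} := h ▸ Subgroup.mem_top x
    induction hx using Subgroup.closure_induction with
    | mem x hx => rcases hx with rfl | rfl <;> simp
    | one => simp
    | mul x y _ _ hx hy =>
      simp only [Finset.mem_insert, Finset.mem_singleton] at hx hy
      rcases hx with rfl | rfl | rfl | rfl <;> rcases hy with rfl | rfl | rfl | rfl <;>
        simp [mul_assoc, ha, hb, hba, hax, hbax]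
    | inv x _ hx =>
      simp only [Finset.mem_insert, Finset.mem_singleton] at hx
      rcases hx with rfl | rfl | rfl | rfl <;> simp [ha', hb', hba]
  have hsurj : Function.Surjective fun x : ({1, a, b, a * b} : Finset G) => (x : G) :=
    fun x => ⟨⟨x, key x⟩, rfl⟩
  calc
    Nat.card G ≤ Nat.card ({1, a, b, a * b} : Finset G) := Nat.card_le_card_of_surjective _ hsurj
    _ = ({1, a, b, a * b} : Finset G).card := by
      rw [Nat.card_eq_fintype_card, Fintype.card_coe]
    _ ≤ 4 := Finset.card_le_four

namespace TwoBridge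

open Topology
open scoped unitInterval

variable {p q : ℤ} {hp : 0 < p} {hpq : IsCoprime p q}

/-- Two meridians which act on the regular covering as commuting reflections do not generate the
link group, as they do not generate a dihedral group of order at least six. -/
theorem closure_ne_top (hp3 : 3 ≤ p) {e : RegCover hp hpq} {x : ↥(link p q)ᶜ}
    (he : regProj hp hpq e = x) {m₁ m₂ : FundamentalGroup ↥(link p q)ᶜ x}
    {k : DihedralGroup p.natAbs} {i j : ZMod p.natAbs} (hij : 2 * (j - i) = 0)
    (h₁ : monodromy hp hpq e he m₁ = MulOpposite.op (k * .sr i * k⁻¹))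
    (h₂ : monodromy hp hpq e he m₂ = MulOpposite.op (k * .sr j * k⁻¹)) :
    Subgroup.closure {m₁, m₂} ≠ ⊤ := by
  intro h
  have hmap := congrArg (Subgroup.map (monodromy hp hpq e he)) h
  rw [MonoidHom.map_closure, Set.image_pair,
    Subgroup.map_top_of_surjective _ (monodromy_surjective he)] at hmap
  have inv : ∀ i : ZMod p.natAbs,
      (k * DihedralGroup.sr i * k⁻¹) * (k * DihedralGroup.sr i * k⁻¹) = 1 := by
    intro i
    have : (k * DihedralGroup.sr i * k⁻¹) * (k * DihedralGroup.sr i * k⁻¹) =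
        k * (DihedralGroup.sr i * DihedralGroup.sr i) * k⁻¹ := by group
    rw [this, DihedralGroup.sr_mul_self, mul_one, mul_inv_cancel]
  have hcard := Subgroup.card_le_four_of_closure_pair (by rw [h₁, ← MulOpposite.op_mul, inv]; rfl)
    (by rw [h₂, ← MulOpposite.op_mul, inv]; rfl) (by
      have : (k * DihedralGroup.sr j * k⁻¹ * (k * DihedralGroup.sr i * k⁻¹)) *
          (k * DihedralGroup.sr j * k⁻¹ * (k * DihedralGroup.sr i * k⁻¹)) =
          k * ((DihedralGroup.sr j * DihedralGroup.sr i) *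
            (DihedralGroup.sr j * DihedralGroup.sr i)) * k⁻¹ := by group
      have h0 : i - j + (i - j) = 0 := by linear_combination -hij
      rw [h₁, h₂, ← MulOpposite.op_mul, ← MulOpposite.op_mul, this, DihedralGroup.sr_mul_sr,
        DihedralGroup.r_mul_r, h0, DihedralGroup.r_zero, mul_one, mul_inv_cancel,
        MulOpposite.op_one]) hmap
  rw [Nat.card_congr MulOpposite.opEquiv.symm, DihedralGroup.nat_card] at hcard
  lia

/-- The product of two conjugate reflections is a rotation. -/
theorem exists_conj_sr_mul (k : DihedralGroup p.natAbs) (i j : ZMod p.natAbs) :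
    ∃ d : ZMod p.natAbs, (k * DihedralGroup.sr j * k⁻¹) * (k * DihedralGroup.sr i * k⁻¹) = .r d ∧
      (d = i - j ∨ d = j - i) := by
  have : (k * DihedralGroup.sr j * k⁻¹) * (k * DihedralGroup.sr i * k⁻¹) =
      k * (DihedralGroup.sr j * DihedralGroup.sr i) * k⁻¹ := by group
  rw [this, DihedralGroup.sr_mul_sr]
  rcases k with a | a
  · exact ⟨i - j, by simp, Or.inl rfl⟩
  · exact ⟨j - i, by simp, Or.inr rfl⟩

/-- The class `ω` of a pair of meridians whose tunnel has a given lift to the universal covering: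
the two ends of the lift are fixed by reflections, and `ω` is the rotation which is their product,
up to conjugation. -/
theorem exists_omega {y : DoubleCover p q} {hy : proj p q y ∉ link p q} {e : UCover p q}
    (he : toDouble hp hpq e = y) {τ : Tunnel (link p q)} {C : C(I, UCover p q)}
    (hC : ∀ u, toSphere hp hpq (C u) = τ.path u) {m₁ m₂ : FundamentalGroup ↥(link p q)ᶜ
      ⟨proj p q y, hy⟩} (hm : IsMeridianPair τ m₁ m₂) :
    ∃ (w : HOne (DoubleCover p q) y) (i j : ZMod p.natAbs),
      DihedralGroup.sr i • C 0 = C 0 ∧ DihedralGroup.sr j • C 1 = C 1 ∧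
      MonoidHom.toAdditive (homologyInclusion hy he) w = Additive.ofMul (meridianOmega m₁ m₂) ∧
      (i = j → w = 0) ∧ (2 * (j - i) = 0 → (2 : ℕ) • w = 0 ∧
        (3 ≤ p → Subgroup.closure {m₁, m₂} ≠ ⊤)) := by
  obtain ⟨k, i, j, hi, hj, h₁, h₂⟩ := monodromy_of_isMeridianPair C hC (regProj_basePoint hy he) hm
  obtain ⟨d, hd, hdij⟩ := exists_conj_sr_mul k i j
  have hω : orbifoldEquiv hy he (meridianOmega m₁ m₂) = MulOpposite.op (.r d) := by
    change monodromy hp hpq _ _ (m₁ * m₂) = _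
    rw [map_mul, h₁, h₂, ← MulOpposite.op_mul, hd]
  obtain ⟨a, ha⟩ := exists_homologyInclusion_eq hy he hω
  have had : homologyEquiv hp hpq e he a = Multiplicative.ofAdd d := by
    rw [← ha, orbifoldEquiv_homologyInclusion, MulOpposite.op_inj, DihedralGroup.r.injEq] at hω
    exact Multiplicative.toAdd.injective hω
  refine ⟨Additive.ofMul a, i, j, hi, hj, congrArg Additive.ofMul ha, fun hij => ?_, fun hij => ⟨?_,
    fun hp3 => closure_ne_top hp3 (regProj_basePoint hy he) hij h₁ h₂⟩⟩
  · have hd0 : d = 0 := by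
      subst hij
      rcases hdij with rfl | rfl <;> exact sub_self _
    refine congrArg Additive.ofMul ((homologyEquiv hp hpq e he).injective ?_)
    rw [had, hd0, map_one]
    rfl
  · refine congrArg Additive.ofMul ((homologyEquiv hp hpq e he).injective (?_ : _ = _) : a ^ 2 = 1)
    have h2 : d + d = 0 := by
      rcases hdij with rfl | rfl
      · linear_combination -hij
      · linear_combination hij
    rw [map_pow, map_one, had, sq, ← ofAdd_add, h2]
    rfl

theorem nonempty_hOne_equiv {y : DoubleCover p q} {e : UCover p q}
    (he : toDouble hp hpq e = y) : Nonempty (HOne (DoubleCover p q) y ≃+ ZMod p.natAbs) :=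
  ⟨(MulEquiv.toAdditive (homologyEquiv hp hpq e he)).trans
    (AddEquiv.additiveMultiplicative (ZMod p.natAbs))⟩

/-- An element of order at most two does not generate the homology if `p ≥ 3`. -/
theorem zmultiples_ne_top {A : Type*} [AddGroup A] (hp3 : 3 ≤ p) (f : A ≃+ ZMod p.natAbs) {w : A}
    (hw : (2 : ℕ) • w = 0) : AddSubgroup.zmultiples w ≠ ⊤ := by
  intro h
  have h1 : addOrderOf w = p.natAbs := by
    rw [← Nat.card_zmultiples, h, ← Nat.card_zmod p.natAbs, ← Nat.card_congr f.toEquiv]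
    exact Nat.card_congr AddSubgroup.topEquiv.toEquiv
  have h2 := Nat.le_of_dvd two_pos (addOrderOf_dvd_of_nsmul_eq_zero hw)
  lia

end TwoBridge

theorem proposition5p2 (p q : ℤ) (hp : 0 < p) (hpq : IsCoprime p q)
    (y : TwoBridge.DoubleCover p q) (hy : TwoBridge.proj p q y ∉ TwoBridge.link p q) :
    ∃ ι : HOne (TwoBridge.DoubleCover p q) y →+
        Additive (PiOrbifoldGroup (TwoBridge.link p q) ⟨TwoBridge.proj p q y, hy⟩),
      IsHOneInclusion (TwoBridge.link p q) (TwoBridge.proj p q) y hy ι ∧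
      Nonempty (HOne (TwoBridge.DoubleCover p q) y ≃+ ZMod p.natAbs) ∧
      (∀ hodd : Odd p,
        ∀ m₁ m₂ : FundamentalGroup ↥(TwoBridge.link p q)ᶜ ⟨TwoBridge.proj p q y, hy⟩,
          IsMeridianPair (TwoBridge.longUpperTunnel hpq hodd) m₁ m₂ ∨
            IsMeridianPair (TwoBridge.longLowerTunnel hpq hodd) m₁ m₂ →
          ∃ w : HOne (TwoBridge.DoubleCover p q) y,
            ι w = Additive.ofMul (meridianOmega m₁ m₂) ∧ w = 0 ∧
            (3 ≤ p → AddSubgroup.zmultiples w ≠ ⊤ ∧ Subgroup.closure {m₁, m₂} ≠ ⊤)) ∧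
      (∀ heven : Even p,
        ∀ m₁ m₂ : FundamentalGroup ↥(TwoBridge.link p q)ᶜ ⟨TwoBridge.proj p q y, hy⟩,
          IsMeridianPair (TwoBridge.intermediateLeft hpq heven) m₁ m₂ ∨
            IsMeridianPair (TwoBridge.intermediateRight hpq heven) m₁ m₂ →
          ∃ w : HOne (TwoBridge.DoubleCover p q) y,
            ι w = Additive.ofMul (meridianOmega m₁ m₂) ∧ (2 : ℕ) • w = 0 ∧
            (4 ≤ p → AddSubgroup.zmultiples w ≠ ⊤ ∧ Subgroup.closure {m₁, m₂} ≠ ⊤)) := by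
  obtain ⟨e, he⟩ := (TwoBridge.isQuotientMap_toDouble hp hpq).surjective y
  obtain ⟨f⟩ := TwoBridge.nonempty_hOne_equiv he
  refine ⟨MonoidHom.toAdditive (TwoBridge.homologyInclusion hy he),
    TwoBridge.isHOneInclusion_homologyInclusion hy he, ⟨f⟩, fun hodd m₁ m₂ hm => ?_,
    fun heven m₁ m₂ hm => ?_⟩
  · obtain ⟨τ, C, hC, hfix, hm⟩ : ∃ (τ : Tunnel (TwoBridge.link p q))
        (C : C(unitInterval, TwoBridge.UCover p q)),
        (∀ u, TwoBridge.toSphere hp hpq (C u) = τ.path u) ∧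
        (∀ i j : ZMod p.natAbs, DihedralGroup.sr i • C 0 = C 0 →
          DihedralGroup.sr j • C 1 = C 1 → i = j) ∧ IsMeridianPair τ m₁ m₂ := by
      rcases hm with hm | hm
      · obtain ⟨C, hC, hfix⟩ := TwoBridge.exists_lift_longUpperTunnel hp hpq hodd
        exact ⟨_, C, hC, hfix, hm⟩
      · obtain ⟨C, hC, hfix⟩ := TwoBridge.exists_lift_longLowerTunnel hp hpq hodd
        exact ⟨_, C, hC, hfix, hm⟩
    obtain ⟨w, i, j, hi, hj, hw, h1, h2⟩ := TwoBridge.exists_omega he hC hm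
    obtain rfl := hfix i j hi hj
    obtain ⟨h3, h4⟩ := h2 (by ring)
    exact ⟨w, hw, h1 rfl, fun hp3 => ⟨TwoBridge.zmultiples_ne_top hp3 f h3, h4 hp3⟩⟩
  · obtain ⟨k, hm⟩ : ∃ k, IsMeridianPair (TwoBridge.intermediateTunnel hpq heven k) m₁ m₂ :=
      hm.elim (fun h => ⟨0, h⟩) fun h => ⟨1, h⟩
    obtain ⟨C, hC, hfix⟩ := TwoBridge.exists_lift_intermediateTunnel hp hpq heven k
    obtain ⟨w, i, j, hi, hj, hw, -, h2⟩ := TwoBridge.exists_omega he hC hm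
    obtain ⟨h3, h4⟩ := h2 (hfix i j hi hj)
    exact ⟨w, hw, h3, fun hp4 =>
      ⟨TwoBridge.zmultiples_ne_top (by lia) f h3, h4 (by lia)⟩⟩
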